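/- **Setting.** Let $(W,S)$ be a Coxeter system with $W$ finite, with length function $l$; let $\Gamma$ be an abelian group with a total order compatible with addition, and let $L\colon W\to\Gamma$ be a weight function ($L(ww')=L(w)+L(w')$ whenever $l(ww')=l(w)+l(w')$) with $L(s)>0$ for all $s\in S$. Let $R\subseteq\mathbb{C}$ be a subring with field of fractions $F$, let $A=R[\Gamma]$ be the group ring with $R$-basis $\{\varepsilon^g\mid g\in\Gamma\}$, and let $K$ be its field of fractions. Let $\mathbf{H}$ be the generic Iwahori–Hecke algebra over $A$, with $A$-basis $\{T_w\mid w\in W\}$ and, for $s\in S$, $v_s=\varepsilon^{L(s)}$: $T_sT_w=T_{sw}$ if $l(sw)>l(w)$, and $T_sT_w=T_{sw}+(v_s-v_s^{-1})T_w$ if $l(sw)<l(w)$. *Kazhdan–Lusztig basis.* Let $a\mapsto\bar a$ be the ring involution of $A$ with $\overline{\varepsilon^g}=\varepsilon^{-g}$, extended to $\mathbf{H}$ by $\overline{\sum a_wT_w}=\sum\bar a_wT_{w^{-1}}^{-1}$. Let $C'_w$ be the unique bar-invariant element of the form $T_w+\sum_y p_{y,w}T_y$ with all $p_{y,w}\in\mathbb{Z}[\Gamma_{<0}]$,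 and let $\mathbf{C}_w=(C'_w)^\dagger$, where $\dagger$ is the $A$-algebra automorphism with $T_s^\dagger=-T_s^{-1}$ $(s\in S)$. The $\mathbf{C}_w$ form an $A$-basis of $\mathbf{H}$; write $\mathbf{C}_x\mathbf{C}_y=\sum_z h_{x,y,z}\mathbf{C}_z$. Let $\leq_{\mathcal{LR}}$ be the reflexive and transitive closure of the relation "$\mathbf{C}_y$ occurs with non-zero coefficient in $\mathbf{C}_s\mathbf{C}_w$ or in $\mathbf{C}_w\mathbf{C}_s$ for some $s\in S$" between $y$ and $w$, and let $y\sim_{\mathcal{LR}}w$ mean $y\leq_{\mathcal{LR}}w$ and $w\leq_{\mathcal{LR}}y$. *Balanced representations.* Every $0\neq x\in K$ can be written $x=r_x\varepsilon^{g_x}(1+p)/(1+q)$ with $p,q\in F[\Gamma_{>0}]$ and unique $0\neq r_x\in F$, $g_x\in\Gamma$. Let $\mathcal{O}=\{0\}\cup\{x\neq 0\mid g_x\geq0\}$; the constant term of $x\in\mathcal{O}$ is $r_x$ if $x\ne0$ and $g_x=0$, and $0$ otherwise. Let $\{E^\lambda\mid\lambda\in\Lambda\}$ be the irreducible representations of $W$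 up to isomorphism, $d_\lambda=\dim E^\lambda$. For every $\lambda$ let $\rho^\lambda\colon K\otimes_A\mathbf{H}\to M_{d_\lambda}(K)$ be a matrix representation affording the representation $E^\lambda_\varepsilon$ that corresponds to $E^\lambda$, i.e. $\operatorname{trace}\rho^\lambda(T_w)\in A$ is mapped to $\operatorname{trace}(w,E^\lambda)$ by the ring homomorphism $A\to R$, $\varepsilon^g\mapsto1$, for all $w\in W$. Define $\mathbf{c}_\lambda$ by $d_\lambda\mathbf{c}_\lambda=\sum_w\operatorname{trace}\rho^\lambda(T_w)\operatorname{trace}\rho^\lambda(T_{w^{-1}})$, and $f_\lambda\in F$, $\mathbf{a}_\lambda\in\Gamma$ by $\mathbf{c}_\lambda=f_\lambda\varepsilon^{-2\mathbf{a}_\lambda}+{}$higher terms, $f_\lambda\neq0$. Assume that each $\rho^\lambda$ is balanced, i.e. $\varepsilon^{\mathbf{a}_\lambda}\rho^\lambda_{ij}(T_w)\in\mathcal{O}$ for all $w,i,j$, and let $c^{ij}_{w,\lambda}\in F$ be the constant term of $(-1)^{l(w)}\varepsilon^{\mathbf{a}_\lambda}\rho^\lambda_{ij}(T_w)$. Assume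 that $R$ is $L$-good: $2\cos(2\pi/m_{st})\in R$ for all $s,t\in S$, where $m_{st}$ is the order of $st$, and every $f_\lambda$ is contained and invertible in $R$. *The ring $\tilde{\mathbf{J}}$.* Put $\tilde\gamma_{x,y,z}=\sum_\lambda\sum_{i,j,k}f_\lambda^{-1}c^{ij}_{x,\lambda}c^{jk}_{y,\lambda}c^{ki}_{z,\lambda}$, $\tilde n_w=\sum_\lambda\sum_i f_\lambda^{-1}c^{ii}_{w^{-1},\lambda}$ and $\tilde{\mathcal{D}}=\{w\in W\mid\tilde n_w\neq0\}$. Let $\tilde{\mathbf{J}}$ be the $F$-algebra with basis $\{t_w\mid w\in W\}$, product $t_xt_y=\sum_z\tilde\gamma_{x,y,z^{-1}}t_z$ and identity element $\sum_{d\in\tilde{\mathcal{D}}}\tilde n_dt_d$. Let $\tilde{\mathbf{J}}_A\subseteq K\otimes_F\tilde{\mathbf{J}}$ be the $A$-span of the $t_w$, and let $h\in\mathbf{H}$ act on it by left multiplication transported via $\mathbf{C}_w\leftrightarrow t_w$, so that $\mathbf{C}_x.t_y=\sum_zh_{x,y,z}t_z$. **Theorem** (Lusztig). Assume that $\widetilde{\mathrm{P15}}$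 holds: if $x,x',y,w\in W$ and $w\sim_{\mathcal{LR}}y$, then $$\sum_{u\in W}\tilde\gamma_{w,x',u^{-1}}\,h_{x,u,y}=\sum_{u\in W}h_{x,w,u}\,\tilde\gamma_{u,x',y^{-1}}.$$ Then there is a unique unital $A$-algebra homomorphism $\phi\colon\mathbf{H}\to\tilde{\mathbf{J}}_A$ such that, for all $h\in\mathbf{H}$ and $w\in W$, the difference $\phi(h)t_w-h.t_w$ is an $A$-linear combination of terms $t_y$ with $y\leq_{\mathcal{LR}}w$ and $y\not\sim_{\mathcal{LR}}w$. Explicitly, $$\phi(\mathbf{C}_w)=\sum_{\substack{z\in W,\ d\in\tilde{\mathcal{D}}\\ z\sim_{\mathcal{LR}}d}}h_{w,d,z}\,\tilde n_d\,t_z\qquad(w\in W).$$ -/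

import Mathlib

noncomputable section

namespace KLAsym

open scoped Classical

section Exchange

theorem end_mul_apply {X : Type*} (f g : Function.End X) (p : X) : (f * g) p = f (g p) := rfl

variable {B W : Type*} [Group W] {M : CoxeterMatrix B} (cs : CoxeterSystem M W)

/-- The action of a simple reflection on pairs `(t, e)`. -/
def signedConj (i : B) : Function.End (W × ZMod 2) := fun p =>
  (cs.simple i * p.1 * cs.simple i, p.2 + if p.1 = cs.simple i then 1 else 0)

theorem signedConj_pow (i i' : B) (k : ℕ) (p : W × ZMod 2) :
    ((signedConj cs i * signedConj cs i') ^ k) p =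
      ((cs.simple i * cs.simple i') ^ k * p.1 * ((cs.simple i * cs.simple i') ^ k)⁻¹,
        p.2 + ∑ j ∈ Finset.range (2 * k),
          if p.1 = ((cs.simple i * cs.simple i') ^ j)⁻¹ * cs.simple i' then (1 : ZMod 2) else 0) := by
  set a := cs.simple i with ha
  set b := cs.simple i' with hb
  have haa : a * a = 1 := cs.simple_mul_simple_self i
  have hbb : b * b = 1 := cs.simple_mul_simple_self i'
  have ha' : a⁻¹ = a := inv_eq_of_mul_eq_one_left haa
  have hb' : b⁻¹ = b := inv_eq_of_mul_eq_one_left hbb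
  have hcomm : ∀ k : ℕ, b * (a * b) ^ k = ((a * b) ^ k)⁻¹ * b := by
    intro k
    induction k with
    | zero => simp
    | succ k ih =>
      rw [pow_succ, ← mul_assoc, ih, ← pow_succ, pow_succ', mul_inv_rev, mul_inv_rev, ha', hb']
      simp only [mul_assoc]
  induction k with
  | zero => simp [Function.End.one_def]
  | succ k ih =>
    rw [pow_succ', end_mul_apply, ih, end_mul_apply]
    simp only [signedConj, ← ha, ← hb]
    set r := a * b with hr
    have hrinv : r⁻¹ = b * a := by rw [hr, mul_inv_rev, ha', hb']
    refine Prod.ext ?_ ?_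
    · simp only [pow_succ', mul_inv_rev, hrinv]
      simp only [hr, mul_assoc]
    · have e1 : (r ^ k * p.1 * (r ^ k)⁻¹ = b) ↔ p.1 = (r ^ (2 * k))⁻¹ * b := by
        rw [mul_inv_eq_iff_eq_mul, hcomm, ← eq_inv_mul_iff_mul_eq, ← mul_assoc, ← mul_inv_rev,
          ← pow_add, two_mul]
      have e2 : (b * (r ^ k * p.1 * (r ^ k)⁻¹) * b = a) ↔
          p.1 = (r ^ (2 * k + 1))⁻¹ * b := by
        have : (b * (r ^ k * p.1 * (r ^ k)⁻¹) * b = a) ↔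
            (r ^ k * p.1 * (r ^ k)⁻¹ = r⁻¹ * b) := by
          constructor
          · intro h
            rw [hrinv, ← h]
            simp only [mul_assoc, hbb, mul_one]
            rw [← mul_assoc b b, hbb, one_mul]
          · intro h
            rw [h, hrinv]
            simp only [mul_assoc, hbb, mul_one]
            rw [← mul_assoc b b, hbb, one_mul]
        rw [this, mul_inv_eq_iff_eq_mul, mul_assoc, hcomm, ← eq_inv_mul_iff_mul_eq,
          ← mul_assoc, ← mul_assoc]
        congr! 2
        rw [← mul_inv_rev, ← mul_inv_rev]
        congr 1
        rw [← pow_succ', ← pow_add]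
        congr 1
        ring
      rw [show 2 * (k + 1) = 2 * k + 1 + 1 by ring, Finset.sum_range_succ, Finset.sum_range_succ]
      simp only [e1, e2, add_assoc]

theorem signedConj_liftable : M.IsLiftable (signedConj cs) := by
  intro i i'
  funext p
  rw [signedConj_pow, cs.simple_mul_simple_pow]
  rw [two_mul, Finset.sum_range_add]
  have : ∀ j, (cs.simple i * cs.simple i') ^ (M i i' + j) = (cs.simple i * cs.simple i') ^ j := by
    intro j
    rw [pow_add, cs.simple_mul_simple_pow, one_mul]
  simp only [this]
  rw [CharTwo.add_self_eq_zero]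
  simp [Function.End.one_def]

theorem signedConj_wordProd (ω : List B) (p : W × ZMod 2) :
    cs.lift ⟨signedConj cs, signedConj_liftable cs⟩ (cs.wordProd ω) p =
      (cs.wordProd ω * p.1 * (cs.wordProd ω)⁻¹, p.2 + ((cs.rightInvSeq ω).count p.1 : ℕ)) := by
  induction ω with
  | nil => simp [Function.End.one_def]
  | cons i ω ih =>
    rw [cs.wordProd_cons, map_mul, end_mul_apply, ih,
      cs.lift_apply_simple]
    simp only [signedConj, CoxeterSystem.rightInvSeq, List.count_cons, beq_iff_eq]
    refine Prod.ext (by simp [mul_assoc]) ?_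
    have : (cs.wordProd ω * p.1 * (cs.wordProd ω)⁻¹ = cs.simple i) ↔
        ((cs.wordProd ω)⁻¹ * cs.simple i * cs.wordProd ω = p.1) := by
      rw [mul_inv_eq_iff_eq_mul, mul_assoc, inv_mul_eq_iff_eq_mul, eq_comm]
    simp only [this]
    push_cast
    rw [add_assoc]

/-- If `s w` and `w t` are both longer than `w`, but `s w t` is not longer than them,
then `s w = w t`. -/
theorem simple_mul_eq_mul_simple {w : W} {i j : B}
    (h1 : cs.length w < cs.length (w * cs.simple j))
    (h2 : cs.length (cs.simple i * w * cs.simple j) < cs.length (cs.simple i * w)) :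
    cs.simple i * w = w * cs.simple j := by
  set Φ := cs.lift ⟨signedConj cs, signedConj_liftable cs⟩ with hΦ
  -- the sign is trivial when `t` is not a right descent
  have key : ∀ v : W, cs.length v < cs.length (v * cs.simple j) →
      ∀ e : ZMod 2, (Φ v (cs.simple j, e)).2 = e := by
    intro v hv e
    obtain ⟨ω, hω, rfl⟩ := cs.exists_isReduced v
    rw [hΦ, signedConj_wordProd]
    have : cs.simple j ∉ cs.rightInvSeq ω := fun hm =>
      absurd (cs.isRightInversion_of_mem_rightInvSeq hω hm).2 (by omega)
    simp [List.count_eq_zero.2 this]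
  have hsimp : ∀ (i : B) (p : W × ZMod 2), Φ (cs.simple i) p = signedConj cs i p := by
    intro i p
    rw [hΦ, cs.lift_apply_simple]
  have hA : (Φ (cs.simple i * w) (cs.simple j, 0)).2 = 1 := by
    have h3 : cs.simple i * w = (cs.simple i * w * cs.simple j) * cs.simple j := by simp
    rw [h3, map_mul, end_mul_apply, hsimp]
    have : signedConj cs j (cs.simple j, 0) = (cs.simple j, 1) := by simp [signedConj]
    rw [this]
    exact key _ (by simpa using h2) 1
  rw [map_mul, end_mul_apply, hsimp] at hA
  have h4 : Φ w (cs.simple j, 0) = (w * cs.simple j * w⁻¹, 0) := by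
    refine Prod.ext ?_ (key w h1 0)
    obtain ⟨ω, hω, rfl⟩ := cs.exists_isReduced w
    rw [hΦ, signedConj_wordProd]
  rw [h4] at hA
  simp only [signedConj, zero_add] at hA
  split_ifs at hA with h5
  · rw [← h5]; simp
  · simp at hA

end Exchange

/-- A weight function `L : W → Γ` on a Coxeter group: `L (w w') = L w + L w'` whenever
`ℓ (w w') = ℓ w + ℓ w'`. -/
structure WeightFunction {B W : Type*} [Group W] {M : CoxeterMatrix B} (cs : CoxeterSystem M W)
    (Γ : Type*) [AddCommGroup Γ] where
  toFun : W → Γ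
  map_mul' : ∀ w w' : W, cs.length (w * w') = cs.length w + cs.length w' →
    toFun (w * w') = toFun w + toFun w'

instance {B W : Type*} [Group W] {M : CoxeterMatrix B} (cs : CoxeterSystem M W)
    (Γ : Type*) [AddCommGroup Γ] : CoeFun (WeightFunction cs Γ) (fun _ => W → Γ) :=
  ⟨WeightFunction.toFun⟩

section HeckeAlgebra

variable {B W Γ : Type*} [Group W] {M : CoxeterMatrix B} {cs : CoxeterSystem M W}
  [AddCommGroup Γ] (R : Type*) [CommRing R] (L : WeightFunction cs Γ)

/-- The element `ε^g` of `R[Γ]`. -/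
def eps (g : Γ) : AddMonoidAlgebra R Γ := AddMonoidAlgebra.single g 1

/-- `v_s - v_s⁻¹`, where `v_s = ε^{L(s)}`. -/
def xi (i : B) : AddMonoidAlgebra R Γ := eps R (L (cs.simple i)) - eps R (-L (cs.simple i))

/-- Left multiplication by `T_s` on the free module with basis `W`:
`T_w ↦ T_{sw}` if `ℓ(sw) > ℓ(w)`, and `T_w ↦ T_{sw} + (v_s - v_s⁻¹) T_w` otherwise. -/
def leftOp (i : B) : Module.End (AddMonoidAlgebra R Γ) (W →₀ AddMonoidAlgebra R Γ) :=
  Finsupp.linearCombination (AddMonoidAlgebra R Γ) fun w =>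
    if cs.length w < cs.length (cs.simple i * w) then Finsupp.single (cs.simple i * w) 1
    else Finsupp.single (cs.simple i * w) 1 + xi R L i • Finsupp.single w 1

/-- Right multiplication by `T_s` on the free module with basis `W`. -/
def rightOp (j : B) : Module.End (AddMonoidAlgebra R Γ) (W →₀ AddMonoidAlgebra R Γ) :=
  Finsupp.linearCombination (AddMonoidAlgebra R Γ) fun w =>
    if cs.length w < cs.length (w * cs.simple j) then Finsupp.single (w * cs.simple j) 1
    else Finsupp.single (w * cs.simple j) 1 + xi R L j • Finsupp.single w 1

/-- The generic Iwahori-Hecke algebra over `R[Γ]` attached to the weight function `L`, realised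
through its left regular representation. It is free with basis `heckeT`, whose multiplication rule
is `heckeT_simple_mul`. -/
def Hecke : Type _ :=
  Algebra.adjoin (AddMonoidAlgebra R Γ) (Set.range (leftOp R L))

instance : Ring (Hecke R L) := inferInstanceAs (Ring (Subalgebra.toSubring
  (R := AddMonoidAlgebra R Γ) (A := Module.End (AddMonoidAlgebra R Γ) (W →₀ AddMonoidAlgebra R Γ))
  (Algebra.adjoin (AddMonoidAlgebra R Γ) (Set.range (leftOp R L)))))

instance : Algebra (AddMonoidAlgebra R Γ) (Hecke R L) :=
  inferInstanceAs (Algebra (AddMonoidAlgebra R Γ)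
    (Algebra.adjoin (AddMonoidAlgebra R Γ) (Set.range (leftOp R L))))

/-- The generator `T_s`. -/
def heckeGen (i : B) : Hecke R L :=
  ⟨leftOp R L i, Algebra.subset_adjoin (Set.mem_range_self i)⟩

theorem leftOp_single (i : B) (w : W) :
    leftOp R L i (Finsupp.single w 1) =
      if cs.length w < cs.length (cs.simple i * w) then Finsupp.single (cs.simple i * w) 1
      else Finsupp.single (cs.simple i * w) 1 + xi R L i • Finsupp.single w 1 := by
  simp [leftOp, Finsupp.linearCombination_single]

theorem rightOp_single (j : B) (w : W) :
    rightOp R L j (Finsupp.single w 1) =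
      if cs.length w < cs.length (w * cs.simple j) then Finsupp.single (w * cs.simple j) 1
      else Finsupp.single (w * cs.simple j) 1 + xi R L j • Finsupp.single w 1 := by
  simp [rightOp, Finsupp.linearCombination_single]

theorem xi_eq {w : W} {i j : B} (h : cs.simple i * w = w * cs.simple j)
    (hl : cs.length w < cs.length (cs.simple i * w)) : xi R L i = xi R L j := by
  have h1 := L.map_mul' (cs.simple i) w (by
    rcases cs.length_simple_mul w i with h' | h' <;> simp <;> omega)
  have h2 := L.map_mul' w (cs.simple j) (by
    rw [← h]
    rcases cs.length_simple_mul w i with h' | h' <;> simp <;> omega)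
  have : L (cs.simple i) = L (cs.simple j) := by
    have h3 : L.toFun (cs.simple i) + L.toFun w = L.toFun w + L.toFun (cs.simple j) := by
      rw [← h1, ← h2, h]
    rw [add_comm] at h3
    exact add_left_cancel h3
  simp only [xi, this]

theorem leftOp_rightOp (i j : B) (x : W →₀ AddMonoidAlgebra R Γ) :
    leftOp R L i (rightOp R L j x) = rightOp R L j (leftOp R L i x) := by
  suffices h : leftOp R L i ∘ₗ rightOp R L j = rightOp R L j ∘ₗ leftOp R L i from
    LinearMap.congr_fun h x
  refine Finsupp.lhom_ext' fun w => LinearMap.ext_ring ?_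
  simp only [LinearMap.comp_apply, Finsupp.lsingle_apply]
  have hr1 := cs.length_simple_mul (w * cs.simple j) i
  have hr2 := cs.length_mul_simple (cs.simple i * w) j
  rw [← mul_assoc] at hr1
  have hpos : ∀ {b c : ℕ}, b < c → ¬ c < b := fun h => by omega
  rcases cs.length_simple_mul w i with hi | hi <;>
  rcases cs.length_mul_simple w j with hj | hj
  · -- both `s w` and `w t` are longer
    have ci : cs.length w < cs.length (cs.simple i * w) := by omega
    have cj : cs.length w < cs.length (w * cs.simple j) := by omega
    rw [rightOp_single, leftOp_single, if_pos ci, if_pos cj, leftOp_single, rightOp_single,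
      ← mul_assoc]
    by_cases hr : cs.length (cs.simple i * w) < cs.length (cs.simple i * w * cs.simple j)
    · rw [if_pos hr, if_pos (by omega)]
    · rw [if_neg hr, if_neg (by omega)]
      have h := simple_mul_eq_mul_simple cs cj (i := i) (by omega)
      rw [xi_eq R L h ci, h]
  · have ci : cs.length w < cs.length (cs.simple i * w) := by omega
    have cj : ¬ cs.length w < cs.length (w * cs.simple j) := by omega
    rw [rightOp_single, leftOp_single, if_pos ci, if_neg cj, map_add, map_smul, leftOp_single,
      leftOp_single, rightOp_single, if_pos ci, ← mul_assoc, if_pos (by omega),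
      if_neg (by omega)]
  · have ci : ¬ cs.length w < cs.length (cs.simple i * w) := by omega
    have cj : cs.length w < cs.length (w * cs.simple j) := by omega
    rw [rightOp_single, leftOp_single, if_neg ci, if_pos cj, map_add, map_smul, leftOp_single,
      rightOp_single, rightOp_single, if_pos cj, ← mul_assoc, if_neg (by omega),
      if_pos (by omega)]
  · have ci : ¬ cs.length w < cs.length (cs.simple i * w) := by omega
    have cj : ¬ cs.length w < cs.length (w * cs.simple j) := by omega
    rw [rightOp_single, leftOp_single, if_neg ci, if_neg cj, map_add, map_add, map_smul, map_smul,
      leftOp_single, leftOp_single, rightOp_single, rightOp_single, if_neg ci, if_neg cj,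
      ← mul_assoc]
    by_cases hr : cs.length (cs.simple i * w) < cs.length (cs.simple i * w * cs.simple j)
    · rw [if_pos hr, if_pos (by omega)]
      have h := simple_mul_eq_mul_simple cs (w := cs.simple i * w) (i := i) hr (by
        rw [cs.simple_mul_simple_cancel_left]; omega)
      have hx := xi_eq R L h (by rw [cs.simple_mul_simple_cancel_left]; omega)
      rw [cs.simple_mul_simple_cancel_left] at h
      have h' : w * cs.simple j = cs.simple i * w := by
        conv_lhs => rw [h]
        rw [cs.simple_mul_simple_cancel_right]
      rw [hx, h']
    · rw [if_neg hr, if_neg (by omega)]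
      simp only [smul_add, smul_smul]
      rw [mul_comm (xi R L i)]
      abel

theorem hecke_rightOp (h : Hecke R L) (j : B) (x : W →₀ AddMonoidAlgebra R Γ) :
    h.1 (rightOp R L j x) = rightOp R L j (h.1 x) := by
  obtain ⟨f, hf⟩ := h
  suffices hh : Commute (rightOp R L j) f from (LinearMap.congr_fun hh x).symm
  refine Algebra.adjoin_induction (fun y hy => ?_) (fun a => ?_) (fun _ _ _ _ => Commute.add_right)
    (fun _ _ _ _ => Commute.mul_right) hf
  · obtain ⟨i, rfl⟩ := hy
    exact LinearMap.ext fun x => (leftOp_rightOp R L i j x).symm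
  · exact Algebra.commute_algebraMap_right a _

/-- Evaluation of operators at the basis vector of the identity. -/
def heckeEval : Hecke R L →ₗ[AddMonoidAlgebra R Γ] (W →₀ AddMonoidAlgebra R Γ) :=
  (LinearMap.applyₗ (Finsupp.single (1 : W) (1 : AddMonoidAlgebra R Γ))) ∘ₗ
    (Algebra.adjoin (AddMonoidAlgebra R Γ) (Set.range (leftOp R L))).val.toLinearMap

theorem heckeEval_apply (h : Hecke R L) : heckeEval R L h = h.1 (Finsupp.single 1 1) := rfl

theorem heckeEval_bijective : Function.Bijective (heckeEval R L) := by
  constructor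
  · refine (injective_iff_map_eq_zero (heckeEval R L)).2 fun h hh => ?_
    rw [heckeEval_apply] at hh
    refine Subtype.ext (Finsupp.lhom_ext' fun w => LinearMap.ext_ring ?_)
    simp only [LinearMap.comp_apply, Finsupp.lsingle_apply]
    change h.1 (Finsupp.single w 1) = 0
    induction hn : cs.length w generalizing w with
    | zero =>
      rw [cs.length_eq_zero_iff] at hn
      rw [hn, hh]
    | succ n ih =>
      have hw : w ≠ 1 := by rintro rfl; simp at hn
      obtain ⟨j, hj⟩ := cs.exists_rightDescent_of_ne_one hw
      rw [cs.isRightDescent_iff] at hj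
      have := rightOp_single R L j (w * cs.simple j)
      rw [cs.simple_mul_simple_cancel_right, if_pos (by omega)] at this
      rw [← this, hecke_rightOp, ih _ (by omega), map_zero]
  · have key : ∀ w : W, ∃ h : Hecke R L, heckeEval R L h = Finsupp.single w 1 := by
      intro w
      induction hn : cs.length w generalizing w with
      | zero =>
        rw [cs.length_eq_zero_iff] at hn
        exact ⟨1, by rw [hn]; rfl⟩
      | succ n ih =>
        have hw : w ≠ 1 := by rintro rfl; simp at hn
        obtain ⟨i, hi⟩ := cs.exists_leftDescent_of_ne_one hw
        rw [cs.isLeftDescent_iff] at hi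
        have h1 := leftOp_single R L i (cs.simple i * w)
        rw [cs.simple_mul_simple_cancel_left, if_pos (by omega)] at h1
        obtain ⟨h, hh⟩ := ih (cs.simple i * w) (by omega)
        refine ⟨heckeGen R L i * h, ?_⟩
        rw [← h1, ← hh]
        rfl
    intro x
    induction x using Finsupp.induction_linear with
    | zero => exact ⟨0, map_zero _⟩
    | add x y hx hy =>
      obtain ⟨a, rfl⟩ := hx
      obtain ⟨b, rfl⟩ := hy
      exact ⟨a + b, map_add _ _ _⟩
    | single w a =>
      obtain ⟨h, hh⟩ := key w
      exact ⟨a • h, by rw [map_smul, hh, Finsupp.smul_single, smul_eq_mul, mul_one]⟩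

/-- The standard basis `T_w` of the Iwahori-Hecke algebra. -/
def heckeT : Module.Basis W (AddMonoidAlgebra R Γ) (Hecke R L) :=
  Module.Basis.ofRepr (LinearEquiv.ofBijective (heckeEval R L) (heckeEval_bijective R L))

theorem heckeEval_heckeT (w : W) : heckeEval R L (heckeT R L w) = Finsupp.single w 1 :=
  (heckeT R L).repr_self w

theorem heckeT_one : heckeT R L 1 = 1 := by
  refine (heckeEval_bijective R L).1 ?_
  rw [heckeEval_heckeT]
  rfl

/-- The multiplication rule of the Iwahori-Hecke algebra. -/
theorem heckeT_simple_mul (i : B) (w : W) :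
    heckeT R L (cs.simple i) * heckeT R L w =
      if cs.length w < cs.length (cs.simple i * w) then heckeT R L (cs.simple i * w)
      else heckeT R L (cs.simple i * w) + xi R L i • heckeT R L w := by
  have h0 : heckeT R L (cs.simple i) = heckeGen R L i := by
    refine (heckeEval_bijective R L).1 ?_
    rw [heckeEval_heckeT, heckeEval_apply, heckeGen, leftOp_single, mul_one, if_pos (by simp)]
  refine (heckeEval_bijective R L).1 ?_
  have h1 : heckeEval R L (heckeT R L (cs.simple i) * heckeT R L w) =
      leftOp R L i (Finsupp.single w 1) := by
    rw [← heckeEval_heckeT R L w, h0]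
    rfl
  rw [h1, leftOp_single]
  split_ifs
  · rw [heckeEval_heckeT]
  · rw [map_add, map_smul, heckeEval_heckeT, heckeEval_heckeT]

end HeckeAlgebra

section KazhdanLusztig

variable {B W Γ : Type*} [Group W] [Fintype W] {M : CoxeterMatrix B} {cs : CoxeterSystem M W}
  [AddCommGroup Γ] [LinearOrder Γ] [IsOrderedAddMonoid Γ] (R : Subring ℂ) (L : WeightFunction cs Γ)

/-- The ring involution `ε^g ↦ ε^{-g}` of `R[Γ]`. -/
def barA (a : AddMonoidAlgebra R Γ) : AddMonoidAlgebra R Γ :=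
  a.coeff.sum fun g r => AddMonoidAlgebra.single (-g) r

/-- The bar involution: the sum of the `a_w T_w` goes to the sum of the `ā_w (T_{w⁻¹})⁻¹`. -/
def barH (h : Hecke R L) : Hecke R L :=
  ∑ w : W, barA R ((heckeT R L).repr h w) • Ring.inverse (heckeT R L w⁻¹)

/-- Membership in `ℤ[Γ_{<0}]`. -/
def IsIntNeg (a : AddMonoidAlgebra R Γ) : Prop :=
  ∀ g : Γ, (∃ n : ℤ, a.coeff g = n) ∧ (a.coeff g ≠ 0 → g < 0)

/-- The two conditions that characterise `C'_w`: it is fixed by the bar involution, and it is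
`T_w` plus a `ℤ[Γ_{<0}]`-linear combination of the `T_y`. -/
def IsKLElement (w : W) (c : Hecke R L) : Prop :=
  barH R L c = c ∧ ∀ y : W, IsIntNeg R ((heckeT R L).repr c y - if y = w then 1 else 0)

/-- The Kazhdan-Lusztig basis element `C'_w`. -/
def klC' (w : W) : Hecke R L := Classical.epsilon (IsKLElement R L w)

/-- The `A`-algebra automorphism `†` of the Hecke algebra with `T_s† = -T_s⁻¹`. On the standard
basis it is given by `T_w† = (-1)^{ℓ(w)} (T_{w⁻¹})⁻¹`. -/
def dagger : Hecke R L →ₗ[AddMonoidAlgebra R Γ] Hecke R L :=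
  (heckeT R L).constr (AddMonoidAlgebra R Γ) fun w =>
    (-1) ^ cs.length w * Ring.inverse (heckeT R L w⁻¹)

/-- The Kazhdan-Lusztig basis element `C_w = (C'_w)†`. -/
def klC (w : W) : Hecke R L := dagger R L (klC' R L w)

/-- The coordinates of an element of the Hecke algebra in the basis `C_w`. -/
def klCoord (h : Hecke R L) : W → AddMonoidAlgebra R Γ :=
  Classical.epsilon fun c => h = ∑ z : W, c z • klC R L z

/-- The structure constants `h_{x,y,z}`, where `C_x C_y` is the sum of the `h_{x,y,z} C_z`. -/
def hConst (x y z : W) : AddMonoidAlgebra R Γ := klCoord R L (klC R L x * klC R L y) z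

/-- `C_y` occurs in `C_s C_w` or in `C_w C_s`, for some simple reflection `s`. -/
def stepLR (y w : W) : Prop :=
  ∃ i : B, hConst R L (cs.simple i) w y ≠ 0 ∨ hConst R L w (cs.simple i) y ≠ 0

/-- The Kazhdan-Lusztig preorder `y ≤_LR w`. -/
def leLR (y w : W) : Prop := Relation.ReflTransGen (stepLR R L) y w

/-- The equivalence relation `y ∼_LR w`, whose classes are the two-sided cells. -/
def eqvLR (y w : W) : Prop := leLR R L y w ∧ leLR R L w y

end KazhdanLusztig

section ValuationRing

variable {Γ : Type*} [AddCommGroup Γ] [LinearOrder Γ] [IsOrderedAddMonoid Γ] (R : Subring ℂ)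

/-- The field `K` of fractions of `A = R[Γ]`. -/
abbrev KField (Γ : Type*) [AddCommGroup Γ] [LinearOrder Γ] [IsOrderedAddMonoid Γ]
    (R : Subring ℂ) : Type _ := FractionRing (AddMonoidAlgebra R Γ)

/-- The inclusion of `F`, the field of fractions of `R`, into `K`. -/
def FtoK : FractionRing R →+* KField Γ R :=
  IsFractionRing.lift (FaithfulSMul.algebraMap_injective R (KField Γ R))

/-- The element `ε^g` of `K`. -/
def epsK (g : Γ) : KField Γ R := algebraMap (AddMonoidAlgebra R Γ) (KField Γ R) (eps R g)

/-- The inclusion of `F[Γ]` into `K`. -/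
def FGtoK (p : AddMonoidAlgebra (FractionRing R) Γ) : KField Γ R :=
  p.coeff.sum fun g r => FtoK R r * epsK R g

/-- Membership in `F[Γ_{>0}]`. -/
def IsPos (p : AddMonoidAlgebra (FractionRing R) Γ) : Prop := ∀ g : Γ, p.coeff g ≠ 0 → 0 < g

/-- `x = r ε^g (1 + p) / (1 + q)` with `p, q ∈ F[Γ_{>0}]`. -/
def HasLead (x : KField Γ R) (r : FractionRing R) (g : Γ) : Prop :=
  ∃ p q : AddMonoidAlgebra (FractionRing R) Γ, IsPos R p ∧ IsPos R q ∧
    x = FtoK R r * epsK R g * ((1 + FGtoK R p) / (1 + FGtoK R q))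

/-- The exponent `g_x` of a nonzero element of `K` (with the value `0` at `x = 0`). -/
def leadExp (x : KField Γ R) : Γ :=
  if h : ∃ g : Γ, ∃ r : FractionRing R, r ≠ 0 ∧ HasLead R x r g then h.choose else 0

/-- The coefficient `r_x` of an element of `K`, with `r_0 = 0`. -/
def leadCoeff (x : KField Γ R) : FractionRing R :=
  if h : ∃ r : FractionRing R, r ≠ 0 ∧ ∃ g : Γ, HasLead R x r g then h.choose else 0

/-- The valuation ring `𝒪`, the set of all `x ∈ K` with `g_x ≥ 0`, where `g_0 = +∞`. -/
def valO : Set (KField Γ R) := {x | x = 0 ∨ 0 ≤ leadExp R x}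

/-- The constant term in `F` of an element of `𝒪`. -/
def constTerm (x : KField Γ R) : FractionRing R := if leadExp R x = 0 then leadCoeff R x else 0

/-- The ring homomorphism `θ₁ : A → R` with `θ₁(ε^g) = 1` for all `g`. -/
def theta1 (a : AddMonoidAlgebra R Γ) : R := a.coeff.sum fun _ r => r

end ValuationRing

section Balanced

variable {B W Γ : Type*} [Group W] [Fintype W] {M : CoxeterMatrix B} {cs : CoxeterSystem M W}
  [AddCommGroup Γ] [LinearOrder Γ] [IsOrderedAddMonoid Γ]

/-- `{E_l}` is a complete set of representatives of the isomorphism classes of irreducible complex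
representations of the finite group `W`. -/
structure IsIrrFamily {Λ W : Type*} [Group W] (E : Λ → FDRep ℂ W) : Prop where
  simple : ∀ l, CategoryTheory.Simple (E l)
  inequivalent : ∀ l m, Nonempty (E l ≅ E m) → l = m
  complete : ∀ V : FDRep ℂ W, CategoryTheory.Simple V → ∃ l, Nonempty (V ≅ E l)

/-- Matrix representations over `K` of degree `n` of the Hecke algebra. Such `A`-algebra maps are
the same thing as `K`-algebra maps `K ⊗_A H → M_n(K)`. -/
abbrev MatRep (R : Subring ℂ) (L : WeightFunction cs Γ) (n : ℕ) : Type _ :=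
  Hecke R L →ₐ[AddMonoidAlgebra R Γ] Matrix (Fin n) (Fin n) (KField Γ R)

variable {R : Subring ℂ} {L : WeightFunction cs Γ} {n : ℕ}

/-- `ρ` affords the representation of `H_K` that corresponds to the representation `V` of `W`
under specialisation: the trace of `T_w` lies in `A`, and `θ₁` maps it to the trace of `w`
on `V`. -/
def Corresponds (V : FDRep ℂ W) (ρ : MatRep R L n) : Prop :=
  n = Module.finrank ℂ V ∧ ∀ w : W, ∃ a : AddMonoidAlgebra R Γ,
    algebraMap (AddMonoidAlgebra R Γ) (KField Γ R) a = (ρ (heckeT R L w)).trace ∧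
    (theta1 R a : ℂ) = V.character w

/-- The element `c_ρ`, where `n c_ρ` is the sum of the
`trace (T_w, ρ) trace (T_{w⁻¹}, ρ)` over all `w ∈ W`. -/
def schurElt (ρ : MatRep R L n) : KField Γ R :=
  (n : KField Γ R)⁻¹ * ∑ w : W, (ρ (heckeT R L w)).trace * (ρ (heckeT R L w⁻¹)).trace

/-- The invariant `f_ρ`: the leading coefficient of `c_ρ = f_ρ ε^{-2 a_ρ} + higher terms`. -/
def fInv (ρ : MatRep R L n) : FractionRing R := leadCoeff R (schurElt ρ)

/-- The invariant `a_ρ`: the leading exponent of `c_ρ` is `-2 a_ρ`. -/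
def aInv (ρ : MatRep R L n) : Γ := Classical.epsilon fun a => leadExp R (schurElt ρ) = -(2 • a)

/-- `ρ` is balanced: `ε^{a_ρ} ρ_{ij}(T_w) ∈ 𝒪` for all `w, i, j`. -/
def IsBalanced (ρ : MatRep R L n) : Prop :=
  ∀ (w : W) (i j : Fin n), epsK R (aInv ρ) * ρ (heckeT R L w) i j ∈ valO R

/-- The leading matrix coefficients: the constant term of
`(-1)^{ℓ(w)} ε^{a_ρ} ρ_{ij}(T_w)`. -/
def leadMat (ρ : MatRep R L n) (w : W) (i j : Fin n) : FractionRing R :=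
  constTerm R ((-1) ^ cs.length w * (epsK R (aInv ρ) * ρ (heckeT R L w) i j))

end Balanced

section AsymptoticRing

variable {B W Γ Λ : Type*} [Group W] [Fintype W] {M : CoxeterMatrix B} {cs : CoxeterSystem M W}
  [AddCommGroup Γ] [LinearOrder Γ] [IsOrderedAddMonoid Γ] {R : Subring ℂ}
  {L : WeightFunction cs Γ} [Fintype Λ] {d : Λ → ℕ} (ρ : ∀ l : Λ, MatRep R L (d l))

/-- The constants `γ̃_{x,y,z}`. -/
def gammaT (x y z : W) : FractionRing R :=
  ∑ l : Λ, ∑ i : Fin (d l), ∑ j : Fin (d l), ∑ k : Fin (d l),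
    (fInv (ρ l))⁻¹ * leadMat (ρ l) x i j * leadMat (ρ l) y j k * leadMat (ρ l) z k i

/-- The constants `ñ_w`. -/
def nT (w : W) : FractionRing R :=
  ∑ l : Λ, ∑ i : Fin (d l), (fInv (ρ l))⁻¹ * leadMat (ρ l) w⁻¹ i i

/-- The set `D̃` of all `w` with `ñ_w ≠ 0`. -/
def setD : Finset W := Finset.univ.filter fun w => nT ρ w ≠ 0

/-- The algebra `K ⊗_F J̃`: the `K`-vector space with basis `t_w`, with the product
given by `t_x t_y = ∑_z γ̃_{x,y,z⁻¹} t_z`. -/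
def JTilde (_ρ : ∀ l : Λ, MatRep R L (d l)) : Type _ := W → KField Γ R

instance : AddCommGroup (JTilde ρ) := inferInstanceAs (AddCommGroup (W → KField Γ R))

instance : Module (KField Γ R) (JTilde ρ) := inferInstanceAs (Module _ (W → KField Γ R))

instance : Module (AddMonoidAlgebra R Γ) (JTilde ρ) := inferInstanceAs (Module _ (W → KField Γ R))

instance : NonUnitalNonAssocRing (JTilde ρ) where
  mul a b := fun z => ∑ x : W, ∑ y : W, a x * b y * FtoK R (gammaT ρ x y z⁻¹)
  left_distrib a b c := funext fun z => by
    change ∑ x : W, ∑ y : W, a x * (b y + c y) * FtoK R (gammaT ρ x y z⁻¹) =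
      ∑ x : W, ∑ y : W, a x * b y * FtoK R (gammaT ρ x y z⁻¹) +
      ∑ x : W, ∑ y : W, a x * c y * FtoK R (gammaT ρ x y z⁻¹)
    simp only [mul_add, add_mul, Finset.sum_add_distrib]
  right_distrib a b c := funext fun z => by
    change ∑ x : W, ∑ y : W, (a x + b x) * c y * FtoK R (gammaT ρ x y z⁻¹) =
      ∑ x : W, ∑ y : W, a x * c y * FtoK R (gammaT ρ x y z⁻¹) +
      ∑ x : W, ∑ y : W, b x * c y * FtoK R (gammaT ρ x y z⁻¹)
    simp only [add_mul, Finset.sum_add_distrib]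
  zero_mul a := funext fun z => by
    change ∑ x : W, ∑ y : W, (0 : KField Γ R) * a y * FtoK R (gammaT ρ x y z⁻¹) = 0
    simp
  mul_zero a := funext fun z => by
    change ∑ x : W, ∑ y : W, a x * (0 : KField Γ R) * FtoK R (gammaT ρ x y z⁻¹) = 0
    simp

/-- The basis element `t_w`. -/
def tElt (w : W) : JTilde ρ := fun z => if z = w then 1 else 0

/-- The identity element `∑_{w ∈ D̃} ñ_w t_w`. -/
def oneJ : JTilde ρ := ∑ w ∈ setD ρ, (FtoK R (nT ρ w) : KField Γ R) • tElt ρ w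

/-- `J̃_A`, the `A`-span of the `t_w`. -/
def JA : Submodule (AddMonoidAlgebra R Γ) (JTilde ρ) :=
  Submodule.span (AddMonoidAlgebra R Γ) (Set.range (tElt ρ))

/-- The left action of the Hecke algebra on the `t_w`, transported from left multiplication via
`C_w ↔ t_w`. -/
def actT (h : Hecke R L) (w : W) : JTilde ρ :=
  ∑ z : W, klCoord R L (h * klC R L w) z • tElt ρ z

/-- The `A`-linear combinations of the `t_y` with `y ≤_LR w` and not `y ∼_LR w`. -/
def lowerSpan (w : W) : Submodule (AddMonoidAlgebra R Γ) (JTilde ρ) :=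
  Submodule.span (AddMonoidAlgebra R Γ) (tElt ρ '' {y | leLR R L y w ∧ ¬ eqvLR R L y w})

/-- The property P̃15. -/
def P15Tilde : Prop :=
  ∀ x x' y w : W, eqvLR R L w y →
    ∑ u : W, FtoK R (gammaT ρ w x' u⁻¹) *
        algebraMap (AddMonoidAlgebra R Γ) (KField Γ R) (hConst R L x u y) =
      ∑ u : W, algebraMap (AddMonoidAlgebra R Γ) (KField Γ R) (hConst R L x w u) *
        FtoK R (gammaT ρ u x' y⁻¹)

/-- The ring `ℤ_W` generated by the numbers `2 cos (2π / m_{st})`, where `m_{st}` is the order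
of `st`. -/
def zW (cs : CoxeterSystem M W) : Subring ℂ :=
  Subring.closure (Set.range fun p : B × B =>
    (2 * Real.cos (2 * Real.pi / orderOf (cs.simple p.1 * cs.simple p.2)) : ℂ))

/-- `R` is `L`-good: `ℤ_W ⊆ R`, and every `f_l` is contained and invertible in `R`. -/
def IsLGood : Prop :=
  zW cs ≤ R ∧ ∀ l : Λ, ∃ u : Rˣ, algebraMap R (FractionRing R) u = fInv (ρ l)

/-- The conditions on `φ`: a unital homomorphism of `A`-algebras from `H` to `J̃_A` such that every
`φ(h) t_w - h.t_w` is an `A`-linear combination of the `t_y` with `y ≤_LR w`, not `y ∼_LR w`. -/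
structure IsLusztigHom (φ : Hecke R L →ₙₐ[AddMonoidAlgebra R Γ] JTilde ρ) : Prop where
  map_one : φ 1 = oneJ ρ
  mem_JA : ∀ h : Hecke R L, φ h ∈ JA ρ
  sub_mem : ∀ (h : Hecke R L) (w : W), φ h * tElt ρ w - actT ρ h w ∈ lowerSpan ρ w

end AsymptoticRing

end KLAsym

end

open KLAsym

/-
Embed `K` into the Hahn series over `ℂ` with exponents in `Γ`. The traces of `ρ^λ(T_w)` and of
`ρ^λ(T_{w⁻¹})` are conjugate there, so the element `c_λ` is, up to a positive factor, a sum of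
absolute squares; hence its lowest exponent has the form `-2 a_λ` and, the `ρ^λ` being balanced,
the leading coefficients of the matrices `ρ^λ(T_w)` inherit the Schur relations. Over `F` these
relations give a Fourier isomorphism from `J̃` onto a product of matrix algebras, with `∑ ñ_d t_d`
as the inverse image of the identity.

Since `C_w` agrees with `(-1)^{ℓ(w)} T_w` modulo terms of positive exponent, `ρ^λ(C_w)` and
`(-1)^{ℓ(w)} ρ^λ(T_w)` have the same leading coefficients. The two-sided ideal of a product of
matrix algebras generated by an element contains every factor at which that element is non-zero;
so if the leading matrices at `x` and at `y` are both non-zero for some `λ`, then `C_x` occurs in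
the two-sided ideal generated by `C_y`, and vice versa. Therefore `γ̃_{x,y,z⁻¹} ≠ 0` forces `x`,
`y` and `z` to lie in one two-sided cell.

By P̃15 the action of the Hecke algebra on the graded module associated with the filtration by
two-sided cells, transported to `J̃`, now commutes with right multiplication, so that `h` acts as
left multiplication by `φ(h) = h · 1`. Conversely `φ(h) t_w` is supported on the cell of `w`,
hence is determined by its class modulo lower cells, and these products determine `φ(h)`.
-/

noncomputable section

namespace KLAsym

section HeckeFamilies

variable {B W : Type*} [Group W] {M : CoxeterMatrix B} {cs : CoxeterSystem M W}

theorem length_induction (cs : CoxeterSystem M W) {P : W → Prop} (one : P 1)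
    (simple_mul : ∀ i w, cs.length w < cs.length (cs.simple i * w) → P w → P (cs.simple i * w))
    (w : W) : P w := by
  induction hn : cs.length w generalizing w with
  | zero => rwa [cs.length_eq_zero_iff.1 hn]
  | succ n ih =>
    obtain ⟨i, hi⟩ := cs.exists_leftDescent_of_ne_one (w := w) (by rintro rfl; simp at hn)
    rw [cs.isLeftDescent_iff] at hi
    have := simple_mul i (cs.simple i * w) (by rw [cs.simple_mul_simple_cancel_left]; omega)
      (ih _ (by omega))
    rwa [cs.simple_mul_simple_cancel_left] at this

theorem length_induction_right (cs : CoxeterSystem M W) {P : W → Prop} (one : P 1)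
    (mul_simple : ∀ w j, cs.length w < cs.length (w * cs.simple j) → P w → P (w * cs.simple j))
    (w : W) : P w := by
  suffices h : ∀ v : W, P v⁻¹ by simpa using h w⁻¹
  refine length_induction cs (by simpa using one) fun i v hlt hv => ?_
  rw [mul_inv_rev, cs.inv_simple]
  refine mul_simple _ i ?_ hv
  rwa [← cs.length_inv (v⁻¹ * _), mul_inv_rev, cs.inv_simple, inv_inv, cs.length_inv]

variable {A S : Type*} [CommRing A] [Ring S] [Algebra A S]

/-- A family `U` in an `A`-algebra satisfies the relations of the standard basis `T_w` of an
Iwahori–Hecke algebra in which `T_s² = 1 + ζ_s T_s`. By the universal property `heckeLift` such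
families are the representations of that algebra, which makes the twisted families below
(inverses, signs, opposites) into (anti)automorphisms. -/
structure IsHeckeFamily (cs : CoxeterSystem M W) (ζ : B → A) (U : W → S) : Prop where
  map_one : U 1 = 1
  simple_mul_of_lt : ∀ i w, cs.length w < cs.length (cs.simple i * w) →
    U (cs.simple i) * U w = U (cs.simple i * w)
  simple_mul_self : ∀ i, U (cs.simple i) * U (cs.simple i) = 1 + ζ i • U (cs.simple i)

namespace IsHeckeFamily

variable {ζ : B → A} {U : W → S}

theorem simple_mul (hU : IsHeckeFamily cs ζ U) (i : B) (w : W) :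
    U (cs.simple i) * U w =
      if cs.length w < cs.length (cs.simple i * w) then U (cs.simple i * w)
      else U (cs.simple i * w) + ζ i • U w := by
  split_ifs with h
  · exact hU.simple_mul_of_lt i w h
  · have hw := hU.simple_mul_of_lt i (cs.simple i * w) (by
      have := cs.length_simple_mul w i
      rw [cs.simple_mul_simple_cancel_left]; omega)
    rw [cs.simple_mul_simple_cancel_left] at hw
    rw [← hw, ← mul_assoc, hU.simple_mul_self, add_mul, one_mul, smul_mul_assoc]

theorem mul_of_length_add (hU : IsHeckeFamily cs ζ U) {w w' : W}
    (h : cs.length (w * w') = cs.length w + cs.length w') : U w * U w' = U (w * w') := by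
  induction w using length_induction cs with
  | one => rw [hU.map_one, one_mul, one_mul]
  | simple_mul i v hv ih =>
    rw [mul_assoc] at h
    have hi := cs.length_simple_mul (v * w') i
    have hle := cs.length_mul_le v w'
    rw [← hU.simple_mul_of_lt i v hv, mul_assoc, ih (by omega),
      hU.simple_mul_of_lt i _ (by omega), mul_assoc]

theorem mul_simple_of_lt (hU : IsHeckeFamily cs ζ U) {w : W} {j : B}
    (h : cs.length w < cs.length (w * cs.simple j)) :
    U w * U (cs.simple j) = U (w * cs.simple j) := by
  refine hU.mul_of_length_add ?_
  have := cs.length_mul_simple w j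
  rw [cs.length_simple]
  omega

theorem map (hU : IsHeckeFamily cs ζ U) {A' T : Type*} [CommRing A'] [Ring T] [Algebra A' T]
    (f : S →+* T) (g : A → A') (hf : ∀ a x, f (a • x) = g a • f x) :
    IsHeckeFamily cs (g ∘ ζ) (f ∘ U) where
  map_one := by rw [Function.comp_apply, hU.map_one, f.map_one]
  simple_mul_of_lt i w h := by
    simp only [Function.comp_apply, ← map_mul, hU.simple_mul_of_lt i w h]
  simple_mul_self i := by
    simp only [Function.comp_apply, ← map_mul, hU.simple_mul_self i, map_add, f.map_one, hf]

theorem op (hU : IsHeckeFamily cs ζ U) :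
    IsHeckeFamily cs ζ fun w => MulOpposite.op (U w⁻¹) where
  map_one := by rw [inv_one, hU.map_one, MulOpposite.op_one]
  simple_mul_of_lt i w h := by
    rw [← MulOpposite.op_mul, cs.inv_simple, mul_inv_rev, cs.inv_simple, hU.mul_simple_of_lt]
    rwa [← cs.length_inv (w⁻¹ * _), mul_inv_rev, inv_inv, cs.inv_simple, cs.length_inv]
  simple_mul_self i := by
    rw [← MulOpposite.op_mul, cs.inv_simple, hU.simple_mul_self, MulOpposite.op_add,
      MulOpposite.op_one, MulOpposite.op_smul]

theorem mul_simple (hU : IsHeckeFamily cs ζ U) (w : W) (j : B) :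
    U w * U (cs.simple j) =
      if cs.length w < cs.length (w * cs.simple j) then U (w * cs.simple j)
      else U (w * cs.simple j) + ζ j • U w := by
  have hl : cs.length (cs.simple j * w⁻¹) = cs.length (w * cs.simple j) := by
    rw [← cs.length_inv (w * _), mul_inv_rev, cs.inv_simple]
  have h := hU.op.simple_mul j w⁻¹
  simp only [hl, mul_inv_rev, cs.inv_simple, inv_inv, cs.length_inv] at h
  have h' := congrArg MulOpposite.unop h
  rwa [apply_ite MulOpposite.unop, MulOpposite.unop_add, MulOpposite.unop_smul] at h'

theorem isUnit_simple_and_inverse_simple (hU : IsHeckeFamily cs ζ U) (i : B) :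
    IsUnit (U (cs.simple i)) ∧ Ring.inverse (U (cs.simple i)) = U (cs.simple i) - ζ i • 1 := by
  let u : Sˣ :=
    { val := U (cs.simple i)
      inv := U (cs.simple i) - ζ i • 1
      val_inv := by rw [mul_sub, hU.simple_mul_self, mul_smul_comm, mul_one, add_sub_cancel_right]
      inv_val := by
        rw [sub_mul, hU.simple_mul_self, smul_mul_assoc, one_mul, add_sub_cancel_right] }
  exact ⟨u.isUnit, Ring.inverse_unit u⟩

theorem inverse_simple (hU : IsHeckeFamily cs ζ U) (i : B) :
    Ring.inverse (U (cs.simple i)) = U (cs.simple i) - ζ i • 1 :=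
  (hU.isUnit_simple_and_inverse_simple i).2

theorem isUnit (hU : IsHeckeFamily cs ζ U) (w : W) : IsUnit (U w) := by
  induction w using length_induction cs with
  | one => exact hU.map_one ▸ isUnit_one
  | simple_mul i w hw ih =>
    rw [← hU.simple_mul_of_lt i w hw]
    exact (hU.isUnit_simple_and_inverse_simple i).1.mul ih

theorem inverse (hU : IsHeckeFamily cs ζ U) :
    IsHeckeFamily cs (-ζ) fun w => Ring.inverse (U w⁻¹) where
  map_one := by rw [inv_one, hU.map_one, Ring.inverse_one]
  simple_mul_of_lt i w h := by
    rw [cs.inv_simple, ← Ring.inverse_mul (.inl (hU.isUnit _)), mul_inv_rev, cs.inv_simple,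
      hU.mul_simple_of_lt]
    rwa [← cs.length_inv (w⁻¹ * _), mul_inv_rev, inv_inv, cs.inv_simple, cs.length_inv]
  simple_mul_self i := by
    simp only [cs.inv_simple, hU.inverse_simple, sub_mul, mul_sub, hU.simple_mul_self,
      smul_mul_assoc, mul_smul_comm, one_mul, mul_one, Pi.neg_apply, neg_smul, smul_sub]
    abel

theorem sign (hU : IsHeckeFamily cs ζ U) :
    IsHeckeFamily cs (-ζ) fun w => (-1 : ℤ) ^ cs.length w • U w where
  map_one := by rw [cs.length_one, pow_zero, one_smul, hU.map_one]
  simple_mul_of_lt i w h := by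
    have hl : cs.length (cs.simple i * w) = cs.length w + 1 := by
      have := cs.length_simple_mul w i
      omega
    rw [smul_mul_smul_comm, hU.simple_mul_of_lt i w h, cs.length_simple, hl, pow_one, pow_succ']
  simple_mul_self i := by
    simp only [cs.length_simple, pow_one, neg_smul, one_smul, neg_mul_neg, hU.simple_mul_self,
      Pi.neg_apply, smul_neg, neg_neg]

end IsHeckeFamily

variable {Γ : Type*} [AddCommGroup Γ] (R : Type*) [CommRing R] (L : WeightFunction cs Γ)

theorem isHeckeFamily_heckeT : IsHeckeFamily cs (xi R L) (heckeT R L) where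
  map_one := heckeT_one R L
  simple_mul_of_lt i w h := by rw [heckeT_simple_mul, if_pos h]
  simple_mul_self i := by
    rw [heckeT_simple_mul, if_neg (by simp), cs.simple_mul_simple_self, heckeT_one]

/-- The additive map with `a T_w ↦ f(a) U_w`; it is multiplicative when `U` is a Hecke family, see
`heckeLift`. -/
def heckeLiftₛₗ (f : AddMonoidAlgebra R Γ →+* A) (U : W → S) : Hecke R L →ₛₗ[f] S where
  toFun h := ((heckeT R L).repr h).sum fun w a => f a • U w
  map_add' x y := by
    rw [map_add]
    exact Finsupp.sum_add_index' (by simp) (by simp [add_smul])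
  map_smul' a x := by
    rw [map_smul, Finsupp.sum_smul_index (by simp), Finsupp.smul_sum]
    simp only [map_mul, mul_smul]

variable {R L}

theorem hecke_induction {P : Hecke R L → Prop}
    (smul : ∀ (a : AddMonoidAlgebra R Γ) w, P (a • heckeT R L w))
    (add : ∀ x y, P x → P y → P (x + y)) (h : Hecke R L) : P h := by
  rw [← (heckeT R L).linearCombination_repr h]
  induction (heckeT R L).repr h using Finsupp.induction_linear with
  | zero => simpa using smul 0 1
  | add x y hx hy => rw [map_add]; exact add _ _ hx hy
  | single w a => rw [Finsupp.linearCombination_single]; exact smul a w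

variable {f : AddMonoidAlgebra R Γ →+* A} {U : W → S}

theorem heckeLiftₛₗ_heckeT (w : W) : heckeLiftₛₗ R L f U (heckeT R L w) = U w := by
  simp [heckeLiftₛₗ]

theorem heckeLiftₛₗ_mul (hU : IsHeckeFamily cs (f ∘ xi R L) U) (x y : Hecke R L) :
    heckeLiftₛₗ R L f U (x * y) = heckeLiftₛₗ R L f U x * heckeLiftₛₗ R L f U y := by
  have simple_mul (i : B) (y : Hecke R L) : heckeLiftₛₗ R L f U (heckeT R L (cs.simple i) * y) =
      U (cs.simple i) * heckeLiftₛₗ R L f U y := by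
    suffices h : (heckeLiftₛₗ R L f U).comp (LinearMap.mulLeft _ (heckeT R L (cs.simple i))) =
        (LinearMap.mulLeft A (U (cs.simple i))).comp (heckeLiftₛₗ R L f U) from
      LinearMap.congr_fun h y
    refine (heckeT R L).ext fun w => ?_
    simp only [LinearMap.comp_apply, LinearMap.mulLeft_apply, heckeT_simple_mul,
      heckeLiftₛₗ_heckeT, hU.simple_mul]
    split_ifs
    · rw [heckeLiftₛₗ_heckeT]
    · simp only [map_add, LinearMap.map_smulₛₗ, heckeLiftₛₗ_heckeT, Function.comp_apply]
  have basis_mul (w : W) (y : Hecke R L) : heckeLiftₛₗ R L f U (heckeT R L w * y) =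
      U w * heckeLiftₛₗ R L f U y := by
    induction w using length_induction cs generalizing y with
    | one => rw [heckeT_one, hU.map_one, one_mul, one_mul]
    | simple_mul i w hw ih =>
      rw [← (isHeckeFamily_heckeT R L).simple_mul_of_lt i w hw, mul_assoc, simple_mul, ih,
        ← hU.simple_mul_of_lt i w hw, mul_assoc]
  suffices h : (heckeLiftₛₗ R L f U).comp (LinearMap.mulRight _ y) =
      (LinearMap.mulRight A (heckeLiftₛₗ R L f U y)).comp (heckeLiftₛₗ R L f U) from
    LinearMap.congr_fun h x
  refine (heckeT R L).ext fun w => ?_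
  simp only [LinearMap.comp_apply, LinearMap.mulRight_apply, basis_mul, heckeLiftₛₗ_heckeT]

/-- The universal property of the Hecke algebra, in a form that is semilinear along `f`: the ring
homomorphism with `a T_w ↦ f(a) U_w` attached to a Hecke family `U`. -/
def heckeLift (hU : IsHeckeFamily cs (f ∘ xi R L) U) : Hecke R L →+* S where
  toFun := heckeLiftₛₗ R L f U
  map_one' := by rw [← heckeT_one, heckeLiftₛₗ_heckeT, hU.map_one]
  map_mul' := heckeLiftₛₗ_mul hU
  map_zero' := map_zero _
  map_add' := map_add _

theorem heckeLift_heckeT (hU : IsHeckeFamily cs (f ∘ xi R L) U) (w : W) :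
    heckeLift hU (heckeT R L w) = U w := heckeLiftₛₗ_heckeT w

theorem heckeLift_smul (hU : IsHeckeFamily cs (f ∘ xi R L) U) (a : AddMonoidAlgebra R Γ)
    (h : Hecke R L) : heckeLift hU (a • h) = f a • heckeLift hU h :=
  LinearMap.map_smulₛₗ (heckeLiftₛₗ R L f U) a h

theorem heckeLift_apply [Fintype W] (hU : IsHeckeFamily cs (f ∘ xi R L) U) (h : Hecke R L) :
    heckeLift hU h = ∑ w, f ((heckeT R L).repr h w) • U w :=
  Finsupp.sum_fintype ((heckeT R L).repr h) (fun w a => f a • U w) (by simp)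

end HeckeFamilies

section BarCoefficients

variable {Γ : Type*} [AddCommGroup Γ] (R : Type*) [CommRing R]

/-- The bar involution `ε^g ↦ ε^{-g}` of the group ring `R[Γ]`. -/
def barHom : AddMonoidAlgebra R Γ →+* AddMonoidAlgebra R Γ :=
  AddMonoidAlgebra.mapDomainRingHom R (negAddMonoidHom : Γ →+ Γ)

theorem barHom_eps (g : Γ) : barHom R (eps R g) = eps R (-g) := by
  simp [barHom, eps]

variable {R}

theorem coeff_barHom (a : AddMonoidAlgebra R Γ) (g : Γ) :
    (barHom R a).coeff g = a.coeff (-g) := by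
  have h := Finsupp.mapDomain_apply neg_injective a.coeff (-g)
  rwa [neg_neg] at h

theorem barHom_barHom (a : AddMonoidAlgebra R Γ) : barHom R (barHom R a) = a := by
  ext g
  rw [coeff_barHom, coeff_barHom, neg_neg]

variable (R Γ) in
/-- The elements of `R[Γ]` with integral coefficients. -/
def intCoeffs : Subring (AddMonoidAlgebra R Γ) :=
  (AddMonoidAlgebra.mapRingHom Γ (Int.castRingHom R)).range

theorem mem_intCoeffs {a : AddMonoidAlgebra R Γ} :
    a ∈ intCoeffs Γ R ↔ ∀ g, ∃ n : ℤ, a.coeff g = n := by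
  constructor
  · rintro ⟨b, rfl⟩ g
    exact ⟨b.coeff g, by simp⟩
  · intro h
    choose n hn using h
    rw [← AddMonoidAlgebra.sum_coeff_single a]
    exact sum_mem fun g _ => ⟨AddMonoidAlgebra.single g (n g), by simp [hn]⟩

theorem eps_mem_intCoeffs (g : Γ) : eps R g ∈ intCoeffs Γ R :=
  ⟨AddMonoidAlgebra.single g 1, by simp [eps]⟩

theorem barHom_mem_intCoeffs {a : AddMonoidAlgebra R Γ} (ha : a ∈ intCoeffs Γ R) :
    barHom R a ∈ intCoeffs Γ R :=
  mem_intCoeffs.2 fun g => coeff_barHom a g ▸ mem_intCoeffs.1 ha (-g)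

end BarCoefficients

section NegativeCoefficients

variable {Γ : Type*} [AddCommGroup Γ] [LinearOrder Γ] {R : Subring ℂ} {a b : AddMonoidAlgebra R Γ}

theorem isIntNeg_iff :
    IsIntNeg R a ↔ a ∈ intCoeffs Γ R ∧ ∀ g, a.coeff g ≠ 0 → g < 0 := by
  simp only [IsIntNeg, forall_and, mem_intCoeffs, Subtype.ext_iff, Subring.coe_intCast]

theorem isIntNeg_zero : IsIntNeg R (0 : AddMonoidAlgebra R Γ) :=
  isIntNeg_iff.2 ⟨zero_mem _, by simp⟩

theorem IsIntNeg.add (ha : IsIntNeg R a) (hb : IsIntNeg R b) : IsIntNeg R (a + b) := by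
  rw [isIntNeg_iff] at *
  refine ⟨add_mem ha.1 hb.1, fun g h => ?_⟩
  by_contra hg
  have ha' := mt (ha.2 g) hg
  have hb' := mt (hb.2 g) hg
  push Not at ha' hb'
  exact h (by simp [ha', hb'])

theorem IsIntNeg.neg (ha : IsIntNeg R a) : IsIntNeg R (-a) := by
  rw [isIntNeg_iff] at *
  exact ⟨neg_mem ha.1, by simpa using ha.2⟩

theorem isIntNeg_eps {g : Γ} (hg : g < 0) : IsIntNeg R (eps R g) :=
  isIntNeg_iff.2 ⟨eps_mem_intCoeffs g, fun h h0 => by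
    obtain rfl : g = h := by
      by_contra hgh
      exact h0 (by simp [eps, hgh])
    exact hg⟩

variable [IsOrderedAddMonoid Γ]

theorem IsIntNeg.eq_zero_of_barHom_eq (ha : IsIntNeg R a) (h : barHom R a = a) : a = 0 := by
  ext1
  by_contra! h0
  obtain ⟨g, hg⟩ := Finsupp.ne_iff.1 h0
  have hneg : g < 0 := (ha g).2 hg
  have hpos : -g < 0 := (ha (-g)).2 (by rwa [← coeff_barHom, h])
  exact absurd (add_neg hneg hpos) (by simp)

theorem exists_isIntNeg_sub_bar (ha : a ∈ intCoeffs Γ R) (h : barHom R a = -a) :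
    ∃ b, IsIntNeg R b ∧ a = b - barHom R b := by
  have coeff_neg (g : Γ) : a.coeff (-g) = -a.coeff g := by
    rw [← coeff_barHom, h, AddMonoidAlgebra.coeff_neg, Finsupp.neg_apply]
  refine ⟨.ofCoeff (a.coeff.filter (· < 0)), isIntNeg_iff.2 ⟨mem_intCoeffs.2 fun g => ?_, ?_⟩, ?_⟩
  · by_cases hg : g < 0
    · simpa [hg] using mem_intCoeffs.1 ha g
    · exact ⟨0, by simp [hg]⟩
  · simp +contextual [Finsupp.filter_apply]
  · ext g
    simp only [AddMonoidAlgebra.coeff_sub, Finsupp.sub_apply, coeff_barHom, Finsupp.filter_apply]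
    rcases lt_trichotomy g 0 with hg | rfl | hg
    · simp [hg, hg.not_gt]
    · have h0 : a.coeff 0 = 0 := self_eq_neg.1 (by simpa using coeff_neg 0)
      simp [h0]
    · simp [hg, hg.le, coeff_neg]

end NegativeCoefficients

theorem inverse_eq_of_mul_eq_one {S : Type*} [MonoidWithZero S] {a b : S} (ha : IsUnit a)
    (h : a * b = 1) : Ring.inverse a = b := by
  rw [← mul_one (Ring.inverse a), Ring.inverse_mul_eq_iff_eq_mul a 1 b ha, h]

theorem map_ringInverse {S T : Type*} [MonoidWithZero S] [MonoidWithZero T] (f : S →*₀ T) {a : S}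
    (ha : IsUnit a) : f (Ring.inverse a) = Ring.inverse (f a) :=
  (inverse_eq_of_mul_eq_one (ha.map f) (by
    rw [← map_mul, Ring.mul_inverse_cancel _ ha, map_one])).symm

section Involutions

variable {B W Γ : Type*} [Group W] {M : CoxeterMatrix B} {cs : CoxeterSystem M W}
  [AddCommGroup Γ] (R : Type*) [CommRing R] (L : WeightFunction cs Γ)

theorem barHom_comp_xi : barHom R ∘ xi R L = -xi R L := by
  funext i
  rw [Function.comp_apply, Pi.neg_apply, xi, map_sub, barHom_eps, barHom_eps, neg_neg, neg_sub]

/-- The bar involution of the Hecke algebra, as a ring homomorphism. -/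
def barRing : Hecke R L →+* Hecke R L :=
  heckeLift (barHom_comp_xi R L ▸ (isHeckeFamily_heckeT R L).inverse)

/-- The ring involution of the Hecke algebra that is the bar involution on scalars and maps `T_w`
to `(-1)^{ℓ(w)} T_w`; it relates the basis `C_w` to the basis `C'_w`, see `klC_eq`. -/
def signRing : Hecke R L →+* Hecke R L :=
  heckeLift (barHom_comp_xi R L ▸ (isHeckeFamily_heckeT R L).sign)

/-- The linear antiautomorphism of the Hecke algebra with `T_w ↦ T_{w⁻¹}`; it exchanges left and
right multiplication. -/
def flat : Hecke R L →ₗ[AddMonoidAlgebra R Γ] Hecke R L :=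
  (MulOpposite.opLinearEquiv (AddMonoidAlgebra R Γ)).symm.toLinearMap ∘ₗ
    heckeLiftₛₗ R L (RingHom.id _) fun w => MulOpposite.op (heckeT R L w⁻¹)

variable {R L}

theorem isUnit_heckeT (w : W) : IsUnit (heckeT R L w) :=
  (isHeckeFamily_heckeT R L).isUnit w

theorem inverse_heckeT_simple (i : B) :
    Ring.inverse (heckeT R L (cs.simple i)) = heckeT R L (cs.simple i) - xi R L i • 1 :=
  (isHeckeFamily_heckeT R L).inverse_simple i

theorem barRing_heckeT (w : W) : barRing R L (heckeT R L w) = Ring.inverse (heckeT R L w⁻¹) :=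
  heckeLift_heckeT _ w

theorem barRing_smul (a : AddMonoidAlgebra R Γ) (h : Hecke R L) :
    barRing R L (a • h) = barHom R a • barRing R L h :=
  heckeLift_smul _ a h

theorem signRing_heckeT (w : W) :
    signRing R L (heckeT R L w) = (-1 : ℤ) ^ cs.length w • heckeT R L w :=
  heckeLift_heckeT _ w

theorem signRing_smul (a : AddMonoidAlgebra R Γ) (h : Hecke R L) :
    signRing R L (a • h) = barHom R a • signRing R L h :=
  heckeLift_smul _ a h

theorem flat_heckeT (w : W) : flat R L (heckeT R L w) = heckeT R L w⁻¹ := by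
  rw [flat, LinearMap.comp_apply, heckeLiftₛₗ_heckeT]
  rfl

theorem flat_flat (h : Hecke R L) : flat R L (flat R L h) = h := by
  induction h using hecke_induction with
  | smul a w => rw [map_smul, map_smul, flat_heckeT, flat_heckeT, inv_inv]
  | add x y hx hy => rw [map_add, map_add, hx, hy]

theorem flat_one : flat R L 1 = 1 := by rw [← heckeT_one, flat_heckeT, inv_one]

theorem flat_mul (x y : Hecke R L) : flat R L (x * y) = flat R L y * flat R L x := by
  have hU : IsHeckeFamily cs (RingHom.id (AddMonoidAlgebra R Γ) ∘ xi R L)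
      fun w => MulOpposite.op (heckeT R L w⁻¹) := (isHeckeFamily_heckeT R L).op
  rw [flat, LinearMap.comp_apply, heckeLiftₛₗ_mul hU]
  rfl

theorem barRing_inverse_heckeT (w : W) :
    barRing R L (Ring.inverse (heckeT R L w⁻¹)) = heckeT R L w := by
  have h := map_ringInverse (barRing R L).toMonoidWithZeroHom (isUnit_heckeT (L := L) (R := R) w⁻¹)
  refine h.trans ?_
  change Ring.inverse (barRing R L _) = _
  rw [barRing_heckeT, inv_inv, Ring.inverse_inverse (isUnit_heckeT w)]

theorem barRing_barRing (h : Hecke R L) : barRing R L (barRing R L h) = h := by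
  induction h using hecke_induction with
  | smul a w => rw [barRing_smul, barRing_smul, barHom_barHom, barRing_heckeT,
      barRing_inverse_heckeT]
  | add x y hx hy => rw [map_add, map_add, hx, hy]

theorem signRing_inverse_heckeT (w : W) :
    signRing R L (Ring.inverse (heckeT R L w)) =
      (-1 : ℤ) ^ cs.length w • Ring.inverse (heckeT R L w) := by
  have h := map_ringInverse (signRing R L).toMonoidWithZeroHom (isUnit_heckeT (L := L) (R := R) w)
  refine h.trans (inverse_eq_of_mul_eq_one ((isUnit_heckeT w).map (signRing R L)) ?_)
  change signRing R L _ * _ = 1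
  rw [signRing_heckeT, smul_mul_smul_comm, Ring.mul_inverse_cancel _ (isUnit_heckeT w),
    ← mul_pow, neg_one_mul, neg_neg, one_pow, one_smul]

theorem flat_inverse_heckeT (w : W) :
    flat R L (Ring.inverse (heckeT R L w)) = Ring.inverse (heckeT R L w⁻¹) :=
  (inverse_eq_of_mul_eq_one (isUnit_heckeT _) (by
    rw [← flat_heckeT, ← flat_mul, Ring.inverse_mul_cancel _ (isUnit_heckeT w), flat_one])).symm

theorem flat_barRing (h : Hecke R L) : flat R L (barRing R L h) = barRing R L (flat R L h) := by
  induction h using hecke_induction with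
  | smul a w => rw [barRing_smul, map_smul, map_smul, barRing_smul, barRing_heckeT, flat_heckeT,
      flat_inverse_heckeT, barRing_heckeT]
  | add x y hx hy => simp only [map_add, hx, hy]

theorem flat_signRing (h : Hecke R L) : flat R L (signRing R L h) = signRing R L (flat R L h) := by
  induction h using hecke_induction with
  | smul a w => rw [signRing_smul, map_smul, map_smul, signRing_smul, signRing_heckeT, map_zsmul,
      flat_heckeT, signRing_heckeT, cs.length_inv]
  | add x y hx hy => simp only [map_add, hx, hy]

theorem repr_signRing (h : Hecke R L) (y : W) : (heckeT R L).repr (signRing R L h) y =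
    (-1 : ℤ) ^ cs.length y • barHom R ((heckeT R L).repr h y) := by
  classical
  induction h using hecke_induction with
  | smul a w =>
    rw [signRing_smul, signRing_heckeT]
    simp only [map_smul, map_zsmul, Module.Basis.repr_self, Finsupp.smul_apply,
      Finsupp.single_apply, smul_eq_mul, mul_smul_comm, map_mul]
    split_ifs with h
    · rw [h, map_one]
    · rw [map_zero, mul_zero, smul_zero, smul_zero]
  | add x y hx hy => simp only [map_add, Finsupp.add_apply, hx, hy, smul_add]

theorem repr_flat (h : Hecke R L) (y : W) :
    (heckeT R L).repr (flat R L h) y = (heckeT R L).repr h y⁻¹ := by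
  classical
  induction h using hecke_induction with
  | smul a w => simp only [map_smul, flat_heckeT, Module.Basis.repr_self, Finsupp.smul_apply,
      Finsupp.single_apply, inv_eq_iff_eq_inv]
  | add x y hx hy => simp only [map_add, Finsupp.add_apply, hx, hy]

end Involutions

section Triangularity

variable {B W Γ : Type*} [Group W] {M : CoxeterMatrix B} {cs : CoxeterSystem M W}
  [AddCommGroup Γ] {R : Type*} [CommRing R] {L : WeightFunction cs Γ}

theorem xi_mem_intCoeffs (i : B) : xi R L i ∈ intCoeffs Γ R :=
  sub_mem (eps_mem_intCoeffs _) (eps_mem_intCoeffs _)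

variable (R L) in
/-- The `ℤ[Γ]`-span of the `T_w` with `ℓ(w) < n`. -/
def intSpan (n : ℕ) : Submodule (intCoeffs Γ R) (Hecke R L) :=
  Submodule.span _ (heckeT R L '' {w | cs.length w < n})

theorem heckeT_mem_intSpan {n : ℕ} {w : W} (h : cs.length w < n) :
    heckeT R L w ∈ intSpan R L n :=
  Submodule.subset_span ⟨w, h, rfl⟩

theorem intSpan_mono {m n : ℕ} (hmn : m ≤ n) : intSpan R L m ≤ intSpan R L n :=
  Submodule.span_mono (Set.image_mono fun _ h => lt_of_lt_of_le h hmn)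

theorem smul_mem_intSpan {n : ℕ} {a : AddMonoidAlgebra R Γ} (ha : a ∈ intCoeffs Γ R)
    {h : Hecke R L} (hh : h ∈ intSpan R L n) : a • h ∈ intSpan R L n :=
  (intSpan R L n).smul_mem ⟨a, ha⟩ hh

theorem mem_intSpan_iff {n : ℕ} {h : Hecke R L} :
    h ∈ intSpan R L n ↔ ∀ y, (heckeT R L).repr h y ∈ intCoeffs Γ R ∧
      (n ≤ cs.length y → (heckeT R L).repr h y = 0) := by
  classical
  constructor
  · intro hh y
    induction hh using Submodule.span_induction with
    | mem _ hx =>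
      obtain ⟨w, hw, rfl⟩ := hx
      rw [Module.Basis.repr_self, Finsupp.single_apply]
      split_ifs with hwy
      · exact ⟨one_mem _, fun hy => absurd hy (hwy ▸ not_le.2 hw)⟩
      · exact ⟨zero_mem _, fun _ => rfl⟩
    | zero => simp [zero_mem]
    | add x x' _ _ hx hx' =>
      rw [map_add, Finsupp.add_apply]
      exact ⟨add_mem hx.1 hx'.1, fun hy => by rw [hx.2 hy, hx'.2 hy, add_zero]⟩
    | smul c x _ hx =>
      rw [Subring.smul_def, map_smul, Finsupp.smul_apply, smul_eq_mul]
      exact ⟨mul_mem c.2 hx.1, fun hy => by rw [hx.2 hy, mul_zero]⟩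
  · intro hh
    rw [← (heckeT R L).linearCombination_repr h]
    refine sum_mem fun y hy => smul_mem_intSpan (hh y).1 (heckeT_mem_intSpan ?_)
    by_contra! hn
    exact Finsupp.mem_support_iff.1 hy ((hh y).2 hn)

theorem mem_intSpan_of_succ {n : ℕ} {h : Hecke R L} (hh : h ∈ intSpan R L (n + 1))
    (h0 : ∀ y, cs.length y = n → (heckeT R L).repr h y = 0) : h ∈ intSpan R L n := by
  rw [mem_intSpan_iff] at hh ⊢
  refine fun y => ⟨(hh y).1, fun hy => ?_⟩
  rcases hy.eq_or_lt with hy | hy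
  · exact h0 y hy.symm
  · exact (hh y).2 hy

theorem eq_zero_of_mem_intSpan_zero {h : Hecke R L} (hh : h ∈ intSpan R L 0) : h = 0 :=
  (heckeT R L).repr.map_eq_zero_iff.1
    (Finsupp.ext fun y => (mem_intSpan_iff.1 hh y).2 (Nat.zero_le _))

theorem map_mem_intSpan {f : AddMonoidAlgebra R Γ → AddMonoidAlgebra R Γ}
    (hf : ∀ a ∈ intCoeffs Γ R, f a ∈ intCoeffs Γ R) {φ : Hecke R L →+ Hecke R L}
    (hφ : ∀ a h, φ (a • h) = f a • φ h) {m n : ℕ}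
    (hT : ∀ w, cs.length w < n → φ (heckeT R L w) ∈ intSpan R L m) {h : Hecke R L}
    (hh : h ∈ intSpan R L n) : φ h ∈ intSpan R L m := by
  induction hh using Submodule.span_induction with
  | mem _ hx =>
    obtain ⟨w, hw, rfl⟩ := hx
    exact hT w hw
  | zero => rw [map_zero]; exact zero_mem _
  | add x y _ _ hx hy => rw [map_add]; exact add_mem hx hy
  | smul c x _ hx =>
    rw [Subring.smul_def, hφ]
    exact smul_mem_intSpan (hf c c.2) hx

theorem simple_mul_mem_intSpan {n : ℕ} {h : Hecke R L} (hh : h ∈ intSpan R L n) (i : B) :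
    heckeT R L (cs.simple i) * h ∈ intSpan R L (n + 1) := by
  refine map_mem_intSpan (f := id) (φ := AddMonoidHom.mulLeft (heckeT R L (cs.simple i)))
    (fun _ => id) (fun a h => mul_smul_comm a _ h) (fun w hw => ?_) hh
  have hlen := cs.length_simple_mul w i
  rw [AddMonoidHom.coe_mulLeft, heckeT_simple_mul]
  split_ifs
  · exact heckeT_mem_intSpan (by omega)
  · exact add_mem (heckeT_mem_intSpan (by omega))
      (smul_mem_intSpan (xi_mem_intCoeffs i) (heckeT_mem_intSpan (by omega)))

theorem barRing_heckeT_sub_mem (w : W) :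
    barRing R L (heckeT R L w) - heckeT R L w ∈ intSpan R L (cs.length w) := by
  induction w using length_induction cs with
  | one => rw [heckeT_one, map_one, sub_self]; exact zero_mem _
  | simple_mul i w hw ih =>
    have hlen : cs.length (cs.simple i * w) = cs.length w + 1 := by
      have := cs.length_simple_mul w i
      omega
    have expand : barRing R L (heckeT R L (cs.simple i * w)) - heckeT R L (cs.simple i * w) =
        heckeT R L (cs.simple i) * (barRing R L (heckeT R L w) - heckeT R L w) -
          (xi R L i • heckeT R L w + xi R L i • (barRing R L (heckeT R L w) - heckeT R L w)) := by
      rw [← (isHeckeFamily_heckeT R L).simple_mul_of_lt i w hw, map_mul,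
        barRing_heckeT (cs.simple i), cs.inv_simple, inverse_heckeT_simple, sub_mul,
        smul_mul_assoc, one_mul, mul_sub, smul_sub]
      abel
    rw [expand, hlen]
    exact sub_mem (simple_mul_mem_intSpan ih i)
      (add_mem (smul_mem_intSpan (xi_mem_intCoeffs i) (heckeT_mem_intSpan (by omega)))
        (smul_mem_intSpan (xi_mem_intCoeffs i) (intSpan_mono (by omega) ih)))

theorem barRing_mem_intSpan {n : ℕ} {h : Hecke R L} (hh : h ∈ intSpan R L n) :
    barRing R L h ∈ intSpan R L n := by
  refine map_mem_intSpan (f := barHom R) (φ := (barRing R L).toAddMonoidHom)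
    (fun _ => barHom_mem_intCoeffs) barRing_smul (fun w hw => ?_) hh
  simpa using add_mem (intSpan_mono hw.le (barRing_heckeT_sub_mem w)) (heckeT_mem_intSpan hw)

theorem signRing_mem_intSpan {n : ℕ} {h : Hecke R L} (hh : h ∈ intSpan R L n) :
    signRing R L h ∈ intSpan R L n :=
  map_mem_intSpan (f := barHom R) (φ := (signRing R L).toAddMonoidHom)
    (fun _ => barHom_mem_intCoeffs) signRing_smul
    (fun w hw => (signRing_heckeT (L := L) (R := R) w).symm ▸
      zsmul_mem (heckeT_mem_intSpan hw) _) hh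

theorem repr_barRing_of_length_eq {n : ℕ} {h : Hecke R L} (hh : h ∈ intSpan R L (n + 1)) {y : W}
    (hy : cs.length y = n) :
    (heckeT R L).repr (barRing R L h) y = barHom R ((heckeT R L).repr h y) := by
  classical
  induction hh using Submodule.span_induction with
  | mem _ hx =>
    obtain ⟨w, hw, rfl⟩ := hx
    have hwy : cs.length w ≤ cs.length y := hy ▸ Nat.lt_succ_iff.1 hw
    have h0 := (mem_intSpan_iff.1 (barRing_heckeT_sub_mem (R := R) (L := L) w) y).2 hwy
    rw [map_sub, Finsupp.sub_apply, sub_eq_zero] at h0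
    rw [h0, Module.Basis.repr_self, Finsupp.single_apply]
    split_ifs
    · rw [map_one]
    · rw [map_zero]
  | zero => simp
  | add x x' _ _ hx hx' => simp only [map_add, Finsupp.add_apply, hx, hx']
  | smul c x _ hx => rw [Subring.smul_def, barRing_smul, map_smul, map_smul, Finsupp.smul_apply,
      Finsupp.smul_apply, hx, smul_eq_mul, smul_eq_mul, map_mul]

end Triangularity

section KazhdanLusztigBasis

variable {B W Γ : Type*} [Group W] {M : CoxeterMatrix B} {cs : CoxeterSystem M W}
  [AddCommGroup Γ] {R : Subring ℂ} {L : WeightFunction cs Γ}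

theorem barH_eq [Fintype W] (h : Hecke R L) : barH R L h = barRing R L h := by
  have barA_eq (a : AddMonoidAlgebra R Γ) : barA R a = barHom R a :=
    AddMonoidAlgebra.ext (by simp [barA, barHom, AddMonoidAlgebra.mapDomain, Finsupp.mapDomain])
  simp only [barRing, heckeLift_apply, barH, barA_eq]

theorem dagger_eq (h : Hecke R L) : dagger R L h = signRing R L (barRing R L h) := by
  induction h using hecke_induction with
  | smul a w =>
    rw [map_smul, barRing_smul, signRing_smul, barHom_barHom, dagger, Module.Basis.constr_basis,
      barRing_heckeT, signRing_inverse_heckeT, cs.length_inv, zsmul_eq_mul]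
    push_cast
    rfl
  | add x y hx hy => simp only [map_add, hx, hy]

variable [LinearOrder Γ]

theorem isKLElement_iff [Fintype W] {w : W} {c : Hecke R L} :
    IsKLElement R L w c ↔
    barRing R L c = c ∧ ∀ y, IsIntNeg R ((heckeT R L).repr (c - heckeT R L w) y) := by
  classical
  simp only [IsKLElement, barH_eq, map_sub, Finsupp.sub_apply, Module.Basis.repr_self,
    Finsupp.single_apply, @eq_comm W w]

variable [IsOrderedAddMonoid Γ]

theorem exists_isIntNeg_sub_barRing_mem {n : ℕ} {h : Hecke R L} (hh : h ∈ intSpan R L (n + 1))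
    (hb : barRing R L h = -h) : ∃ k ∈ intSpan R L (n + 1),
      (∀ y, IsIntNeg R ((heckeT R L).repr k y)) ∧ h - (k - barRing R L k) ∈ intSpan R L n := by
  classical
  have top_coeff (y : W) (hy : cs.length y = n) :
      ∃ b, IsIntNeg R b ∧ (heckeT R L).repr h y = b - barHom R b :=
    exists_isIntNeg_sub_bar (mem_intSpan_iff.1 hh y).1
      (by rw [← repr_barRing_of_length_eq hh hy, hb, map_neg, Finsupp.neg_apply])
  choose! b hb_neg hb_eq using top_coeff
  obtain ⟨k, hk⟩ : ∃ k : Hecke R L, ∀ y, (heckeT R L).repr k y =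
      if cs.length y = n then b y else 0 :=
    ⟨(heckeT R L).repr.symm <| Finsupp.onFinset ((heckeT R L).repr h).support
      (fun y => if cs.length y = n then b y else 0) fun y => by
      rw [ite_ne_right_iff, Finsupp.mem_support_iff]
      refine fun ⟨hy, hb0⟩ h0 => hb0 ((hb_neg y hy).eq_zero_of_barHom_eq ?_)
      exact (sub_eq_zero.1 ((hb_eq y hy).symm.trans h0)).symm,
      fun y => by rw [LinearEquiv.apply_symm_apply, Finsupp.onFinset_apply]⟩
  have k_neg (y : W) : IsIntNeg R ((heckeT R L).repr k y) := by
    rw [hk]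
    split_ifs with hy
    exacts [hb_neg y hy, isIntNeg_zero]
  have k_mem : k ∈ intSpan R L (n + 1) := mem_intSpan_iff.2 fun y =>
    ⟨(isIntNeg_iff.1 (k_neg y)).1, fun hy => by rw [hk, if_neg (by omega)]⟩
  refine ⟨k, k_mem, k_neg, mem_intSpan_of_succ
    (sub_mem hh (sub_mem k_mem (barRing_mem_intSpan k_mem))) fun y hy => ?_⟩
  rw [map_sub, map_sub, Finsupp.sub_apply, Finsupp.sub_apply, repr_barRing_of_length_eq k_mem hy,
    hk, if_pos hy, hb_eq y hy, sub_self]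

theorem exists_sub_barRing {n : ℕ} {h : Hecke R L} (hh : h ∈ intSpan R L n)
    (hb : barRing R L h = -h) :
    ∃ k ∈ intSpan R L n, (∀ y, IsIntNeg R ((heckeT R L).repr k y)) ∧ h = k - barRing R L k := by
  induction n generalizing h with
  | zero =>
    exact ⟨0, zero_mem _, fun y => by simpa using isIntNeg_zero,
      by rw [eq_zero_of_mem_intSpan_zero hh, map_zero, sub_zero]⟩
  | succ n ih =>
    obtain ⟨k, hk, k_neg, hsub⟩ := exists_isIntNeg_sub_barRing_mem hh hb
    obtain ⟨k', hk', k'_neg, he⟩ := ih hsub (by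
      rw [map_sub, map_sub, barRing_barRing, hb]
      abel)
    refine ⟨k + k', add_mem hk (intSpan_mono n.le_succ hk'), fun y => ?_, ?_⟩
    · rw [map_add, Finsupp.add_apply]
      exact (k_neg y).add (k'_neg y)
    · rw [map_add, sub_eq_iff_eq_add.1 he]
      abel

theorem eq_zero_of_barRing_eq {h : Hecke R L}
    (hn : ∀ y, IsIntNeg R ((heckeT R L).repr h y)) (hb : barRing R L h = h) : h = 0 := by
  have eq_zero_of_mem (n : ℕ) (hm : h ∈ intSpan R L n) : h = 0 := by
    induction n with
    | zero => exact eq_zero_of_mem_intSpan_zero hm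
    | succ n ih =>
      exact ih (mem_intSpan_of_succ hm fun y hy => (hn y).eq_zero_of_barHom_eq
        (by rw [← repr_barRing_of_length_eq hm hy, hb]))
  refine eq_zero_of_mem (((heckeT R L).repr h).support.sup cs.length + 1)
    (mem_intSpan_iff.2 fun y => ⟨(isIntNeg_iff.1 (hn y)).1, fun hy => ?_⟩)
  exact Finsupp.notMem_support_iff.1 fun hs =>
    absurd (Finset.le_sup (f := cs.length) hs) (by omega)

variable [Fintype W]

theorem IsKLElement.unique {w : W} {c c' : Hecke R L} (hc : IsKLElement R L w c)
    (hc' : IsKLElement R L w c') : c = c' := by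
  rw [isKLElement_iff] at hc hc'
  refine sub_eq_zero.1 (eq_zero_of_barRing_eq (fun y => ?_) (by rw [map_sub, hc.1, hc'.1]))
  simpa only [map_sub, Finsupp.sub_apply, ← sub_eq_add_neg, sub_sub_sub_cancel_right] using
    (hc.2 y).add (hc'.2 y).neg

theorem exists_isKLElement (w : W) :
    ∃ c, IsKLElement R L w c ∧ c - heckeT R L w ∈ intSpan R L (cs.length w) := by
  obtain ⟨k, hk, k_neg, he⟩ := exists_sub_barRing (barRing_heckeT_sub_mem (R := R) (L := L) w)
    (by rw [map_sub, barRing_barRing, neg_sub])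
  refine ⟨heckeT R L w + k, isKLElement_iff.2 ⟨?_, ?_⟩, by rwa [add_sub_cancel_left]⟩
  · rw [map_add, sub_eq_iff_eq_add.1 he]
    abel
  · rwa [add_sub_cancel_left]

theorem isKLElement_klC' (w : W) : IsKLElement R L w (klC' R L w) :=
  Classical.epsilon_spec ⟨_, (exists_isKLElement w).choose_spec.1⟩

theorem klC'_sub_mem (w : W) : klC' R L w - heckeT R L w ∈ intSpan R L (cs.length w) := by
  obtain ⟨c, hc, hm⟩ := exists_isKLElement (R := R) (L := L) w
  rwa [(isKLElement_klC' w).unique hc]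

theorem klC_eq (w : W) : klC R L w = signRing R L (klC' R L w) := by
  rw [klC, dagger_eq, (isKLElement_iff.1 (isKLElement_klC' w)).1]

theorem flat_klC (w : W) : flat R L (klC R L w) = klC R L w⁻¹ := by
  obtain ⟨bar_eq, neg⟩ := isKLElement_iff.1 (isKLElement_klC' (R := R) (L := L) w)
  have flat_klC' : flat R L (klC' R L w) = klC' R L w⁻¹ := by
    refine IsKLElement.unique (isKLElement_iff.2 ⟨?_, fun y => ?_⟩) (isKLElement_klC' _)
    · rw [← flat_barRing, bar_eq]
    · rw [← flat_heckeT, ← map_sub, repr_flat]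
      exact neg y⁻¹
  rw [klC_eq, klC_eq, flat_signRing, flat_klC']

theorem klC_simple {i : B} (hi : 0 < L (cs.simple i)) :
    klC R L (cs.simple i) = eps R (L (cs.simple i)) • 1 - heckeT R L (cs.simple i) := by
  classical
  have klC'_simple : klC' R L (cs.simple i) =
      heckeT R L (cs.simple i) + eps R (-L (cs.simple i)) • 1 := by
    refine (isKLElement_klC' _).unique (isKLElement_iff.2 ⟨?_, fun y => ?_⟩)
    · rw [map_add, barRing_heckeT, cs.inv_simple, inverse_heckeT_simple, barRing_smul, map_one,
        barHom_eps, neg_neg, xi, sub_smul]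
      abel
    · rw [add_sub_cancel_left, map_smul, ← heckeT_one, Module.Basis.repr_self,
        Finsupp.smul_single_one, Finsupp.single_apply]
      split_ifs
      exacts [isIntNeg_eps (neg_lt_zero.2 hi), isIntNeg_zero]
  rw [klC_eq, klC'_simple, map_add, signRing_heckeT, signRing_smul, map_one, barHom_eps, neg_neg,
    cs.length_simple, pow_one, neg_one_smul, neg_add_eq_sub]

theorem signRing_klC'_sub (w : W) : signRing R L (klC' R L w - heckeT R L w) =
    klC R L w - (-1 : ℤ) ^ cs.length w • heckeT R L w := by
  rw [map_sub, klC_eq, signRing_heckeT]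

theorem klC_sub_mem (w : W) :
    klC R L w - (-1 : ℤ) ^ cs.length w • heckeT R L w ∈ intSpan R L (cs.length w) :=
  signRing_klC'_sub (R := R) (L := L) w ▸ signRing_mem_intSpan (klC'_sub_mem w)

theorem pos_of_coeff_repr_klC_sub_ne_zero {w y : W} {g : Γ}
    (h : ((heckeT R L).repr (klC R L w - (-1 : ℤ) ^ cs.length w • heckeT R L w) y).coeff g ≠ 0) :
    0 < g := by
  have neg := (isKLElement_iff.1 (isKLElement_klC' (R := R) (L := L) w)).2 y
  refine neg_lt_zero.1 ((isIntNeg_iff.1 neg).2 (-g) fun h0 => h ?_)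
  rw [← signRing_klC'_sub, repr_signRing, AddMonoidAlgebra.coeff_smul, Finsupp.smul_apply,
    coeff_barHom, h0, smul_zero]

theorem mem_span_klC_of_mem_intSpan (n : ℕ) {h : Hecke R L} (hh : h ∈ intSpan R L n) :
    h ∈ Submodule.span (AddMonoidAlgebra R Γ) (Set.range (klC R L)) := by
  suffices hle : intSpan R L n ≤ (Submodule.span (AddMonoidAlgebra R Γ)
      (Set.range (klC R L))).restrictScalars (intCoeffs Γ R) from hle hh
  clear hh h
  induction n with
  | zero => exact fun h hh => eq_zero_of_mem_intSpan_zero hh ▸ zero_mem _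
  | succ n ih =>
    rw [intSpan, Submodule.span_le]
    rintro _ ⟨w, hw, rfl⟩
    have signed : (-1 : ℤ) ^ cs.length w • heckeT R L w ∈
        Submodule.span (AddMonoidAlgebra R Γ) (Set.range (klC R L)) := by
      simpa using sub_mem (Submodule.subset_span (Set.mem_range_self w))
        (ih (intSpan_mono (Nat.lt_succ_iff.1 hw) (klC_sub_mem w)))
    rcases neg_one_pow_eq_or ℤ (cs.length w) with hs | hs <;> rw [hs] at signed
    · simpa using signed
    · simpa using neg_mem signed

theorem top_le_span_klC : ⊤ ≤ Submodule.span (AddMonoidAlgebra R Γ) (Set.range (klC R L)) := by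
  rw [← (heckeT R L).span_eq, Submodule.span_le]
  rintro _ ⟨w, rfl⟩
  exact mem_span_klC_of_mem_intSpan _ (heckeT_mem_intSpan (Nat.lt_succ_self _))

theorem constr_klC_bijective :
    Function.Bijective ((heckeT R L).constr (AddMonoidAlgebra R Γ) (klC R L)) := by
  have := Module.Finite.of_basis (heckeT R L)
  have surj : Function.Surjective ((heckeT R L).constr (AddMonoidAlgebra R Γ) (klC R L)) := by
    rw [← LinearMap.range_eq_top, Module.Basis.constr_range]
    exact top_le_iff.1 top_le_span_klC
  exact ⟨OrzechProperty.injective_of_surjective_endomorphism _ surj, surj⟩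

variable (R L) in
/-- The Kazhdan–Lusztig basis `C_w` of the Hecke algebra. -/
def klBasis : Module.Basis W (AddMonoidAlgebra R Γ) (Hecke R L) :=
  (heckeT R L).map (LinearEquiv.ofBijective _ constr_klC_bijective)

theorem klBasis_apply (w : W) : klBasis R L w = klC R L w := by
  rw [klBasis, Module.Basis.map_apply, LinearEquiv.ofBijective_apply, Module.Basis.constr_basis]

theorem klCoord_eq (h : Hecke R L) : klCoord R L h = (klBasis R L).repr h := by
  have hsum : h = ∑ z, klCoord R L h z • klBasis R L z := by
    simp only [klBasis_apply]
    exact Classical.epsilon_spec (p := fun c : W → AddMonoidAlgebra R Γ => h = ∑ z, c z • klC R L z)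
      ⟨(klBasis R L).repr h, by simpa only [klBasis_apply] using ((klBasis R L).sum_repr h).symm⟩
  conv_rhs => rw [hsum, (klBasis R L).repr_sum_self]

theorem sum_klCoord_smul_klC (h : Hecke R L) : ∑ z, klCoord R L h z • klC R L z = h := by
  simpa only [klCoord_eq, klBasis_apply] using (klBasis R L).sum_repr h

end KazhdanLusztigBasis

section CellOrder

variable {B W Γ : Type*} [Group W] [Fintype W] {M : CoxeterMatrix B} {cs : CoxeterSystem M W}
  [AddCommGroup Γ] [LinearOrder Γ] {R : Subring ℂ} {L : WeightFunction cs Γ}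

theorem leLR_refl (w : W) : leLR R L w w := Relation.ReflTransGen.refl

theorem leLR.trans {x y z : W} (h : leLR R L x y) (h' : leLR R L y z) : leLR R L x z :=
  Relation.ReflTransGen.trans h h'

theorem eqvLR_refl (w : W) : eqvLR R L w w := ⟨leLR_refl w, leLR_refl w⟩

theorem eqvLR.symm {x y : W} (h : eqvLR R L x y) : eqvLR R L y x := ⟨h.2, h.1⟩

theorem eqvLR.trans {x y z : W} (h : eqvLR R L x y) (h' : eqvLR R L y z) : eqvLR R L x z :=
  ⟨h.1.trans h'.1, h'.2.trans h.2⟩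

variable [IsOrderedAddMonoid Γ]

theorem klCoord_klC (w : W) : klCoord R L (klC R L w) = Finsupp.single w 1 := by
  rw [klCoord_eq, ← klBasis_apply, Module.Basis.repr_self]

theorem klCoord_flat (h : Hecke R L) (z : W) :
    klCoord R L (flat R L h) z = klCoord R L h z⁻¹ := by
  classical
  conv_lhs => rw [← sum_klCoord_smul_klC h]
  simp only [map_sum, map_smul, flat_klC, klCoord_eq, Finsupp.finsetSum_apply,
    Finsupp.smul_apply, smul_eq_mul]
  simp only [← klCoord_eq, klCoord_klC, Finsupp.single_apply, inv_eq_iff_eq_inv]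
  simp

theorem hConst_inv (x y z : W) : hConst R L x⁻¹ y⁻¹ z⁻¹ = hConst R L y x z := by
  rw [hConst, hConst, ← flat_klC, ← flat_klC, ← flat_mul, klCoord_flat, inv_inv]

theorem leLR.inv {y w : W} (h : leLR R L y w) : leLR R L y⁻¹ w⁻¹ := by
  refine Relation.ReflTransGen.lift (p := stepLR R L) (·⁻¹) ?_ y w h
  rintro a b ⟨i, hi⟩
  refine ⟨i, ?_⟩
  rw [← cs.inv_simple i, hConst_inv, hConst_inv]
  exact hi.symm

variable (R L) in
/-- The span of the `C_y` with `y ≤_LR w`. It is a two-sided ideal if `L` is positive on the simple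
reflections. -/
def lowerIdeal (w : W) : Submodule (AddMonoidAlgebra R Γ) (Hecke R L) :=
  Submodule.span _ (klBasis R L '' {y | leLR R L y w})

theorem mem_lowerIdeal {w : W} {h : Hecke R L} :
    h ∈ lowerIdeal R L w ↔ ∀ y, klCoord R L h y ≠ 0 → leLR R L y w := by
  simp only [lowerIdeal, Module.Basis.mem_span_image, klCoord_eq, Set.subset_def,
    Finset.mem_coe, Finsupp.mem_support_iff, Set.mem_ofPred_eq]

theorem klC_mem_lowerIdeal {y w : W} (h : leLR R L y w) : klC R L y ∈ lowerIdeal R L w :=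
  Submodule.subset_span ⟨y, h, klBasis_apply y⟩

theorem flat_mem_lowerIdeal {w : W} {h : Hecke R L} (hh : h ∈ lowerIdeal R L w) :
    flat R L h ∈ lowerIdeal R L w⁻¹ := by
  rw [mem_lowerIdeal] at hh ⊢
  intro y hy
  rw [klCoord_flat] at hy
  simpa using (hh _ hy).inv

theorem heckeT_simple_mul_mem_lowerIdeal {i : B} (hL : 0 < L (cs.simple i)) {w : W}
    {h : Hecke R L} (hh : h ∈ lowerIdeal R L w) :
    heckeT R L (cs.simple i) * h ∈ lowerIdeal R L w := by
  suffices hle : lowerIdeal R L w ≤ (lowerIdeal R L w).comap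
      (LinearMap.mulLeft _ (heckeT R L (cs.simple i))) from hle hh
  refine Submodule.span_le.2 ?_
  rintro _ ⟨y, hy, rfl⟩
  have heckeT_eq : heckeT R L (cs.simple i) =
      eps R (L (cs.simple i)) • 1 - klC R L (cs.simple i) := by rw [klC_simple hL, sub_sub_cancel]
  rw [klBasis_apply, SetLike.mem_coe, Submodule.mem_comap, LinearMap.mulLeft_apply, heckeT_eq,
    sub_mul, smul_mul_assoc, one_mul]
  refine sub_mem (Submodule.smul_mem _ _ (klC_mem_lowerIdeal hy)) (mem_lowerIdeal.2 fun z hz => ?_)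
  exact (Relation.ReflTransGen.single ⟨i, Or.inl hz⟩ : leLR R L z y).trans hy

theorem mul_mem_lowerIdeal_left (hL : ∀ i : B, 0 < L (cs.simple i)) (x : Hecke R L) {w : W}
    {h : Hecke R L} (hh : h ∈ lowerIdeal R L w) : x * h ∈ lowerIdeal R L w := by
  induction x using hecke_induction with
  | smul a v =>
    rw [smul_mul_assoc]
    refine Submodule.smul_mem _ _ ?_
    induction v using length_induction cs with
    | one => rwa [heckeT_one, one_mul]
    | simple_mul i v hv ih =>
      rw [← (isHeckeFamily_heckeT R L).simple_mul_of_lt i v hv, mul_assoc]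
      exact heckeT_simple_mul_mem_lowerIdeal (hL i) ih
  | add x y hx hy =>
    rw [add_mul]
    exact add_mem hx hy

theorem mul_mem_lowerIdeal_right (hL : ∀ i : B, 0 < L (cs.simple i)) (x : Hecke R L) {w : W}
    {h : Hecke R L} (hh : h ∈ lowerIdeal R L w) : h * x ∈ lowerIdeal R L w := by
  have h_flat := flat_mem_lowerIdeal
    (mul_mem_lowerIdeal_left hL (flat R L x) (flat_mem_lowerIdeal hh))
  rwa [flat_mul, flat_flat, flat_flat, inv_inv] at h_flat

theorem leLR_of_klCoord_mul_ne_zero (hL : ∀ i : B, 0 < L (cs.simple i)) {x : Hecke R L} {y w : W}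
    (h : klCoord R L (x * klC R L w) y ≠ 0) : leLR R L y w :=
  mem_lowerIdeal.1 (mul_mem_lowerIdeal_left hL x (klC_mem_lowerIdeal (leLR_refl w))) y h

end CellOrder

section Irreducible

open CategoryTheory Representation
open scoped MonoidAlgebra

universe u v

variable {k : Type u} {G : Type v} {V : Type*} [Field k] [Monoid G] [AddCommGroup V] [Module k V]

theorem exists_equiv_fin_fun [FiniteDimensional k V] (σ : Representation k G V) :
    ∃ τ : Representation k G (Fin (Module.finrank k V) → k), Nonempty (τ.Equiv σ) := by
  let e := (Module.finBasis k V).equivFun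
  refine ⟨(e.conjRingEquiv : _ →* _).comp σ, ⟨.mk e.symm fun g => ?_⟩⟩
  ext x
  simp

theorem isIrreducible_of_equiv {V' : Type*} [AddCommGroup V'] [Module k V']
    {τ : Representation k G V'} {σ : Representation k G V} (e : τ.Equiv σ) [IsIrreducible σ] :
    IsIrreducible τ := by
  rw [irreducible_iff_isSimpleModule_asModule]
  exact IsSimpleModule.congr (LinearEquiv.ofBijective
    (IntertwiningMap.equivLinearMapAsModule τ σ e.toIntertwiningMap) e.bijective)

theorem simple_of_isIrreducible {V : Type u} [AddCommGroup V] [Module k V] [FiniteDimensional k V]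
    (σ : Representation k G V) [IsIrreducible σ] : Simple (FDRep.of σ) := by
  let F := forget₂ (FDRep k G) (Rep k G) ⋙ Rep.toModuleMonoidAlgebra
  have : Simple (F.obj (FDRep.of σ)) := inferInstanceAs (Simple (ModuleCat.of k[G] σ.asModule))
  exact F.simple_of_simple_obj _

theorem exists_asAlgebraHom_eq_smul_one [IsAlgClosed k] [FiniteDimensional k V]
    (σ : Representation k G V) [IsIrreducible σ] {z : k[G]} (hz : ∀ a, Commute z a) :
    ∃ c : k, σ.asAlgebraHom z = c • 1 := by
  let ζ : IntertwiningMap σ σ :=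
    { toLinearMap := σ.asAlgebraHom z
      isIntertwining' := fun g => by
        have := (hz (MonoidAlgebra.of k G g)).map σ.asAlgebraHom
        rwa [asAlgebraHom_of] at this }
  obtain ⟨c, hc⟩ := IsIrreducible.algebraMap_intertwiningMap_bijective_of_isAlgClosed.2 ζ
  exact ⟨c, congrArg IntertwiningMap.toLinearMap hc.symm⟩

theorem asAlgebraHom_ofModule' [Module k[G] V] [IsScalarTower k k[G] V] :
    asAlgebraHom (ofModule' (k := k) (G := G) V) = Algebra.lsmul k k V :=
  (MonoidAlgebra.lift k _ G).apply_symm_apply _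

theorem isIrreducible_ofModule' [Module k[G] V] [IsScalarTower k k[G] V] [IsSimpleModule k[G] V] :
    IsIrreducible (ofModule' (k := k) (G := G) V) := by
  rw [irreducible_iff_isSimpleModule_asModule]
  let e : asModule (ofModule' (k := k) (G := G) V) ≃ₗ[k[G]] V :=
    { asModuleEquiv (ofModule' (k := k) (G := G) V) with
      map_smul' := fun a x => (asModuleEquiv_map_smul _ a x).trans
        (LinearMap.congr_fun (DFunLike.congr_fun asAlgebraHom_ofModule' a) _) }
  exact IsSimpleModule.congr e

theorem eq_zero_of_forall_asAlgebraHom_eq_zero {G : Type v} [Group G] [Finite G]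
    [NeZero (Nat.card G : k)] {z : k[G]}
    (hz : ∀ (V : Type (max u v)) [AddCommGroup V] [Module k V] [FiniteDimensional k V]
      (σ : Representation k G V) [σ.IsIrreducible], σ.asAlgebraHom z = 0) : z = 0 := by
  rw [← Submodule.mem_bot k[G], ← IsSemisimpleRing.jacobson_eq_bot,
    Ring.jacobson_eq_sInf_isMaximal, Submodule.mem_sInf]
  intro I (hI : Ideal.IsMaximal I)
  have : IsSimpleModule k[G] (k[G] ⧸ I) := isSimpleModule_iff_isCoatom.2 hI.out
  have := isIrreducible_ofModule' (k := k) (G := G) (V := k[G] ⧸ I)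
  have := hz _ (ofModule' (k := k) (G := G) (k[G] ⧸ I))
  rw [asAlgebraHom_ofModule'] at this
  simpa [← Submodule.Quotient.mk_smul, Submodule.Quotient.mk_eq_zero] using
    LinearMap.congr_fun this (Submodule.Quotient.mk 1)

theorem commute_of_coeff_conj {k G : Type*} [CommSemiring k] [Group G] {z : k[G]}
    (hz : ∀ g h, z.coeff (h * g * h⁻¹) = z.coeff g) (a : k[G]) : Commute z a := by
  induction a using MonoidAlgebra.induction_linear with
  | zero => exact Commute.zero_right z
  | add a b ha hb => exact ha.add_right hb
  | single h r =>
    ext g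
    rw [MonoidAlgebra.coeff_mul_single_apply, MonoidAlgebra.coeff_single_mul_apply, mul_comm,
      ← hz (h⁻¹ * g) h, mul_inv_cancel_left]

end Irreducible

section RegularCharacter

open CategoryTheory Representation
open scoped MonoidAlgebra

variable {W Λ : Type*} [Group W] {E : Λ → FDRep ℂ W}

theorem IsIrrFamily.exists_character_eq (hE : IsIrrFamily E) {V : Type*} [AddCommGroup V]
    [Module ℂ V] [FiniteDimensional ℂ V] (σ : Representation ℂ W V) [IsIrreducible σ] :
    ∃ l, (E l).character = σ.character := by
  obtain ⟨τ, ⟨e⟩⟩ := exists_equiv_fin_fun σ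
  have := isIrreducible_of_equiv e
  obtain ⟨l, ⟨i⟩⟩ := hE.complete (FDRep.of τ) (simple_of_isIrreducible τ)
  exact ⟨l, (FDRep.char_iso i).symm.trans (char_iso e)⟩

theorem IsIrrFamily.asAlgebraHom_eq_zero [Fintype W] (hE : IsIrrFamily E) {z : ℂ[W]}
    (hz : ∀ a, Commute z a) (h : ∀ l, ∑ g, z.coeff g * (E l).character g = 0) {V : Type*}
    [AddCommGroup V] [Module ℂ V] [FiniteDimensional ℂ V] (σ : Representation ℂ W V)
    [IsIrreducible σ] :
    σ.asAlgebraHom z = 0 := by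
  obtain ⟨l, hl⟩ := hE.exists_character_eq σ
  obtain ⟨c, hc⟩ := exists_asAlgebraHom_eq_smul_one σ hz
  have trace_eq : c * Module.finrank ℂ V = 0 := by
    rw [← h l, hl, ← smul_eq_mul, ← LinearMap.trace_one, ← map_smul, ← hc, asAlgebraHom_def,
      MonoidAlgebra.lift_apply, Finsupp.sum_fintype _ _ (by simp), map_sum]
    simp [character]
  have : Nontrivial V := IsSimpleModule.nontrivial ℂ[W] σ.asModule
  have finrank_ne_zero : (Module.finrank ℂ V : ℂ) ≠ 0 :=
    Nat.cast_ne_zero.2 Module.finrank_pos.ne'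
  rw [hc, (mul_eq_zero.1 trace_eq).resolve_right finrank_ne_zero, zero_smul]

theorem IsIrrFamily.eq_zero_of_sum_mul_character_eq_zero [Fintype W] (hE : IsIrrFamily E)
    {z : ℂ[W]} (hz : ∀ a, Commute z a) (h : ∀ l, ∑ g, z.coeff g * (E l).character g = 0) : z = 0 :=
  have : NeZero (Nat.card W : ℂ) := ⟨by simp⟩
  eq_zero_of_forall_asAlgebraHom_eq_zero fun _ _ _ _ σ _ => hE.asAlgebraHom_eq_zero hz h σ

theorem IsIrrFamily.sum_character_mul_character_inv [Fintype W] [DecidableEq Λ]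
    (hE : IsIrrFamily E) (l m : Λ) :
    ∑ g : W, (E l).character g * (E m).character g⁻¹ =
      if l = m then (Nat.card W : ℂ) else 0 := by
  have := hE.simple l
  have := hE.simple m
  have card_ne_zero : (Nat.card W : ℂ) ≠ 0 := by simp
  have : Invertible (Nat.card W : ℂ) := invertibleOfNonzero card_ne_zero
  have h := FDRep.char_orthonormal (E l) (E m)
  rw [inv_mul_eq_iff_eq_mul₀ card_ne_zero] at h
  rw [h]
  have iso_iff : Nonempty (E l ≅ E m) ↔ l = m :=
    ⟨hE.inequivalent l m, fun hlm => hlm ▸ ⟨Iso.refl _⟩⟩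
  simp [iso_iff]

theorem IsIrrFamily.sum_finrank_mul_character [Finite W] [Fintype Λ] [DecidableEq W]
    (hE : IsIrrFamily E) (w : W) :
    ∑ l, (Module.finrank ℂ (E l) : ℂ) * (E l).character w =
      if w = 1 then (Nat.card W : ℂ) else 0 := by
  classical
  have := Fintype.ofFinite W
  set f : W → ℂ := fun g => ∑ l, (Module.finrank ℂ (E l) : ℂ) * (E l).character g -
    if g = 1 then (Nat.card W : ℂ) else 0 with hf
  set z : ℂ[W] := ∑ g : W, MonoidAlgebra.single g (f g⁻¹) with hz
  have coeff_z (g : W) : z.coeff g = f g⁻¹ := by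
    simp [hz, Finsupp.single_apply]
  suffices z_eq_zero : z = 0 by
    rw [← sub_eq_zero, ← inv_inv w]
    exact (coeff_z w⁻¹).symm.trans (by simp [z_eq_zero])
  refine hE.eq_zero_of_sum_mul_character_eq_zero (commute_of_coeff_conj fun g h => ?_) fun m => ?_
  · have conj_inv : (h * g * h⁻¹)⁻¹ = h * g⁻¹ * h⁻¹ := by simp [mul_assoc]
    simp only [coeff_z, conj_inv, hf, FDRep.char_conj, conj_eq_one_iff]
  · have orthogonality (l : Λ) : ∑ g : W, (Module.finrank ℂ (E l) : ℂ) * (E l).character g⁻¹ *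
        (E m).character g = if m = l then (Module.finrank ℂ (E l) : ℂ) * Nat.card W else 0 := by
      simp only [mul_assoc, ← Finset.mul_sum, mul_comm ((E l).character _),
        hE.sum_character_mul_character_inv, mul_ite, mul_zero]
    simp only [coeff_z, hf, sub_mul, Finset.sum_sub_distrib, Finset.sum_mul, inv_eq_one, ite_mul,
      zero_mul]
    rw [Finset.sum_comm]
    simp only [orthogonality]
    simp [mul_comm]

end RegularCharacter

section SchurRelations

variable {B W : Type*} [Group W] {M : CoxeterMatrix B} {cs : CoxeterSystem M W}

theorem IsHeckeFamily.mul_sum_mul_mul_inv [Fintype W] {A n m : Type*} [CommRing A] [Fintype n]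
    [Fintype m] [DecidableEq n] [DecidableEq m] {ζ : B → A} {σ : W → Matrix n n A}
    {τ : W → Matrix m m A} (hσ : IsHeckeFamily cs ζ σ) (hτ : IsHeckeFamily cs ζ τ)
    (X : Matrix n m A) (v : W) :
    σ v * ∑ w, σ w * X * τ w⁻¹ = (∑ w, σ w * X * τ w⁻¹) * τ v := by
  induction v using length_induction cs with
  | one => rw [hσ.map_one, hτ.map_one, Matrix.one_mul, Matrix.mul_one]
  | simple_mul i v hv ih =>
    have commutator (w : W) : σ (cs.simple i) * (σ w * X * τ w⁻¹) -
        σ w * X * τ w⁻¹ * τ (cs.simple i) =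
          σ (cs.simple i * w) * X * τ w⁻¹ - σ w * X * τ (w⁻¹ * cs.simple i) := by
      have hl : cs.length (w⁻¹ * cs.simple i) = cs.length (cs.simple i * w) := by
        rw [← cs.length_inv, mul_inv_rev, cs.inv_simple, inv_inv]
      rw [Matrix.mul_assoc (σ w * X), hτ.mul_simple, hl, cs.length_inv, ← Matrix.mul_assoc,
        ← Matrix.mul_assoc, hσ.simple_mul]
      split_ifs
      · rfl
      · simp only [Matrix.add_mul, Matrix.mul_add, Matrix.smul_mul, Matrix.mul_smul]
        abel
    have reindex : ∑ w, σ (cs.simple i * w) * X * τ w⁻¹ =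
        ∑ w, σ w * X * τ (w⁻¹ * cs.simple i) := by
      rw [← Equiv.sum_comp (Equiv.mulLeft (cs.simple i)) fun w =>
        σ w * X * τ (w⁻¹ * cs.simple i)]
      simp
    have simple_comm : σ (cs.simple i) * ∑ w, σ w * X * τ w⁻¹ =
        (∑ w, σ w * X * τ w⁻¹) * τ (cs.simple i) := by
      rw [← sub_eq_zero, Matrix.mul_sum, Matrix.sum_mul, ← Finset.sum_sub_distrib]
      simp only [commutator, Finset.sum_sub_distrib, reindex, sub_self]
    rw [← hσ.simple_mul_of_lt i v hv, ← hτ.simple_mul_of_lt i v hv, Matrix.mul_assoc, ih,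
      ← Matrix.mul_assoc, simple_comm, Matrix.mul_assoc]

/-- Matrix representations `σ l` of a Hecke algebra over a field `𝕂`, whose characters take values
in a subring `j : A → 𝕂` and specialise under a homomorphism `θ` killing the parameters to
functions `χ l` with `∑ l, d l * χ l` the regular character. This last condition makes
`𝕂 ⊗ H` split semisimple with simple modules `σ l`. -/
structure IsSplitFamily {A 𝕂 k Λ : Type*} [CommRing A] [Field 𝕂] [Field k] [Fintype Λ]
    (cs : CoxeterSystem M W) (j : A →+* 𝕂) (θ : A →+* k) (ξ : B → A) (χ : Λ → W → k) {d : Λ → ℕ}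
    (σ : ∀ l, W → Matrix (Fin (d l)) (Fin (d l)) 𝕂) : Prop where
  injective : Function.Injective j
  map_parameter : ∀ i, θ (ξ i) = 0
  isHeckeFamily : ∀ l, IsHeckeFamily cs (j ∘ ξ) (σ l)
  exists_trace_eq : ∀ l w, ∃ a, j a = (σ l w).trace ∧ θ a = χ l w
  sum_mul_one : ∑ l, (d l : k) * χ l 1 = Nat.card W
  sum_mul_of_ne_one : ∀ w, w ≠ 1 → ∑ l, (d l : k) * χ l w = 0

namespace IsSplitFamily

variable {A 𝕂 k Λ : Type*} [CommRing A] [Field 𝕂] [Field k] [Fintype Λ]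
  {j : A →+* 𝕂} {θ : A →+* k} {ξ : B → A} {χ : Λ → W → k} {d : Λ → ℕ}
  {σ : ∀ l, W → Matrix (Fin (d l)) (Fin (d l)) 𝕂}

theorem exists_trace_mul_eq (H : IsSplitFamily cs j θ ξ χ σ) (l : Λ) (x y : W) :
    ∃ a, j a = (σ l x * σ l y).trace ∧ θ a = χ l (x * y) := by
  induction x using length_induction_right cs generalizing y with
  | one =>
    rw [(H.isHeckeFamily l).map_one, one_mul, one_mul]
    exact H.exists_trace_eq l y
  | mul_simple x i hx ih =>
    rw [← (H.isHeckeFamily l).mul_simple_of_lt hx, mul_assoc, mul_assoc,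
      (H.isHeckeFamily l).simple_mul]
    obtain ⟨a, ha, ha'⟩ := ih (cs.simple i * y)
    split_ifs
    · exact ⟨a, ha, ha'⟩
    · obtain ⟨b, hb, -⟩ := ih y
      refine ⟨a + ξ i * b, ?_, ?_⟩
      · rw [mul_add, mul_smul_comm, Matrix.trace_add, Matrix.trace_smul, smul_eq_mul, map_add,
          map_mul, ha, hb, Function.comp_apply]
      · rw [map_add, map_mul, H.map_parameter, zero_mul, add_zero, ha']

variable [CharZero k]

theorem sum_sq (H : IsSplitFamily cs j θ ξ χ σ) : ∑ l, d l * d l = Nat.card W := by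
  have chi_one (l : Λ) : χ l 1 = d l := by
    obtain ⟨a, ha, ha'⟩ := H.exists_trace_eq l 1
    rw [(H.isHeckeFamily l).map_one, Matrix.trace_one, Fintype.card_fin, ← map_natCast j] at ha
    rw [← ha', H.injective ha, map_natCast]
  have := H.sum_mul_one
  simp only [chi_one] at this
  exact_mod_cast this

/-- The Gram matrix of the form `(x, y) ↦ ∑ l, d l * tr (σ l x * σ l y)` specialises to a non-zero
multiple of the identity matrix, hence is nonsingular. -/
theorem linearIndependent [Finite W] (H : IsSplitFamily cs j θ ξ χ σ) :
    LinearIndependent 𝕂 fun w l => σ l w := by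
  classical
  have := Fintype.ofFinite W
  choose g hjg hθg using H.exists_trace_mul_eq
  let G : Matrix W W A := Matrix.of fun x y => ∑ l, (d l : A) * g l x y⁻¹
  have map_G : θ.mapMatrix G = Matrix.diagonal fun _ => (Nat.card W : k) := by
    ext x y
    simp only [G, RingHom.mapMatrix_apply, Matrix.map_apply, Matrix.of_apply, map_sum, map_mul,
      map_natCast, hθg, Matrix.diagonal_apply]
    split_ifs with hxy
    · rw [hxy, mul_inv_cancel, H.sum_mul_one]
    · exact H.sum_mul_of_ne_one _ (mt mul_inv_eq_one.1 hxy)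
  have det_ne_zero : (j.mapMatrix G).det ≠ 0 := by
    rw [← RingHom.map_det, Ne, map_eq_zero_iff j H.injective]
    intro h
    have := congrArg θ h
    rw [RingHom.map_det, map_G, Matrix.det_diagonal, map_zero] at this
    simp at this
  rw [Fintype.linearIndependent_iff]
  intro a ha
  refine congrFun (Matrix.eq_zero_of_vecMul_eq_zero det_ne_zero ?_)
  ext y
  have trace_eq_zero (l : Λ) : ∑ w, a w * (σ l w * σ l y⁻¹).trace = 0 := by
    have := congrArg (fun P : ∀ l, Matrix _ _ 𝕂 => (P l * σ l y⁻¹).trace) ha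
    simpa [Matrix.sum_mul, Finset.sum_apply] using this
  simp only [Matrix.vecMul, dotProduct, G, RingHom.mapMatrix_apply, Matrix.map_apply,
    Matrix.of_apply, map_sum, map_mul, map_natCast, hjg, Finset.mul_sum, Pi.zero_apply]
  rw [Finset.sum_comm]
  simp only [mul_left_comm (a _), ← Finset.mul_sum, trace_eq_zero, mul_zero,
    Finset.sum_const_zero]

theorem span_eq_top [Finite W] (H : IsSplitFamily cs j θ ξ χ σ) :
    Submodule.span 𝕂 (Set.range fun w l => σ l w) = ⊤ := by
  have := Fintype.ofFinite W
  refine H.linearIndependent.span_eq_top_of_card_eq_finrank' ?_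
  rw [Module.finrank_pi_fintype, ← Nat.card_eq_fintype_card, ← H.sum_sq]
  simp [Module.finrank_matrix]

variable [Fintype W]

theorem mul_sum_mul_mul_inv (H : IsSplitFamily cs j θ ξ χ σ) {l m : Λ}
    (X : Matrix (Fin (d l)) (Fin (d m)) 𝕂) (P : ∀ l, Matrix (Fin (d l)) (Fin (d l)) 𝕂) :
    P l * ∑ w, σ l w * X * σ m w⁻¹ = (∑ w, σ l w * X * σ m w⁻¹) * P m := by
  have hP : P ∈ Submodule.span 𝕂 (Set.range fun w l => σ l w) := H.span_eq_top ▸ trivial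
  induction hP using Submodule.span_induction with
  | mem P hP =>
    obtain ⟨v, rfl⟩ := hP
    exact (H.isHeckeFamily l).mul_sum_mul_mul_inv (H.isHeckeFamily m) X v
  | zero => simp
  | add P Q _ _ hP hQ => rw [Pi.add_apply, Pi.add_apply, Matrix.add_mul, Matrix.mul_add, hP, hQ]
  | smul c P _ hP => rw [Pi.smul_apply, Pi.smul_apply, Matrix.smul_mul, Matrix.mul_smul, hP]

theorem sum_mul_single_mul_inv_apply {n m : Type*} [Fintype n] [Fintype m] [DecidableEq n]
    [DecidableEq m] (f : W → Matrix n n 𝕂) (g : W → Matrix m m 𝕂) (i p : n) (q k : m) :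
    (∑ w, f w * Matrix.single p q (1 : 𝕂) * g w⁻¹) i k = ∑ w, f w i p * g w⁻¹ q k := by
  simp [Matrix.sum_apply, Matrix.mul_apply, Matrix.single_apply, ite_and]

theorem sum_mul_inv_eq_zero (H : IsSplitFamily cs j θ ξ χ σ) {l m : Λ} (hlm : l ≠ m)
    (i p : Fin (d l)) (q k : Fin (d m)) : ∑ w, σ l w i p * σ m w⁻¹ q k = 0 := by
  classical
  have := H.mul_sum_mul_mul_inv (Matrix.single p q 1) (Pi.single l 1)
  rw [Pi.single_eq_same, Pi.single_eq_of_ne hlm.symm, Matrix.one_mul, Matrix.mul_zero] at this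
  rw [← sum_mul_single_mul_inv_apply, this, Matrix.zero_apply]

theorem exists_sum_mul_inv_eq (H : IsSplitFamily cs j θ ξ χ σ) (l : Λ) :
    ∃ c : 𝕂, ∀ i p q k, ∑ w, σ l w i p * σ l w⁻¹ q k = if i = k ∧ p = q then c else 0 := by
  classical
  have exists_scalar (p q : Fin (d l)) :
      ∃ c : 𝕂, Matrix.scalar _ c = ∑ w, σ l w * Matrix.single p q 1 * σ l w⁻¹ := by
    refine Matrix.mem_range_scalar_of_commute_single fun i k _ => ?_
    simpa [Commute, SemiconjBy] using
      H.mul_sum_mul_mul_inv (l := l) (m := l) (Matrix.single p q 1)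
        (Pi.single l (Matrix.single i k 1))
  choose c hc using exists_scalar
  have sum_eq (i p q k : Fin (d l)) :
      ∑ w, σ l w i p * σ l w⁻¹ q k = if i = k then c p q else 0 := by
    rw [← sum_mul_single_mul_inv_apply, ← hc, Matrix.scalar_apply, Matrix.diagonal_apply]
  have sum_symm (i p q k : Fin (d l)) :
      ∑ w, σ l w i p * σ l w⁻¹ q k = ∑ w, σ l w q k * σ l w⁻¹ i p := by
    rw [← Equiv.sum_comp (Equiv.inv W)]
    simp [mul_comm]
  have c_eq (i p q : Fin (d l)) : c p q = if p = q then c i i else 0 := by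
    have := sum_symm i p q i
    rw [sum_eq, sum_eq, if_pos rfl] at this
    simpa only [eq_comm] using this
  rcases isEmpty_or_nonempty (Fin (d l)) with _ | ⟨⟨i₀⟩⟩
  · exact ⟨0, fun i => isEmptyElim i⟩
  · exact ⟨c i₀ i₀, fun i p q k => by rw [sum_eq, c_eq i₀, ite_and]⟩

theorem sum_mul_inv_eq (H : IsSplitFamily cs j θ ξ χ σ) [CharZero 𝕂] (l : Λ)
    (i p q k : Fin (d l)) :
    ∑ w, σ l w i p * σ l w⁻¹ q k =
      if i = k ∧ p = q then (d l : 𝕂)⁻¹ * ∑ w, (σ l w).trace * (σ l w⁻¹).trace else 0 := by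
  obtain ⟨c, hc⟩ := H.exists_sum_mul_inv_eq l
  have sum_trace : ∑ w, (σ l w).trace * (σ l w⁻¹).trace = d l * c := by
    simp only [Matrix.trace, Matrix.diag_apply, Finset.sum_mul_sum]
    rw [Finset.sum_comm]
    simp only [Finset.sum_comm (s := (Finset.univ : Finset W)), hc]
    simp
  have d_ne_zero : (d l : 𝕂) ≠ 0 := Nat.cast_ne_zero.2 (Fin.pos i).ne'
  rw [sum_trace, inv_mul_cancel_left₀ d_ne_zero, hc]

end IsSplitFamily

end SchurRelations

section HahnSeries

variable {Γ S : Type*}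

theorem le_orderTop_sum [LinearOrder Γ] [AddCommMonoid S] {ι : Type*} {s : Finset ι}
    {x : ι → HahnSeries Γ S} {p : WithTop Γ} (hx : ∀ i ∈ s, p ≤ (x i).orderTop) :
    p ≤ (∑ i ∈ s, x i).orderTop := by
  rw [HahnSeries.le_orderTop_iff_forall]
  intro g hg
  rw [HahnSeries.coeff_sum]
  exact Finset.sum_eq_zero fun i hi => HahnSeries.le_orderTop_iff_forall.1 (hx i hi) g hg

theorem exists_le_orderTop_coeff_ne_zero [Zero Γ] [LinearOrder Γ] [Zero S]
    {ι : Type*} [Finite ι] {x : ι → HahnSeries Γ S} (hx : x ≠ 0) :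
    ∃ p : Γ, (∀ i, p ≤ (x i).orderTop) ∧ ∃ i, (x i).coeff p ≠ 0 := by
  obtain ⟨k, hk⟩ := Function.ne_iff.1 hx
  have := Nonempty.intro k
  obtain ⟨i, hi⟩ := Finite.exists_min fun i => (x i).orderTop
  have hk' : x k ≠ 0 := hk
  have hi0 : x i ≠ 0 := by
    rw [← HahnSeries.orderTop_ne_top] at hk' ⊢
    exact ne_top_of_le_ne_top hk' (hi k)
  refine ⟨(x i).order, fun k => ?_, i, HahnSeries.coeff_order_eq_zero.not.2 hi0⟩
  rw [HahnSeries.order_eq_orderTop_of_ne_zero hi0]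
  exact hi k

variable [AddCommGroup Γ] [LinearOrder Γ] [IsOrderedAddMonoid Γ]

theorem coeff_add_mul_of_le_orderTop [NonUnitalNonAssocSemiring S] {x y : HahnSeries Γ S} {p q : Γ}
    (hx : p ≤ x.orderTop) (hy : q ≤ y.orderTop) :
    (x * y).coeff (p + q) = x.coeff p * y.coeff q := by
  rw [HahnSeries.coeff_mul, Finset.sum_eq_single (p, q)]
  · rintro ⟨a, b⟩ hab hne
    obtain ⟨ha, hb, hab⟩ := Finset.mem_antidiagonal.1 hab
    have hpa : p ≤ a := WithTop.coe_le_coe.1 (hx.trans (HahnSeries.orderTop_le_of_coeff_ne_zero ha))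
    have hqb : q ≤ b := WithTop.coe_le_coe.1 (hy.trans (HahnSeries.orderTop_le_of_coeff_ne_zero hb))
    obtain ⟨rfl, rfl⟩ := (add_eq_add_iff_eq_and_eq hpa hqb).1 hab.symm
    exact absurd rfl hne
  · intro h
    by_contra hne
    exact h (Finset.mem_antidiagonal.2 ⟨left_ne_zero_of_mul hne, right_ne_zero_of_mul hne, rfl⟩)

/-- Coefficientwise conjugation. -/
instance [CommRing S] [StarRing S] : StarRing (HahnSeries Γ S) where
  star x := x.map (starRingEnd S)
  star_involutive x := HahnSeries.ext (funext fun g => star_star (x.coeff g))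
  star_mul x y := by
    rw [mul_comm x]
    exact HahnSeries.map_mul (starRingEnd S).toNonUnitalRingHom
  star_add _ _ := HahnSeries.map_add (starRingEnd S).toAddMonoidHom

theorem coeff_star [CommRing S] [StarRing S] (x : HahnSeries Γ S) (g : Γ) :
    (star x).coeff g = star (x.coeff g) :=
  rfl

theorem le_orderTop_star [CommRing S] [StarRing S] {x : HahnSeries Γ S} {p : WithTop Γ}
    (hx : p ≤ x.orderTop) : p ≤ (star x).orderTop := by
  rw [HahnSeries.le_orderTop_iff_forall] at hx ⊢
  intro g hg
  rw [coeff_star, hx g hg, star_zero]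

theorem exists_orderTop_star_dotProduct_self [CommRing S] [PartialOrder S] [StarRing S]
    [StarOrderedRing S] [NoZeroDivisors S] {ι : Type*} [Fintype ι] {x : ι → HahnSeries Γ S}
    (hx : x ≠ 0) : ∃ p : Γ, (star x ⬝ᵥ x).orderTop = ((p + p : Γ) : WithTop Γ) := by
  obtain ⟨p, hp, i, hi⟩ := exists_le_orderTop_coeff_ne_zero hx
  have coeff_ne_zero : (star x ⬝ᵥ x).coeff (p + p) ≠ 0 := by
    have : (star x ⬝ᵥ x).coeff (p + p) =
        star (fun i => (x i).coeff p) ⬝ᵥ fun i => (x i).coeff p := by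
      rw [dotProduct, HahnSeries.coeff_sum]
      exact Finset.sum_congr rfl fun i _ =>
        coeff_add_mul_of_le_orderTop (le_orderTop_star (hp i)) (hp i)
    rw [this, Ne, dotProduct_star_self_eq_zero]
    exact fun h => hi (congrFun h i)
  refine ⟨p, le_antisymm (HahnSeries.orderTop_le_of_coeff_ne_zero coeff_ne_zero) ?_⟩
  exact le_orderTop_sum fun i _ =>
    (add_le_add (le_orderTop_star (hp i)) (hp i)).trans HahnSeries.orderTop_add_le_mul

end HahnSeries

namespace IsHeckeFamily

variable {B W n 𝕂 : Type*} [Group W] {M : CoxeterMatrix B} {cs : CoxeterSystem M W}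
  [Fintype n] [DecidableEq n] [Field 𝕂] [StarRing 𝕂] {ζ : B → 𝕂} {σ : W → Matrix n n 𝕂}

open scoped Matrix

theorem conjTranspose (hσ : IsHeckeFamily cs ζ σ) (hζ : ∀ i, star (ζ i) = ζ i) :
    IsHeckeFamily cs ζ fun w => (σ w⁻¹)ᴴ where
  map_one := by rw [inv_one, hσ.map_one, Matrix.conjTranspose_one]
  simple_mul_of_lt i w h := by
    rw [← Matrix.conjTranspose_mul, cs.inv_simple, hσ.mul_simple_of_lt, mul_inv_rev, cs.inv_simple]
    rwa [← cs.length_inv (w⁻¹ * _), mul_inv_rev, inv_inv, cs.inv_simple, cs.length_inv]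
  simple_mul_self i := by
    rw [← Matrix.conjTranspose_mul, cs.inv_simple, hσ.simple_mul_self, Matrix.conjTranspose_add,
      Matrix.conjTranspose_smul, hζ, Matrix.conjTranspose_one]

/-- `∑ w, (σ w)ᴴ * σ w` is nonsingular and intertwines `σ` with its contragredient. -/
theorem star_trace_inv [Fintype W] (hσ : IsHeckeFamily cs ζ σ) (hζ : ∀ i, star (ζ i) = ζ i)
    (anisotropic : ∀ x : W × n → 𝕂, star x ⬝ᵥ x = 0 → x = 0) (w : W) :
    star (σ w⁻¹).trace = (σ w).trace := by
  let I := ∑ u, (σ u⁻¹)ᴴ * 1 * σ u⁻¹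
  have intertwine : (σ w⁻¹)ᴴ * I = I * σ w :=
    (hσ.conjTranspose hζ).mul_sum_mul_mul_inv hσ 1 w
  have det_ne_zero : I.det ≠ 0 := by
    intro h
    obtain ⟨v, hv0, hv⟩ := Matrix.exists_mulVec_eq_zero_iff.2 h
    have form_eq : star v ⬝ᵥ I *ᵥ v =
        star (fun p : W × n => (σ p.1⁻¹ *ᵥ v) p.2) ⬝ᵥ fun p => (σ p.1⁻¹ *ᵥ v) p.2 := by
      refine Eq.trans ?_ (Fintype.sum_prod_type _).symm
      simp only [I, Matrix.mul_one, Matrix.sum_mulVec, dotProduct_sum, ← Matrix.mulVec_mulVec]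
      refine Finset.sum_congr rfl fun u _ => ?_
      rw [Matrix.dotProduct_mulVec, ← Matrix.star_mulVec]
      rfl
    rw [hv, dotProduct_zero] at form_eq
    refine hv0 (funext fun k => ?_)
    simpa [hσ.map_one] using congrFun (anisotropic _ form_eq.symm) (1, k)
  have hI : IsUnit I.det := isUnit_iff_ne_zero.2 det_ne_zero
  calc star (σ w⁻¹).trace = ((σ w⁻¹)ᴴ * I * I⁻¹).trace := by
        rw [Matrix.mul_nonsing_inv_cancel_right _ _ hI, Matrix.trace_conjTranspose]
    _ = (I * σ w * I⁻¹).trace := by rw [intertwine]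
    _ = (σ w).trace := by
        rw [Matrix.trace_mul_comm, ← Matrix.mul_assoc, Matrix.nonsing_inv_mul _ hI, Matrix.one_mul]

end IsHeckeFamily

section HahnEmbedding

variable {Γ S T : Type*} [AddCommGroup Γ] [LinearOrder Γ] [IsOrderedAddMonoid Γ] [CommRing S]
  [CommRing T]

/-- The homomorphism from a group ring to Hahn series induced by a homomorphism of coefficient
rings. -/
def hahnMap (f : S →+* T) : AddMonoidAlgebra S Γ →+* HahnSeries Γ T :=
  AddMonoidAlgebra.liftNCRingHom (HahnSeries.C.comp f)
    { toFun := fun g => HahnSeries.single g.toAdd 1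
      map_one' := rfl
      map_mul' := fun g h => by simp }
    fun _ _ => Commute.all _ _

theorem hahnMap_single (f : S →+* T) (g : Γ) (r : S) :
    hahnMap f (AddMonoidAlgebra.single g r) = HahnSeries.single g (f r) := by
  simp [hahnMap]

theorem coeff_hahnMap (f : S →+* T) (a : AddMonoidAlgebra S Γ) (g : Γ) :
    (hahnMap f a).coeff g = f (a.coeff g) := by
  induction a using AddMonoidAlgebra.induction_linear with
  | zero => simp
  | add x y hx hy => simp [hx, hy]
  | single h r =>
    rw [hahnMap_single, HahnSeries.coeff_single, AddMonoidAlgebra.coeff_single,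
      Finsupp.single_apply]
    simp only [eq_comm (a := g), apply_ite f, map_zero]

theorem hahnMap_injective {f : S →+* T} (hf : Function.Injective f) :
    Function.Injective (hahnMap (Γ := Γ) f) := by
  intro a b h
  refine AddMonoidAlgebra.ext (Finsupp.ext fun g => hf ?_)
  rw [← coeff_hahnMap, h, coeff_hahnMap]

variable (R : Subring ℂ)

/-- The embedding of `A = R[Γ]` into Hahn series. -/
def AtoHahn : AddMonoidAlgebra R Γ →+* HahnSeries Γ ℂ :=
  hahnMap R.subtype

theorem coeff_AtoHahn (a : AddMonoidAlgebra R Γ) (g : Γ) : (AtoHahn R a).coeff g = a.coeff g :=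
  coeff_hahnMap _ a g

theorem AtoHahn_injective : Function.Injective (AtoHahn (Γ := Γ) R) :=
  hahnMap_injective Subtype.val_injective

/-- The embedding of `F`, the field of fractions of `R`, into `ℂ`. -/
def FtoC : FractionRing R →+* ℂ :=
  IsFractionRing.lift (g := R.subtype) Subtype.val_injective

theorem FtoC_algebraMap (r : R) : FtoC R (algebraMap R (FractionRing R) r) = r :=
  IsFractionRing.lift_algebraMap _ _

/-- The embedding of `K` into Hahn series, which turns leading exponents and leading coefficients
into orders and leading coefficients of series. -/
def KtoHahn : KField Γ R →+* HahnSeries Γ ℂ :=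
  IsFractionRing.lift (AtoHahn_injective R)

theorem KtoHahn_algebraMap (a : AddMonoidAlgebra R Γ) :
    KtoHahn R (algebraMap (AddMonoidAlgebra R Γ) (KField Γ R) a) = AtoHahn R a :=
  IsFractionRing.lift_algebraMap _ _

theorem KtoHahn_epsK (g : Γ) : KtoHahn R (epsK R g) = HahnSeries.single g 1 := by
  rw [epsK, KtoHahn_algebraMap, eps, AtoHahn, hahnMap_single, map_one]

theorem FtoK_algebraMap (r : R) : FtoK (Γ := Γ) R (algebraMap R (FractionRing R) r) =
    algebraMap (AddMonoidAlgebra R Γ) (KField Γ R) (AddMonoidAlgebra.single 0 r) := by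
  rw [FtoK, IsFractionRing.lift_algebraMap,
    IsScalarTower.algebraMap_apply R (AddMonoidAlgebra R Γ) (KField Γ R)]
  rfl

theorem KtoHahn_FtoK (r : FractionRing R) :
    KtoHahn (Γ := Γ) R (FtoK R r) = HahnSeries.C (FtoC R r) := by
  suffices h : (KtoHahn (Γ := Γ) R).comp (FtoK R) = HahnSeries.C.comp (FtoC R) from
    RingHom.congr_fun h r
  refine IsLocalization.ringHom_ext (nonZeroDivisors R) (RingHom.ext fun a => ?_)
  simp only [RingHom.comp_apply]
  rw [FtoK_algebraMap, KtoHahn_algebraMap, FtoC_algebraMap, AtoHahn, hahnMap_single]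
  rfl

theorem KtoHahn_FtoK_mul_epsK (r : FractionRing R) (g : Γ) :
    KtoHahn R (FtoK R r * epsK R g) = HahnSeries.single g (FtoC R r) := by
  rw [map_mul, KtoHahn_FtoK, KtoHahn_epsK, HahnSeries.C_apply, HahnSeries.single_mul_single,
    zero_add, mul_one]

theorem KtoHahn_FGtoK (p : AddMonoidAlgebra (FractionRing R) Γ) :
    KtoHahn R (FGtoK R p) = hahnMap (FtoC R) p := by
  rw [FGtoK, Finsupp.sum, map_sum]
  simp only [KtoHahn_FtoK_mul_epsK, ← hahnMap_single]
  rw [← map_sum]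
  exact congrArg _ (AddMonoidAlgebra.ext ((AddMonoidAlgebra.coeff_sum _ _).trans
    p.coeff.sum_single))

variable {R}

theorem IsPos.orderTop_leadingCoeff {p : AddMonoidAlgebra (FractionRing R) Γ} (hp : IsPos R p) :
    (KtoHahn R (1 + FGtoK R p)).orderTop = 0 ∧ (KtoHahn R (1 + FGtoK R p)).leadingCoeff = 1 := by
  rw [← HahnSeries.orderTop_self_sub_one_pos_iff, map_add, map_one, add_sub_cancel_left,
    KtoHahn_FGtoK]
  by_contra h
  obtain ⟨g, hg⟩ := WithTop.ne_top_iff_exists.1 (ne_top_of_le_ne_top WithTop.zero_ne_top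
    (not_lt.1 h))
  refine h (hg ▸ WithTop.coe_pos.2 (hp g fun h0 => ?_))
  refine HahnSeries.coeff_orderTop_ne hg.symm ?_
  rw [coeff_hahnMap, h0, map_zero]

theorem HasLead.orderTop_leadingCoeff {x : KField Γ R} {r : FractionRing R} {g : Γ} (hr : r ≠ 0)
    (h : HasLead R x r g) :
    (KtoHahn R x).orderTop = g ∧ (KtoHahn R x).leadingCoeff = FtoC R r := by
  obtain ⟨p, q, hp, hq, rfl⟩ := h
  obtain ⟨hp, hp'⟩ := hp.orderTop_leadingCoeff
  obtain ⟨hq, hq'⟩ := hq.orderTop_leadingCoeff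
  generalize 1 + FGtoK R p = P at *
  generalize 1 + FGtoK R q = Q at *
  have hQ : KtoHahn R Q ≠ 0 := by
    rw [← HahnSeries.orderTop_ne_top, hq]
    exact WithTop.zero_ne_top
  have hr' : FtoC R r ≠ 0 := (map_ne_zero _).2 hr
  have cleared := congrArg (KtoHahn R)
    (div_mul_cancel₀ (FtoK R r * epsK R g * P) ((map_ne_zero (KtoHahn R)).1 hQ))
  rw [mul_div_assoc, map_mul, map_mul (KtoHahn R) _ P, KtoHahn_FtoK_mul_epsK] at cleared
  constructor
  · have := congrArg HahnSeries.orderTop cleared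
    rwa [HahnSeries.orderTop_mul, HahnSeries.orderTop_mul, hp, hq, add_zero, add_zero,
      HahnSeries.orderTop_single hr'] at this
  · have := congrArg HahnSeries.leadingCoeff cleared
    rwa [HahnSeries.leadingCoeff_mul, HahnSeries.leadingCoeff_mul, hp', hq', mul_one, mul_one,
      HahnSeries.leadingCoeff_of_single] at this

theorem epsK_add (g h : Γ) : epsK R (g + h) = epsK R g * epsK R h := by
  rw [epsK, epsK, epsK, ← map_mul, eps, eps, eps, AddMonoidAlgebra.single_mul_single, one_mul]

theorem epsK_ne_zero (g : Γ) : epsK R g ≠ 0 := by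
  rw [← map_ne_zero (KtoHahn R), KtoHahn_epsK]
  exact HahnSeries.single_ne_zero one_ne_zero

/-- Here `p = (r ε ^ g)⁻¹ a - 1`, where `r ε ^ g` is the lowest term of `a`. -/
theorem exists_algebraMap_eq_lead_mul {a : AddMonoidAlgebra R Γ} (ha : a ≠ 0) :
    ∃ (r : FractionRing R) (g : Γ) (p : AddMonoidAlgebra (FractionRing R) Γ), r ≠ 0 ∧ IsPos R p ∧
      algebraMap (AddMonoidAlgebra R Γ) (KField Γ R) a =
        FtoK R r * epsK R g * (1 + FGtoK R p) := by
  let b := AddMonoidAlgebra.mapRingHom Γ (algebraMap R (FractionRing R)) a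
  have hahn_b : hahnMap (FtoC R) b = AtoHahn R a := by
    ext g
    rw [coeff_hahnMap, coeff_AtoHahn, AddMonoidAlgebra.coeff_mapRingHom, FtoC_algebraMap]
  have ha' : AtoHahn R a ≠ 0 := (map_ne_zero_iff _ (AtoHahn_injective R)).2 ha
  let g := (AtoHahn R a).order
  let r := b.coeff g
  have coeff_lt (h : Γ) (hh : h < g) : b.coeff h = 0 := by
    refine (FtoC R).injective ?_
    rw [← coeff_hahnMap, hahn_b, HahnSeries.coeff_eq_zero_of_lt_order hh, map_zero]
  have hr : FtoC R r ≠ 0 := by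
    rw [← coeff_hahnMap, hahn_b]
    exact HahnSeries.coeff_order_eq_zero.not.2 ha'
  refine ⟨r, g, AddMonoidAlgebra.single (-g) r⁻¹ * b - 1, (map_ne_zero _).1 hr, fun h => ?_, ?_⟩
  · contrapose!
    intro hh
    rw [AddMonoidAlgebra.coeff_sub, Finsupp.sub_apply, AddMonoidAlgebra.coeff_single_mul_apply,
      AddMonoidAlgebra.one_def, AddMonoidAlgebra.coeff_single, Finsupp.single_apply, neg_neg]
    rcases hh.eq_or_lt with rfl | hh
    · rw [add_zero, if_pos rfl, inv_mul_cancel₀ ((map_ne_zero _).1 hr), sub_self]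
    · rw [if_neg hh.ne', coeff_lt _ (by simpa using hh), mul_zero, sub_zero]
  · refine (KtoHahn R).injective ?_
    rw [map_mul, KtoHahn_FtoK_mul_epsK, map_add, map_one, KtoHahn_FGtoK, map_sub, map_one,
      add_sub_cancel, map_mul, hahnMap_single, hahn_b, KtoHahn_algebraMap, ← mul_assoc,
      HahnSeries.single_mul_single, add_neg_cancel, map_inv₀, mul_inv_cancel₀ hr]
    exact (one_mul _).symm

theorem exists_hasLead {x : KField Γ R} (hx : x ≠ 0) : ∃ r ≠ 0, ∃ g, HasLead R x r g := by
  obtain ⟨a, b, hb, rfl⟩ := IsFractionRing.div_surjective (AddMonoidAlgebra R Γ) x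
  have ha : a ≠ 0 := by
    rintro rfl
    exact hx (by rw [map_zero, zero_div])
  obtain ⟨r, g, p, hr, hp, ha⟩ := exists_algebraMap_eq_lead_mul ha
  obtain ⟨s, h, q, hs, hq, hb⟩ := exists_algebraMap_eq_lead_mul (nonZeroDivisors.ne_zero hb)
  refine ⟨r / s, div_ne_zero hr hs, g - h, p, q, hp, hq, ?_⟩
  have eps_sub : epsK R (g - h) = epsK R g / epsK R h := by
    rw [eq_div_iff (epsK_ne_zero h), ← epsK_add, sub_add_cancel]
  rw [ha, hb, eps_sub, map_div₀, mul_div_mul_comm, mul_div_mul_comm]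

theorem not_hasLead_zero {r : FractionRing R} (hr : r ≠ 0) (g : Γ) : ¬HasLead R 0 r g := fun h => by
  simpa using (h.orderTop_leadingCoeff hr).1

theorem leadExp_eq (x : KField Γ R) : leadExp R x = (KtoHahn R x).order := by
  rcases eq_or_ne x 0 with rfl | hx
  · rw [leadExp, dif_neg, map_zero, HahnSeries.order_zero]
    rintro ⟨g, r, hr, h⟩
    exact not_hasLead_zero hr g h
  · obtain ⟨r, hr, g, h⟩ := exists_hasLead hx
    have hex : ∃ g : Γ, ∃ r : FractionRing R, r ≠ 0 ∧ HasLead R x r g := ⟨g, r, hr, h⟩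
    obtain ⟨r', hr', h'⟩ := hex.choose_spec
    rw [leadExp, dif_pos hex, ← WithTop.coe_inj, ← (h'.orderTop_leadingCoeff hr').1,
      HahnSeries.order_eq_orderTop_of_ne_zero ((map_ne_zero _).2 hx)]

theorem FtoC_leadCoeff (x : KField Γ R) : FtoC R (leadCoeff R x) = (KtoHahn R x).leadingCoeff := by
  rcases eq_or_ne x 0 with rfl | hx
  · rw [leadCoeff, dif_neg, map_zero, map_zero, HahnSeries.leadingCoeff_zero]
    rintro ⟨r, hr, g, h⟩
    exact not_hasLead_zero hr g h
  · obtain ⟨r, hr, g, h⟩ := exists_hasLead hx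
    have hex : ∃ r : FractionRing R, r ≠ 0 ∧ ∃ g : Γ, HasLead R x r g := ⟨r, hr, g, h⟩
    obtain ⟨hr', g', h'⟩ := hex.choose_spec
    rw [leadCoeff, dif_pos hex, (h'.orderTop_leadingCoeff hr').2]

theorem mem_valO_iff {x : KField Γ R} : x ∈ valO R ↔ 0 ≤ (KtoHahn R x).orderTop := by
  rw [valO, Set.mem_ofPred_eq, leadExp_eq]
  rcases eq_or_ne x 0 with rfl | hx
  · simp
  · rw [or_iff_right hx, ← WithTop.coe_nonneg,
      HahnSeries.order_eq_orderTop_of_ne_zero ((map_ne_zero _).2 hx)]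

theorem FtoC_constTerm {x : KField Γ R} (hx : x ∈ valO R) :
    FtoC R (constTerm R x) = (KtoHahn R x).coeff 0 := by
  rw [constTerm, leadExp_eq]
  split_ifs with h
  · rw [FtoC_leadCoeff, HahnSeries.leadingCoeff_eq, h]
  · rw [map_zero]
    rcases hx with rfl | hx
    · rw [map_zero, HahnSeries.coeff_zero]
    · rw [leadExp_eq] at hx
      exact (HahnSeries.coeff_eq_zero_of_lt_order (hx.lt_of_ne' h)).symm

end HahnEmbedding

section Fourier

variable {W Λ F : Type*} [Field F] {d : Λ → ℕ}

/-- The Fourier transform of functions on `W` attached to the matrix-valued functions `c l`. -/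
def fourier [Fintype W] (c : ∀ l, W → Matrix (Fin (d l)) (Fin (d l)) F) :
    (W → F) →ₗ[F] ∀ l, Matrix (Fin (d l)) (Fin (d l)) F :=
  LinearMap.pi fun l => Fintype.linearCombination F (c l)

theorem fourier_apply [Fintype W] (c : ∀ l, W → Matrix (Fin (d l)) (Fin (d l)) F) (q : W → F)
    (l : Λ) : fourier c q l = ∑ w, q w • c l w :=
  rfl

variable [Group W] [Fintype Λ]

/-- The inverse Fourier transform, for the Schur elements `f l`. -/
def fourierInv (f : Λ → F) (c : ∀ l, W → Matrix (Fin (d l)) (Fin (d l)) F) :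
    (∀ l, Matrix (Fin (d l)) (Fin (d l)) F) →ₗ[F] W → F :=
  LinearMap.pi fun w => ∑ l, (f l)⁻¹ •
    Matrix.traceLinearMap _ F F ∘ₗ LinearMap.mulRight F (c l w⁻¹) ∘ₗ LinearMap.proj l

theorem fourierInv_apply (f : Λ → F) (c : ∀ l, W → Matrix (Fin (d l)) (Fin (d l)) F)
    (P : ∀ l, Matrix (Fin (d l)) (Fin (d l)) F) (w : W) :
    fourierInv f c P w = ∑ l, (f l)⁻¹ * (P l * c l w⁻¹).trace := by
  simp [fourierInv]

theorem fourierInv_single [DecidableEq Λ] (f : Λ → F)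
    (c : ∀ l, W → Matrix (Fin (d l)) (Fin (d l)) F) (l : Λ) (i k : Fin (d l)) (w : W) :
    fourierInv f c (Pi.single l (Matrix.single i k 1)) w = (f l)⁻¹ * c l w⁻¹ k i := by
  rw [fourierInv_apply, Finset.sum_eq_single l]
  · simp [Matrix.trace_single_mul]
  · intro m _ hm
    simp [hm]
  · simp

/-- The Schur relations for matrix-valued functions `c l` with Schur elements `f l`. They hold for
a full set of irreducible representations, and for the leading coefficients of such a set. -/
structure SchurRelations [Fintype W] (f : Λ → F)
    (c : ∀ l, W → Matrix (Fin (d l)) (Fin (d l)) F) : Prop where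
  sum_sq : ∑ l, d l * d l = Nat.card W
  ne_zero : ∀ l, f l ≠ 0
  sum_mul_inv_eq_zero : ∀ {l m}, l ≠ m → ∀ i p q k, ∑ w, c l w i p * c m w⁻¹ q k = 0
  sum_mul_inv_eq : ∀ l i p q k,
    ∑ w, c l w i p * c l w⁻¹ q k = if i = k ∧ p = q then f l else 0

namespace SchurRelations

variable [Fintype W] {f : Λ → F} {c : ∀ l, W → Matrix (Fin (d l)) (Fin (d l)) F}

theorem fourier_fourierInv (H : SchurRelations f c) (P : ∀ l, Matrix (Fin (d l)) (Fin (d l)) F) :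
    fourier c (fourierInv f c P) = P := by
  ext l i j
  have sum_eq (m : Λ) : ∑ w, (P m * c m w⁻¹).trace * c l w i j =
      ∑ a, ∑ b, P m a b * ∑ w, c l w i j * c m w⁻¹ b a := by
    simp only [Matrix.trace, Matrix.diag_apply, Matrix.mul_apply, Finset.sum_mul, Finset.mul_sum]
    rw [Finset.sum_comm]
    refine Finset.sum_congr rfl fun a _ => ?_
    rw [Finset.sum_comm]
    exact Finset.sum_congr rfl fun b _ => Finset.sum_congr rfl fun w _ => by ring
  simp only [fourier_apply, fourierInv_apply, Matrix.sum_apply, Matrix.smul_apply, smul_eq_mul,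
    Finset.sum_mul, mul_assoc]
  rw [Finset.sum_comm]
  simp only [← Finset.mul_sum, sum_eq]
  rw [Finset.sum_eq_single l]
  · simp [H.sum_mul_inv_eq, ite_and, mul_comm (P l i j), H.ne_zero]
  · intro m _ hm
    simp [H.sum_mul_inv_eq_zero hm.symm]
  · simp

theorem fourierInv_fourier (H : SchurRelations f c) (q : W → F) :
    fourierInv f c (fourier c q) = q := by
  have finrank_eq : Module.finrank F (∀ l, Matrix (Fin (d l)) (Fin (d l)) F) =
      Module.finrank F (W → F) := by
    rw [Module.finrank_pi_fintype, Module.finrank_pi, ← Nat.card_eq_fintype_card, ← H.sum_sq]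
    simp [Module.finrank_matrix]
  have surjective := (LinearMap.injective_iff_surjective_of_finrank_eq_finrank finrank_eq).1
    (Function.LeftInverse.injective H.fourier_fourierInv)
  exact Function.LeftInverse.rightInverse_of_surjective H.fourier_fourierInv surjective q

theorem fourierInv_apply_self [DecidableEq W] (H : SchurRelations f c) (w : W) :
    fourierInv f c (fun l => c l w) = Pi.single w 1 := by
  rw [← H.fourierInv_fourier (Pi.single w 1)]
  congr
  ext l : 1
  simp [fourier_apply, Pi.single_apply]

theorem sum_fourierInv_one_smul (H : SchurRelations f c) (l : Λ) :
    ∑ w, fourierInv f c 1 w • c l w = 1 :=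
  congrFun (H.fourier_fourierInv 1) l

theorem sum_fourierInv_one_smul_mul (H : SchurRelations f c) (y : W) :
    ∑ w, fourierInv f c 1 w • fourierInv f c (fun l => c l w * c l y) =
      fourierInv f c fun l => c l y := by
  simp only [← map_smul, ← map_sum]
  congr 1
  ext l : 1
  simp only [Finset.sum_apply, Pi.smul_apply, ← Matrix.smul_mul, ← Matrix.sum_mul,
    H.sum_fourierInv_one_smul, Matrix.one_mul]

theorem sum_fourierInv_one_smul_mul_right (H : SchurRelations f c) (y : W) :
    ∑ w, fourierInv f c 1 w • fourierInv f c (fun l => c l y * c l w) =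
      fourierInv f c fun l => c l y := by
  simp only [← map_smul, ← map_sum]
  congr 1
  ext l : 1
  simp only [Finset.sum_apply, Pi.smul_apply, ← Matrix.mul_smul, ← Matrix.mul_sum,
    H.sum_fourierInv_one_smul, Matrix.mul_one]

/-- The two-sided ideal generated by `Z` contains every factor at which `Z` is non-zero. -/
theorem apply_single_eq_zero (H : SchurRelations f c)
    {Q : (∀ l, Matrix (Fin (d l)) (Fin (d l)) F) →ₗ[F] F}
    {Z : ∀ l, Matrix (Fin (d l)) (Fin (d l)) F}
    (hQ : ∀ u v, Q ((fun l => c l u) * Z * fun l => c l v) = 0) {l : Λ} (hZ : Z l ≠ 0)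
    [DecidableEq Λ] (i k : Fin (d l)) : Q (Pi.single l (Matrix.single i k 1)) = 0 := by
  have ideal (P P' : ∀ l, Matrix (Fin (d l)) (Fin (d l)) F) : Q (P * Z * P') = 0 := by
    have expand (P : ∀ l, Matrix (Fin (d l)) (Fin (d l)) F) :
        P = ∑ w, fourierInv f c P w • fun l => c l w := by
      conv_lhs => rw [← H.fourier_fourierInv P]
      ext l : 1
      rw [fourier_apply, Finset.sum_apply]
      rfl
    rw [expand P, expand P']
    simp only [Finset.sum_mul, Finset.mul_sum, smul_mul_assoc, mul_smul_comm, map_sum, map_smul,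
      hQ, smul_zero, Finset.sum_const_zero]
  obtain ⟨a, b, hab⟩ : ∃ a b, Z l a b ≠ 0 := by
    by_contra! h
    exact hZ (Matrix.ext h)
  have sandwich : Pi.single l (Matrix.single i a 1) * Z * Pi.single l (Matrix.single b k 1) =
      Z l a b • Pi.single l (Matrix.single i k (1 : F)) := by
    rw [← Pi.single_mul_left, ← Pi.single_mul, Matrix.single_mul_mul_single, ← Pi.single_smul]
    simp
  have := ideal (Pi.single l (Matrix.single i a 1)) (Pi.single l (Matrix.single b k 1))
  rw [sandwich, map_smul] at this
  exact (smul_eq_zero.1 this).resolve_left hab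

end SchurRelations

end Fourier

section Specialisation

variable {B W Γ : Type*} [Group W] {M : CoxeterMatrix B} {cs : CoxeterSystem M W} [AddCommGroup Γ]
  {R : Subring ℂ} {L : WeightFunction cs Γ}

variable (R) in
/-- The specialisation `ε ^ g ↦ 1` with values in `ℂ`. -/
def specOne : AddMonoidAlgebra R Γ →+* ℂ :=
  AddMonoidAlgebra.liftNCRingHom R.subtype (1 : Multiplicative Γ →* ℂ) fun _ _ => Commute.all _ _

theorem specOne_single (g : Γ) (r : R) : specOne R (AddMonoidAlgebra.single g r) = r := by
  simp [specOne]

theorem specOne_eq (a : AddMonoidAlgebra R Γ) : specOne R a = theta1 R a := by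
  induction a using AddMonoidAlgebra.induction_linear with
  | zero => simp [theta1]
  | add x y hx hy =>
    rw [map_add, hx, hy, theta1, theta1, theta1, AddMonoidAlgebra.coeff_add,
      Finsupp.sum_add_index' (fun _ => rfl) (fun _ _ _ => rfl), Subring.coe_add]
  | single g r =>
    rw [specOne_single, theta1, AddMonoidAlgebra.coeff_single, Finsupp.sum_single_index rfl]

theorem specOne_xi (i : B) : specOne R (xi R L i) = 0 := by
  rw [xi, eps, eps, map_sub, specOne_single, specOne_single, sub_self]

end Specialisation

section HahnRep

variable {B W Γ Λ : Type*} [Group W] {M : CoxeterMatrix B} {cs : CoxeterSystem M W}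
  [AddCommGroup Γ] [LinearOrder Γ] [IsOrderedAddMonoid Γ] {R : Subring ℂ} {L : WeightFunction cs Γ}
  {n : ℕ}

/-- The extension of a matrix representation of the Hecke algebra to Hahn series. -/
def hahnRep (ρ : MatRep R L n) : Hecke R L →+* Matrix (Fin n) (Fin n) (HahnSeries Γ ℂ) :=
  (KtoHahn R).mapMatrix.comp (ρ : Hecke R L →+* Matrix (Fin n) (Fin n) (KField Γ R))

theorem hahnRep_apply (ρ : MatRep R L n) (h : Hecke R L) (i j : Fin n) :
    hahnRep ρ h i j = KtoHahn R (ρ h i j) :=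
  rfl

theorem trace_hahnRep (ρ : MatRep R L n) (h : Hecke R L) :
    (hahnRep ρ h).trace = KtoHahn R (ρ h).trace := by
  simp only [Matrix.trace, Matrix.diag_apply, map_sum, hahnRep_apply]

theorem hahnRep_smul (ρ : MatRep R L n) (a : AddMonoidAlgebra R Γ) (h : Hecke R L) :
    hahnRep ρ (a • h) = AtoHahn R a • hahnRep ρ h := by
  ext1 i j
  rw [hahnRep_apply, map_smul, Matrix.smul_apply, Matrix.smul_apply, hahnRep_apply,
    Algebra.smul_def, map_mul, KtoHahn_algebraMap, smul_eq_mul]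

theorem isHeckeFamily_hahnRep (ρ : MatRep R L n) :
    IsHeckeFamily cs (AtoHahn R ∘ xi R L) fun w => hahnRep ρ (heckeT R L w) :=
  (isHeckeFamily_heckeT R L).map (hahnRep ρ) (AtoHahn R) (hahnRep_smul ρ)

theorem star_AtoHahn_xi (i : B) : star (AtoHahn R (xi R L i)) = AtoHahn R (xi R L i) := by
  have star_eps (g : Γ) : star (AtoHahn R (eps R g)) = AtoHahn R (eps R g) := by
    ext h
    rw [coeff_star, coeff_AtoHahn, eps, AddMonoidAlgebra.coeff_single, Finsupp.single_apply]
    split_ifs <;> simp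
  rw [xi, map_sub, star_sub, star_eps, star_eps]

theorem isSplitFamily_hahnRep [Finite W] [Fintype Λ] {E : Λ → FDRep ℂ W}
    (hE : IsIrrFamily E) {d : Λ → ℕ} {ρ : ∀ l, MatRep R L (d l)}
    (hρ : ∀ l, Corresponds (E l) (ρ l)) :
    IsSplitFamily cs (AtoHahn R) (specOne R) (xi R L) (fun l => (E l).character)
      (fun l w => hahnRep (ρ l) (heckeT R L w)) := by
  classical
  have sum_mul (w : W) : ∑ l, (d l : ℂ) * (E l).character w =
      if w = 1 then (Nat.card W : ℂ) else 0 := by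
    rw [← hE.sum_finrank_mul_character]
    exact Finset.sum_congr rfl fun l _ => by rw [(hρ l).1]
  exact {
    injective := AtoHahn_injective R
    map_parameter := specOne_xi
    isHeckeFamily := fun l => isHeckeFamily_hahnRep (ρ l)
    exists_trace_eq := fun l w => by
      obtain ⟨a, ha, ha'⟩ := (hρ l).2 w
      exact ⟨a, by rw [trace_hahnRep, ← ha, KtoHahn_algebraMap], by rw [specOne_eq, ha']⟩
    sum_mul_one := by rw [sum_mul, if_pos rfl]
    sum_mul_of_ne_one := fun w hw => by rw [sum_mul, if_neg hw] }

theorem Corresponds.degree_ne_zero {V : FDRep ℂ W} [CategoryTheory.Simple V]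
    {ρ : MatRep R L n} (h : Corresponds V ρ) : n ≠ 0 := fun hn => by
  have : Subsingleton V := Module.finrank_zero_iff.1 (h.1.symm.trans hn)
  refine CategoryTheory.id_nonzero V ?_
  ext x
  exact Subsingleton.elim (α := V) _ _

instance : CharZero (HahnSeries Γ ℂ) :=
  charZero_of_injective_ringHom (f := (HahnSeries.C : ℂ →+* HahnSeries Γ ℂ)) HahnSeries.C_injective

end HahnRep

section SchurElement

variable {B W Γ : Type*} [Group W] [Fintype W] {M : CoxeterMatrix B} {cs : CoxeterSystem M W}
  [AddCommGroup Γ] [LinearOrder Γ] [IsOrderedAddMonoid Γ] {R : Subring ℂ} {L : WeightFunction cs Γ}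
  {m n : ℕ}

theorem KtoHahn_schurElt (ρ : MatRep R L n) : KtoHahn R (schurElt ρ) =
    (n : HahnSeries Γ ℂ)⁻¹ * ∑ w : W, (hahnRep ρ (heckeT R L w)).trace *
      (hahnRep ρ (heckeT R L w⁻¹)).trace := by
  rw [schurElt, map_mul, map_inv₀, map_natCast, map_sum]
  simp only [map_mul, trace_hahnRep]

open scoped ComplexOrder in
/-- The traces on `T_w` and `T_{w⁻¹}` are conjugate, so up to the factor `n⁻¹` the Schur element is
a sum of squares of absolute values, in which the lowest terms do not cancel. -/
theorem exists_orderTop_schurElt (ρ : MatRep R L n) (hn : n ≠ 0) :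
    ∃ p : Γ, (KtoHahn R (schurElt ρ)).orderTop = ↑(p + p) := by
  have anisotropic (x : W × Fin n → HahnSeries Γ ℂ) (hx : star x ⬝ᵥ x = 0) : x = 0 := by
    by_contra h
    obtain ⟨p, hp⟩ := exists_orderTop_star_dotProduct_self h
    rw [hx, HahnSeries.orderTop_zero] at hp
    exact WithTop.top_ne_coe hp
  have star_trace := (isHeckeFamily_hahnRep ρ).star_trace_inv star_AtoHahn_xi anisotropic
  let x (w : W) : HahnSeries Γ ℂ := (hahnRep ρ (heckeT R L w)).trace
  have hx : x ≠ 0 := fun h => by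
    have := congrFun h 1
    simp [x, heckeT_one, hn] at this
  have sum_eq : ∑ w : W, (hahnRep ρ (heckeT R L w)).trace * (hahnRep ρ (heckeT R L w⁻¹)).trace =
      star x ⬝ᵥ x := by
    rw [← Equiv.sum_comp (Equiv.inv W), dotProduct]
    simp only [Equiv.inv_apply, inv_inv, Pi.star_apply, x]
    exact Finset.sum_congr rfl fun w _ => by rw [← star_trace w, star_star]
  obtain ⟨p, hp⟩ := exists_orderTop_star_dotProduct_self hx
  refine ⟨p, ?_⟩
  rw [KtoHahn_schurElt, sum_eq, HahnSeries.orderTop_mul, hp,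
    ← map_natCast (HahnSeries.C : ℂ →+* HahnSeries Γ ℂ), ← map_inv₀, HahnSeries.C_apply,
    HahnSeries.orderTop_single (by simpa using hn), WithTop.coe_zero, zero_add]

theorem KtoHahn_schurElt_ne_zero (ρ : MatRep R L n) (hn : n ≠ 0) : KtoHahn R (schurElt ρ) ≠ 0 := by
  obtain ⟨p, hp⟩ := exists_orderTop_schurElt ρ hn
  exact HahnSeries.orderTop_ne_top.1 (hp ▸ WithTop.coe_ne_top)

theorem order_schurElt (ρ : MatRep R L n) (hn : n ≠ 0) :
    (KtoHahn R (schurElt ρ)).order = -aInv ρ + -aInv ρ := by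
  obtain ⟨p, hp⟩ := exists_orderTop_schurElt ρ hn
  rw [← HahnSeries.order_eq_orderTop_of_ne_zero (KtoHahn_schurElt_ne_zero ρ hn),
    WithTop.coe_inj] at hp
  have aInv_spec := Classical.epsilon_spec (p := fun a => leadExp R (schurElt ρ) = -(2 • a))
    ⟨-p, by rw [leadExp_eq, hp, two_nsmul, neg_add, neg_neg]⟩
  rw [← leadExp_eq, ← neg_add, ← two_nsmul]
  exact aInv_spec

theorem coeff_schurElt (ρ : MatRep R L n) (hn : n ≠ 0) :
    (KtoHahn R (schurElt ρ)).coeff (-aInv ρ + -aInv ρ) = FtoC R (fInv ρ) := by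
  rw [fInv, FtoC_leadCoeff, HahnSeries.leadingCoeff_eq, order_schurElt ρ hn]

theorem fInv_ne_zero (ρ : MatRep R L n) (hn : n ≠ 0) : fInv ρ ≠ 0 := by
  rw [← map_ne_zero (FtoC R), fInv, FtoC_leadCoeff, HahnSeries.leadingCoeff_ne_zero]
  exact KtoHahn_schurElt_ne_zero ρ hn

theorem IsBalanced.le_orderTop_hahnRep {ρ : MatRep R L n} (hb : IsBalanced ρ) (w : W)
    (i j : Fin n) : ↑(-aInv ρ) ≤ (hahnRep ρ (heckeT R L w) i j).orderTop := by
  have h := mem_valO_iff.1 (hb w i j)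
  rw [map_mul, KtoHahn_epsK, HahnSeries.orderTop_mul, HahnSeries.orderTop_single one_ne_zero,
    ← hahnRep_apply] at h
  simpa [← add_assoc, ← WithTop.coe_add] using add_le_add_right h ↑(-aInv ρ)

theorem IsBalanced.FtoC_leadMat {ρ : MatRep R L n} (hb : IsBalanced ρ) (w : W) (i j : Fin n) :
    FtoC R (leadMat ρ w i j) =
      (-1) ^ cs.length w * (hahnRep ρ (heckeT R L w) i j).coeff (-aInv ρ) := by
  have sign (k : ℕ) : ((-1) ^ k : HahnSeries Γ ℂ) = HahnSeries.C ((-1) ^ k) := by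
    rw [map_pow, map_neg, map_one]
  have sign_mul_mem : (-1) ^ cs.length w * (epsK R (aInv ρ) * ρ (heckeT R L w) i j) ∈ valO R := by
    rcases neg_one_pow_eq_or (KField Γ R) (cs.length w) with h | h
    · simpa [h] using hb w i j
    · simpa [h, mem_valO_iff] using mem_valO_iff.1 (hb w i j)
  rw [leadMat, FtoC_constTerm sign_mul_mem, map_mul, map_mul, KtoHahn_epsK, map_pow, map_neg,
    map_one, ← hahnRep_apply, sign, HahnSeries.C_mul_eq_smul, HahnSeries.coeff_smul, smul_eq_mul,
    HahnSeries.coeff_single_mul, one_mul, zero_sub]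

theorem FtoC_leadMat_mul_leadMat_inv {ρ : MatRep R L n} (hρ : IsBalanced ρ) {τ : MatRep R L m}
    (hτ : IsBalanced τ) (w : W) (i p : Fin n) (q k : Fin m) :
    FtoC R (leadMat ρ w i p * leadMat τ w⁻¹ q k) =
      (hahnRep ρ (heckeT R L w) i p * hahnRep τ (heckeT R L w⁻¹) q k).coeff
        (-aInv ρ + -aInv τ) := by
  rw [map_mul, hρ.FtoC_leadMat, hτ.FtoC_leadMat, coeff_add_mul_of_le_orderTop
    (hρ.le_orderTop_hahnRep w i p) (hτ.le_orderTop_hahnRep w⁻¹ q k), cs.length_inv,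
    mul_mul_mul_comm, ← mul_pow, neg_one_mul, neg_neg, one_pow, one_mul]

end SchurElement

section LeadingCoefficients

variable {B W Γ Λ : Type*} [Group W] [Fintype W] {M : CoxeterMatrix B} {cs : CoxeterSystem M W}
  [AddCommGroup Γ] [LinearOrder Γ] [IsOrderedAddMonoid Γ] {R : Subring ℂ} {L : WeightFunction cs Γ}
  {d : Λ → ℕ}

/-- Balanced matrix representations `ρ l` corresponding to a full set of irreducible
representations `E l` of `W`. -/
structure IsBalancedFamily (E : Λ → FDRep ℂ W) (ρ : ∀ l, MatRep R L (d l)) : Prop where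
  isIrrFamily : IsIrrFamily E
  corresponds : ∀ l, Corresponds (E l) (ρ l)
  isBalanced : ∀ l, IsBalanced (ρ l)

/-- The leading matrix coefficients of `ρ` at `w`, as a matrix. -/
def leadMatrix {n : ℕ} (ρ : MatRep R L n) (w : W) : Matrix (Fin n) (Fin n) (FractionRing R) :=
  Matrix.of (leadMat ρ w)

theorem leadMatrix_apply {n : ℕ} (ρ : MatRep R L n) (w : W) (i j : Fin n) :
    leadMatrix ρ w i j = leadMat ρ w i j :=
  rfl

variable {E : Λ → FDRep ℂ W} {ρ : ∀ l, MatRep R L (d l)}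

theorem IsBalancedFamily.degree_ne_zero (H : IsBalancedFamily E ρ) (l : Λ) : d l ≠ 0 :=
  have := H.isIrrFamily.simple l
  (H.corresponds l).degree_ne_zero

variable [Fintype Λ]

theorem schurRelations_hahnRep (hE : IsIrrFamily E) (hρ : ∀ l, Corresponds (E l) (ρ l)) :
    SchurRelations (fun l => KtoHahn R (schurElt (ρ l)))
      (fun l w => hahnRep (ρ l) (heckeT R L w)) where
  sum_sq := (isSplitFamily_hahnRep hE hρ).sum_sq
  ne_zero l := have := hE.simple l; KtoHahn_schurElt_ne_zero _ (hρ l).degree_ne_zero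
  sum_mul_inv_eq_zero hlm := (isSplitFamily_hahnRep hE hρ).sum_mul_inv_eq_zero hlm
  sum_mul_inv_eq l i p q k := by
    rw [(isSplitFamily_hahnRep hE hρ).sum_mul_inv_eq, KtoHahn_schurElt]

namespace IsBalancedFamily

theorem schurRelations_leadMatrix (H : IsBalancedFamily E ρ) :
    SchurRelations (fun l => fInv (ρ l)) fun l => leadMatrix (ρ l) where
  sum_sq := (schurRelations_hahnRep H.isIrrFamily H.corresponds).sum_sq
  ne_zero l := fInv_ne_zero _ (H.degree_ne_zero l)
  sum_mul_inv_eq_zero {l m} hlm i p q k := by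
    apply (FtoC R).injective
    simp only [leadMatrix_apply, map_sum,
      FtoC_leadMat_mul_leadMat_inv (H.isBalanced l) (H.isBalanced m)]
    rw [← HahnSeries.coeff_sum, (schurRelations_hahnRep H.isIrrFamily
      H.corresponds).sum_mul_inv_eq_zero hlm, HahnSeries.coeff_zero, map_zero]
  sum_mul_inv_eq l i p q k := by
    apply (FtoC R).injective
    simp only [leadMatrix_apply, map_sum,
      FtoC_leadMat_mul_leadMat_inv (H.isBalanced l) (H.isBalanced l)]
    rw [← HahnSeries.coeff_sum,
      (schurRelations_hahnRep H.isIrrFamily H.corresponds).sum_mul_inv_eq]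
    split_ifs
    · exact coeff_schurElt _ (H.degree_ne_zero l)
    · rw [HahnSeries.coeff_zero, map_zero]

end IsBalancedFamily

theorem gammaT_eq_fourierInv (x y z : W) : gammaT ρ x y z⁻¹ =
    fourierInv (fun l => fInv (ρ l)) (fun l => leadMatrix (ρ l))
      (fun l => leadMatrix (ρ l) x * leadMatrix (ρ l) y) z := by
  simp only [gammaT, fourierInv_apply, Matrix.trace, Matrix.diag_apply, Matrix.mul_apply,
    leadMatrix_apply, Finset.mul_sum, mul_assoc]

theorem nT_eq_fourierInv (w : W) : nT ρ w =
    fourierInv (fun l => fInv (ρ l)) (fun l => leadMatrix (ρ l)) 1 w := by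
  simp [nT, fourierInv_apply, Matrix.trace, leadMatrix_apply, Finset.mul_sum]

theorem IsBalancedFamily.sum_nT_mul_gammaT [DecidableEq W] (H : IsBalancedFamily E ρ) (y z : W) :
    ∑ w, nT ρ w * gammaT ρ w y z⁻¹ = if z = y then 1 else 0 := by
  have := congrFun (H.schurRelations_leadMatrix.sum_fourierInv_one_smul_mul y) z
  rw [H.schurRelations_leadMatrix.fourierInv_apply_self, Pi.single_apply] at this
  simpa [gammaT_eq_fourierInv, nT_eq_fourierInv] using this

theorem IsBalancedFamily.sum_nT_mul_gammaT_right [DecidableEq W] (H : IsBalancedFamily E ρ)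
    (y z : W) : ∑ w, nT ρ w * gammaT ρ y w z⁻¹ = if z = y then 1 else 0 := by
  have := congrFun (H.schurRelations_leadMatrix.sum_fourierInv_one_smul_mul_right y) z
  rw [H.schurRelations_leadMatrix.fourierInv_apply_self, Pi.single_apply] at this
  simpa [gammaT_eq_fourierInv, nT_eq_fourierInv] using this

end LeadingCoefficients

section Cells

variable {B W Γ Λ : Type*} [Group W] {M : CoxeterMatrix B} {cs : CoxeterSystem M W}
  [AddCommGroup Γ] [LinearOrder Γ] [IsOrderedAddMonoid Γ] {R : Subring ℂ} {L : WeightFunction cs Γ}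
  [Fintype W]

theorem coeff_AtoHahn_repr_klC [DecidableEq W] (w y : W) {g : Γ} (hg : g ≤ 0) :
    (AtoHahn R ((heckeT R L).repr (klC R L w) y)).coeff g =
      if g = 0 ∧ y = w then (-1) ^ cs.length w else 0 := by
  have coeff_sub : ((heckeT R L).repr (klC R L w - (-1 : ℤ) ^ cs.length w • heckeT R L w)
      y).coeff g = 0 :=
    by_contra fun h => hg.not_gt (pos_of_coeff_repr_klC_sub_ne_zero h)
  have split : AtoHahn R ((heckeT R L).repr (klC R L w) y) =
      AtoHahn R ((heckeT R L).repr (klC R L w - (-1 : ℤ) ^ cs.length w • heckeT R L w) y) +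
        (-1 : ℤ) ^ cs.length w • if y = w then 1 else 0 := by
    rw [map_sub, Finsupp.sub_apply, map_sub, map_zsmul, Finsupp.smul_apply, map_zsmul,
      Module.Basis.repr_self, Finsupp.single_apply]
    simp only [eq_comm (a := w), apply_ite (AtoHahn R), map_one, map_zero, sub_add_cancel]
  rw [split, HahnSeries.coeff_add, coeff_AtoHahn, coeff_sub, Subring.coe_zero, zero_add,
    HahnSeries.coeff_smul]
  by_cases hy : y = w <;> by_cases hg0 : g = 0 <;> simp [hy, hg0, HahnSeries.coeff_one]

theorem orderTop_AtoHahn_repr_klC_nonneg (w y : W) :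
    ↑(0 : Γ) ≤ (AtoHahn R ((heckeT R L).repr (klC R L w) y)).orderTop := by
  classical
  refine HahnSeries.le_orderTop_iff_forall.2 fun g hg => ?_
  have hg := WithTop.coe_lt_coe.1 hg
  rw [coeff_AtoHahn_repr_klC w y hg.le, if_neg fun h => hg.ne h.1]

theorem coeff_sum_repr_klC_mul {f : W → HahnSeries Γ ℂ} {p : Γ} (hf : ∀ y, p ≤ (f y).orderTop)
    (w : W) : (∑ y, AtoHahn R ((heckeT R L).repr (klC R L w) y) * f y).coeff p =
      (-1) ^ cs.length w * (f w).coeff p := by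
  classical
  have coeff_mul (y : W) : (AtoHahn R ((heckeT R L).repr (klC R L w) y) * f y).coeff p =
      if y = w then (-1) ^ cs.length w * (f y).coeff p else 0 := by
    have := coeff_add_mul_of_le_orderTop
      (orderTop_AtoHahn_repr_klC_nonneg (R := R) (L := L) w y) (hf y)
    simpa [coeff_AtoHahn_repr_klC w y le_rfl] using this
  simp [HahnSeries.coeff_sum, coeff_mul]

theorem sum_repr_mul_klCoord (h : Hecke R L) (x : W) :
    ∑ w, (heckeT R L).repr h w * klCoord R L (heckeT R L w) x = klCoord R L h x := by
  conv_rhs => rw [← (heckeT R L).sum_repr h]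
  simp only [klCoord_eq, map_sum, map_smul, Finsupp.finsetSum_apply, Finsupp.smul_apply,
    smul_eq_mul]

theorem sum_repr_klC_mul_klCoord [DecidableEq W] (w x : W) :
    ∑ y, AtoHahn R ((heckeT R L).repr (klC R L w) y) * AtoHahn R (klCoord R L (heckeT R L y) x) =
      if x = w then 1 else 0 := by
  simp only [← map_mul, ← map_sum, sum_repr_mul_klCoord, klCoord_klC, Finsupp.single_apply,
    eq_comm (a := w), apply_ite (AtoHahn R), map_one, map_zero]

theorem orderTop_AtoHahn_klCoord_nonneg (x y : W) :
    ↑(0 : Γ) ≤ (AtoHahn R (klCoord R L (heckeT R L y) x)).orderTop := by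
  classical
  by_cases h0 : (fun y => AtoHahn R (klCoord R L (heckeT R L y) x)) = 0
  · rw [show AtoHahn R (klCoord R L (heckeT R L y) x) = 0 from congrFun h0 y]
    simp
  obtain ⟨p, hp, w, hw⟩ := exists_le_orderTop_coeff_ne_zero h0
  refine le_trans (WithTop.coe_le_coe.2 (le_of_not_gt fun hp0 => hw ?_)) (hp y)
  have h := coeff_sum_repr_klC_mul (R := R) (L := L) hp w
  rw [sum_repr_klC_mul_klCoord] at h
  split_ifs at h <;> simpa [HahnSeries.coeff_one, hp0.ne] using h

theorem coeff_zero_AtoHahn_klCoord [DecidableEq W] (x w : W) :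
    (AtoHahn R (klCoord R L (heckeT R L w) x)).coeff 0 =
      if x = w then (-1) ^ cs.length w else 0 := by
  have h := coeff_sum_repr_klC_mul (R := R) (L := L)
    (fun y => orderTop_AtoHahn_klCoord_nonneg (R := R) (L := L) x y) w
  rw [sum_repr_klC_mul_klCoord] at h
  replace h := congrArg ((-1) ^ cs.length w * ·) h
  rw [← mul_assoc, ← mul_pow, neg_one_mul, neg_neg, one_pow, one_mul] at h
  rw [← h]
  split_ifs <;> simp only [HahnSeries.coeff_one, HahnSeries.coeff_zero, if_true, mul_one, mul_zero]

theorem sum_repr_smul_hahnRep {n : ℕ} (ρ : MatRep R L n) (h : Hecke R L) :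
    ∑ w, AtoHahn R ((heckeT R L).repr h w) • hahnRep ρ (heckeT R L w) = hahnRep ρ h := by
  conv_rhs => rw [← (heckeT R L).sum_repr h]
  simp only [map_sum, hahnRep_smul]

theorem IsBalanced.hahnRep_klC_ne_zero {n : ℕ} {ρ : MatRep R L n} (hρ : IsBalanced ρ) {y : W}
    (h : leadMatrix ρ y ≠ 0) : hahnRep ρ (klC R L y) ≠ 0 := by
  refine fun h0 => h (Matrix.ext fun i j => (FtoC R).injective ?_)
  have coeff_klC := coeff_sum_repr_klC_mul (R := R) (L := L)
    (fun w => hρ.le_orderTop_hahnRep w i j) y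
  rw [leadMatrix_apply, hρ.FtoC_leadMat, ← coeff_klC]
  have entry := congrFun (congrFun ((sum_repr_smul_hahnRep ρ _).trans h0) i) j
  simp only [Matrix.sum_apply, Matrix.smul_apply, smul_eq_mul] at entry
  simp [entry]

variable {E : Λ → FDRep ℂ W} {d : Λ → ℕ} {ρ : ∀ l, MatRep R L (d l)}

section Finite

variable [Finite Λ]

theorem sum_klCoord_smul_hahnRep_inv (hL : ∀ i : B, 0 < L (cs.simple i)) (hE : IsIrrFamily E)
    (hρ : ∀ l, Corresponds (E l) (ρ l)) {x y : W} (hxy : ¬ leLR R L x y) {l : Λ}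
    (hy : hahnRep (ρ l) (klC R L y) ≠ 0) :
    ∑ w, AtoHahn R (klCoord R L (heckeT R L w) x) • hahnRep (ρ l) (heckeT R L w⁻¹) = 0 := by
  classical
  have := Fintype.ofFinite Λ
  have H := schurRelations_hahnRep hE hρ
  set f := fun l => KtoHahn R (schurElt (ρ l))
  set σ := fun l w => hahnRep (ρ l) (heckeT R L w)
  -- `Q` extends the coordinate of `h` at `C_x` to the Hecke algebra over the Hahn series field
  let Q := Fintype.linearCombination (HahnSeries Γ ℂ)
    (fun w => AtoHahn R (klCoord R L (heckeT R L w) x)) ∘ₗ fourierInv f σ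
  have Q_hahnRep (h : Hecke R L) :
      Q (fun l => hahnRep (ρ l) h) = AtoHahn R (klCoord R L h x) := by
    have fourier_eq : fourier σ (fun w => AtoHahn R ((heckeT R L).repr h w)) =
        fun l => hahnRep (ρ l) h :=
      funext fun l => sum_repr_smul_hahnRep (ρ l) h
    rw [← fourier_eq, LinearMap.comp_apply, H.fourierInv_fourier, ← sum_repr_mul_klCoord]
    simp only [Fintype.linearCombination_apply, smul_eq_mul, map_sum, map_mul]
  have Q_ideal (u v : W) : Q ((fun l => σ l u) * (fun l => hahnRep (ρ l) (klC R L y)) *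
      fun l => σ l v) = 0 := by
    have coord_eq_zero : klCoord R L (heckeT R L u * klC R L y * heckeT R L v) x = 0 :=
      by_contra fun h => hxy (mem_lowerIdeal.1 (mul_mem_lowerIdeal_right hL (heckeT R L v)
        (mul_mem_lowerIdeal_left hL (heckeT R L u) (klC_mem_lowerIdeal (leLR_refl y)))) x h)
    rw [← map_zero (AtoHahn R), ← coord_eq_zero, ← Q_hahnRep]
    simp only [map_mul]
    rfl
  ext i j : 2
  have sum_eq_zero := H.apply_single_eq_zero Q_ideal hy j i
  simp only [Q, LinearMap.comp_apply, Fintype.linearCombination_apply, fourierInv_single,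
    smul_eq_mul, mul_assoc, ← Finset.mul_sum] at sum_eq_zero
  simpa [Matrix.sum_apply, mul_comm] using
    (mul_eq_zero.1 sum_eq_zero).resolve_left (inv_ne_zero (H.ne_zero l))

theorem IsBalancedFamily.leLR_of_leadMatrix_ne_zero (H : IsBalancedFamily E ρ)
    (hL : ∀ i : B, 0 < L (cs.simple i)) {l : Λ} {x y : W} (hx : leadMatrix (ρ l) x⁻¹ ≠ 0)
    (hy : leadMatrix (ρ l) y ≠ 0) : leLR R L x y := by
  classical
  by_contra hxy
  refine hx (Matrix.ext fun i j => (FtoC R).injective ?_)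
  have sum_eq := congrFun (congrFun (sum_klCoord_smul_hahnRep_inv hL H.isIrrFamily H.corresponds hxy
    ((H.isBalanced l).hahnRep_klC_ne_zero hy)) i) j
  have coeff_mul (w : W) := coeff_add_mul_of_le_orderTop
    (orderTop_AtoHahn_klCoord_nonneg (R := R) (L := L) x w)
    ((H.isBalanced l).le_orderTop_hahnRep w⁻¹ i j)
  have coeff_eq := congrArg (HahnSeries.coeff · (0 + -aInv (ρ l))) sum_eq
  simp only [Matrix.sum_apply, Matrix.smul_apply, smul_eq_mul, HahnSeries.coeff_sum, coeff_mul,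
    coeff_zero_AtoHahn_klCoord] at coeff_eq
  rw [leadMatrix_apply, (H.isBalanced l).FtoC_leadMat, cs.length_inv]
  simpa using coeff_eq

theorem IsBalancedFamily.eqvLR_of_leadMatrix_ne_zero (H : IsBalancedFamily E ρ)
    (hL : ∀ i : B, 0 < L (cs.simple i)) {l : Λ} {x z : W} (hx : leadMatrix (ρ l) x ≠ 0)
    (hz : leadMatrix (ρ l) z⁻¹ ≠ 0) : eqvLR R L x z := by
  refine ⟨?_, H.leLR_of_leadMatrix_ne_zero hL hz hx⟩
  have := (H.leLR_of_leadMatrix_ne_zero hL (x := x⁻¹) (by rwa [inv_inv]) hz).inv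
  rwa [inv_inv, inv_inv] at this

end Finite

theorem IsBalancedFamily.eqvLR_of_gammaT_ne_zero [Fintype Λ] (H : IsBalancedFamily E ρ)
    (hL : ∀ i : B, 0 < L (cs.simple i)) {x y z : W} (h : gammaT ρ x y z⁻¹ ≠ 0) :
    eqvLR R L x z ∧ eqvLR R L y z := by
  rw [gammaT_eq_fourierInv, fourierInv_apply] at h
  obtain ⟨l, -, h⟩ := Finset.exists_ne_zero_of_sum_ne_zero h
  have prod_ne_zero : leadMatrix (ρ l) x * leadMatrix (ρ l) y * leadMatrix (ρ l) z⁻¹ ≠ 0 :=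
    fun h0 => h (by rw [h0, Matrix.trace_zero, mul_zero])
  have hz := right_ne_zero_of_mul prod_ne_zero
  have hxy := left_ne_zero_of_mul prod_ne_zero
  exact ⟨H.eqvLR_of_leadMatrix_ne_zero hL (left_ne_zero_of_mul hxy) hz,
    H.eqvLR_of_leadMatrix_ne_zero hL (right_ne_zero_of_mul hxy) hz⟩

end Cells

section GradedAction

variable {B W Γ : Type*} [Group W] [Fintype W] {M : CoxeterMatrix B} {cs : CoxeterSystem M W}
  [AddCommGroup Γ] [LinearOrder Γ] [IsOrderedAddMonoid Γ] {R : Subring ℂ} {L : WeightFunction cs Γ}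

theorem klCoord_mul_mul_klC (h h' : Hecke R L) (w z : W) : klCoord R L (h * h' * klC R L w) z =
    ∑ u, klCoord R L (h * klC R L u) z * klCoord R L (h' * klC R L w) u := by
  rw [mul_assoc, ← sum_klCoord_smul_klC (h' * klC R L w), Finset.mul_sum, sum_klCoord_smul_klC]
  simp only [klCoord_eq, mul_smul_comm, map_sum, map_smul, Finsupp.finsetSum_apply,
    Finsupp.smul_apply, smul_eq_mul, mul_comm]

theorem klCoord_mul_klC (h : Hecke R L) (w z : W) :
    klCoord R L (h * klC R L w) z = ∑ x, klCoord R L h x * hConst R L x w z := by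
  conv_lhs => rw [← sum_klCoord_smul_klC h]
  simp only [hConst, klCoord_eq, Finset.sum_mul, smul_mul_assoc, map_sum, map_smul,
    Finsupp.finsetSum_apply, Finsupp.smul_apply, smul_eq_mul]

variable (R L) in
open scoped Classical in
/-- The matrix coefficients of left multiplication on the associated graded module of the
filtration of the Hecke algebra by two-sided ideals `lowerIdeal R L w`, with respect to the basis
of the classes of the `C_w`. -/
def grCoeff (z w : W) : Hecke R L →ₗ[AddMonoidAlgebra R Γ] AddMonoidAlgebra R Γ :=
  if eqvLR R L z w then (klBasis R L).coord z ∘ₗ LinearMap.mulRight _ (klC R L w) else 0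

theorem grCoeff_of_eqvLR {z w : W} (hzw : eqvLR R L z w) (h : Hecke R L) :
    grCoeff R L z w h = klCoord R L (h * klC R L w) z := by
  rw [grCoeff, if_pos hzw, klCoord_eq]
  rfl

theorem grCoeff_of_not_eqvLR {z w : W} (hzw : ¬ eqvLR R L z w) (h : Hecke R L) :
    grCoeff R L z w h = 0 := by
  rw [grCoeff, if_neg hzw, LinearMap.zero_apply]

theorem grCoeff_one [DecidableEq W] (z w : W) : grCoeff R L z w 1 = if z = w then 1 else 0 := by
  by_cases hzw : eqvLR R L z w
  · rw [grCoeff_of_eqvLR hzw, one_mul, klCoord_klC, Finsupp.single_apply]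
    simp only [eq_comm]
  · rw [grCoeff_of_not_eqvLR hzw, if_neg]
    rintro rfl
    exact hzw (eqvLR_refl z)

theorem grCoeff_mul (hL : ∀ i : B, 0 < L (cs.simple i)) (h h' : Hecke R L) (z w : W) :
    grCoeff R L z w (h * h') = ∑ u, grCoeff R L z u h * grCoeff R L u w h' := by
  by_cases hzw : eqvLR R L z w
  · rw [grCoeff_of_eqvLR hzw, klCoord_mul_mul_klC]
    refine Finset.sum_congr rfl fun u _ => ?_
    by_cases huw : eqvLR R L u w
    · rw [grCoeff_of_eqvLR huw, grCoeff_of_eqvLR (hzw.trans huw.symm)]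
    · rw [grCoeff_of_not_eqvLR huw, mul_zero]
      by_contra hne
      have z_le_u := leLR_of_klCoord_mul_ne_zero hL (left_ne_zero_of_mul hne)
      have u_le_w := leLR_of_klCoord_mul_ne_zero hL (right_ne_zero_of_mul hne)
      exact huw ⟨u_le_w, hzw.2.trans z_le_u⟩
  · rw [grCoeff_of_not_eqvLR hzw, Finset.sum_eq_zero]
    intro u _
    by_cases hzu : eqvLR R L z u
    · rw [grCoeff_of_not_eqvLR (fun huw => hzw (hzu.trans huw)), mul_zero]
    · rw [grCoeff_of_not_eqvLR hzu, zero_mul]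

end GradedAction

section AsymptoticRing

variable {B W Γ Λ : Type*} [Group W] [Fintype W] {M : CoxeterMatrix B} {cs : CoxeterSystem M W}
  [AddCommGroup Γ] [LinearOrder Γ] [IsOrderedAddMonoid Γ] {R : Subring ℂ} {L : WeightFunction cs Γ}
  [Fintype Λ] {d : Λ → ℕ} {ρ : ∀ l, MatRep R L (d l)}

instance : IsScalarTower (AddMonoidAlgebra R Γ) (KField Γ R) (JTilde ρ) :=
  inferInstanceAs (IsScalarTower _ _ (W → KField Γ R))

variable (ρ) in
/-- The basis `t_w` of `K ⊗_F J̃`. -/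
def tBasis : Module.Basis W (KField Γ R) (JTilde ρ) :=
  Module.Basis.ofEquivFun (LinearEquiv.refl _ (W → KField Γ R))

theorem tBasis_apply (w : W) : tBasis ρ w = tElt ρ w := by
  classical
  funext z
  exact Pi.single_apply w (1 : KField Γ R) z

theorem tBasis_repr_mul (a b : JTilde ρ) (z : W) : (tBasis ρ).repr (a * b) z =
    ∑ x, ∑ y, (tBasis ρ).repr a x * (tBasis ρ).repr b y * FtoK R (gammaT ρ x y z⁻¹) :=
  rfl

instance : IsScalarTower (KField Γ R) (JTilde ρ) (JTilde ρ) where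
  smul_assoc c a b := (tBasis ρ).ext_elem fun z => by
    simp only [smul_eq_mul, tBasis_repr_mul, map_smul, Finsupp.smul_apply, Finset.mul_sum,
      mul_assoc]

instance : SMulCommClass (KField Γ R) (JTilde ρ) (JTilde ρ) where
  smul_comm c a b := (tBasis ρ).ext_elem fun z => by
    simp only [smul_eq_mul, tBasis_repr_mul, map_smul, Finsupp.smul_apply, Finset.mul_sum,
      mul_assoc, mul_left_comm c]

theorem tElt_mul_tElt (x y : W) :
    tElt ρ x * tElt ρ y = ∑ z, FtoK (Γ := Γ) R (gammaT ρ x y z⁻¹) • tElt ρ z := by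
  classical
  refine (tBasis ρ).ext_elem fun z => ?_
  simp [tBasis_repr_mul, ← tBasis_apply, Finsupp.single_apply]

theorem oneJ_eq_sum : oneJ ρ = ∑ w, FtoK (Γ := Γ) R (nT ρ w) • tElt ρ w := by
  refine Finset.sum_subset (Finset.subset_univ _) fun w _ hw => ?_
  rw [setD, Finset.mem_filter, not_and, not_not] at hw
  rw [hw (Finset.mem_univ w), map_zero, zero_smul]

theorem tBasis_repr_eq_zero_of_mem_lowerSpan {v : JTilde ρ} {w z : W} (hv : v ∈ lowerSpan ρ w)
    (hz : eqvLR R L z w) : (tBasis ρ).repr v z = 0 := by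
  have le_ker : lowerSpan ρ w ≤
      (((tBasis ρ).coord z).restrictScalars (AddMonoidAlgebra R Γ)).ker := by
    rw [lowerSpan, Submodule.span_le]
    rintro _ ⟨y, hy, rfl⟩
    have hne : y ≠ z := by
      rintro rfl
      exact hy.2 hz
    simp [← tBasis_apply, hne]
  exact le_ker hv

variable {E : Λ → FDRep ℂ W}

theorem IsBalancedFamily.oneJ_mul (H : IsBalancedFamily E ρ) (v : JTilde ρ) : oneJ ρ * v = v := by
  classical
  have mulLeft_eq : LinearMap.mulLeft (KField Γ R) (oneJ ρ) = LinearMap.id := by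
    refine (tBasis ρ).ext fun y => ?_
    simp only [tBasis_apply, LinearMap.mulLeft_apply, LinearMap.id_apply, oneJ_eq_sum,
      Finset.sum_mul, smul_mul_assoc, tElt_mul_tElt, Finset.smul_sum, smul_smul, ← map_mul]
    rw [Finset.sum_comm]
    simp only [← Finset.sum_smul, ← map_sum, H.sum_nT_mul_gammaT]
    simp
  exact LinearMap.congr_fun mulLeft_eq v

theorem IsBalancedFamily.mul_oneJ (H : IsBalancedFamily E ρ) (v : JTilde ρ) : v * oneJ ρ = v := by
  classical
  have mulRight_eq : LinearMap.mulRight (KField Γ R) (oneJ ρ) = LinearMap.id := by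
    refine (tBasis ρ).ext fun y => ?_
    simp only [tBasis_apply, LinearMap.mulRight_apply, LinearMap.id_apply, oneJ_eq_sum,
      Finset.mul_sum, mul_smul_comm, tElt_mul_tElt, Finset.smul_sum, smul_smul, ← map_mul]
    rw [Finset.sum_comm]
    simp only [← Finset.sum_smul, ← map_sum, H.sum_nT_mul_gammaT_right]
    simp
  exact LinearMap.congr_fun mulRight_eq v

theorem IsBalancedFamily.ext_mul_tElt (H : IsBalancedFamily E ρ) {a b : JTilde ρ}
    (h : ∀ w, a * tElt ρ w = b * tElt ρ w) : a = b := by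
  rw [← H.mul_oneJ a, ← H.mul_oneJ b]
  simp only [oneJ_eq_sum, Finset.mul_sum, mul_smul_comm, h]

theorem IsBalanced.exists_algebraMap_eq_trace_leadMatrix {n : ℕ} {V : FDRep ℂ W}
    {τ : MatRep R L n} (hb : IsBalanced τ) (hτ : Corresponds V τ) (w : W) :
    ∃ r : R, algebraMap R (FractionRing R) r = (leadMatrix τ w).trace := by
  obtain ⟨a, ha, -⟩ := hτ.2 w
  refine ⟨(-1) ^ cs.length w * a.coeff (-aInv τ), (FtoC R).injective ?_⟩
  have trace_eq : AtoHahn R a = (hahnRep τ (heckeT R L w)).trace := by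
    rw [trace_hahnRep, ← ha, KtoHahn_algebraMap]
  simp only [Matrix.trace, Matrix.diag_apply, leadMatrix_apply, map_sum, hb.FtoC_leadMat]
  rw [← Finset.mul_sum, ← HahnSeries.coeff_sum, FtoC_algebraMap]
  push_cast
  rw [← coeff_AtoHahn, trace_eq]
  rfl

theorem IsBalancedFamily.exists_algebraMap_eq_FtoK_nT (H : IsBalancedFamily E ρ)
    (hf : ∀ l, ∃ u : Rˣ, algebraMap R (FractionRing R) u = fInv (ρ l))
    (w : W) : ∃ a, algebraMap (AddMonoidAlgebra R Γ) (KField Γ R) a = FtoK R (nT ρ w) := by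
  suffices ∃ r : R, algebraMap R (FractionRing R) r = nT ρ w by
    obtain ⟨r, hr⟩ := this
    exact ⟨_, by rw [← hr, FtoK_algebraMap]⟩
  rw [nT_eq_fourierInv, fourierInv_apply]
  refine sum_mem (S := (algebraMap R (FractionRing R)).range) fun l _ => ?_
  obtain ⟨u, hu⟩ := hf l
  have hu' : (fInv (ρ l))⁻¹ = algebraMap R (FractionRing R) (u⁻¹ : Rˣ) :=
    inv_eq_of_mul_eq_one_left (by rw [← hu, ← map_mul, Units.inv_mul, map_one])
  rw [Pi.one_apply, one_mul, hu']
  exact mul_mem ⟨_, rfl⟩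
    ((H.isBalanced l).exists_algebraMap_eq_trace_leadMatrix (H.corresponds l) w⁻¹)

end AsymptoticRing

section LusztigHomomorphism

variable {B W Γ Λ : Type*} [Group W] [Fintype W] {M : CoxeterMatrix B} {cs : CoxeterSystem M W}
  [AddCommGroup Γ] [LinearOrder Γ] [IsOrderedAddMonoid Γ] {R : Subring ℂ} {L : WeightFunction cs Γ}
  [Fintype Λ] {d : Λ → ℕ} {ρ : ∀ l, MatRep R L (d l)}

variable (ρ) in
/-- The action of the Hecke algebra on the associated graded module of the filtration by two-sided
ideals `lowerIdeal R L w`, transported to `K ⊗_F J̃` via `C_w ↔ t_w`. -/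
def grAct : Hecke R L →ₗ[AddMonoidAlgebra R Γ] Module.End (KField Γ R) (JTilde ρ) :=
  ∑ w, ∑ z, (grCoeff R L z w).smulRight (((tBasis ρ).coord w).smulRight (tElt ρ z))

theorem grAct_tElt (h : Hecke R L) (w : W) :
    grAct ρ h (tElt ρ w) = ∑ z, grCoeff R L z w h • tElt ρ z := by
  classical
  simp [grAct, ← tBasis_apply, Finsupp.single_apply, LinearMap.sum_apply]

theorem grAct_one : grAct ρ 1 = 1 := by
  classical
  refine (tBasis ρ).ext fun w => ?_
  simp [tBasis_apply, grAct_tElt, grCoeff_one]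

theorem grAct_mul (hL : ∀ i : B, 0 < L (cs.simple i)) (h h' : Hecke R L) :
    grAct ρ (h * h') = grAct ρ h * grAct ρ h' := by
  refine (tBasis ρ).ext fun w => ?_
  simp only [Module.End.mul_apply, tBasis_apply, grAct_tElt, grCoeff_mul hL, map_sum,
    LinearMap.map_smul_of_tower, Finset.smul_sum, smul_smul, Finset.sum_smul]
  rw [Finset.sum_comm]
  simp only [mul_comm]

theorem tBasis_repr_sum_smul (a : W → AddMonoidAlgebra R Γ) (z : W) :
    (tBasis ρ).repr (∑ w, a w • tElt ρ w) z =
      algebraMap (AddMonoidAlgebra R Γ) (KField Γ R) (a z) := by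
  have smul_eq (w : W) : a w • tElt ρ w =
      algebraMap (AddMonoidAlgebra R Γ) (KField Γ R) (a w) • tBasis ρ w := by
    rw [tBasis_apply, algebraMap_smul]
  simp only [smul_eq, Module.Basis.repr_sum_self]

theorem P15Tilde.sum_gammaT_mul_klCoord (hP : P15Tilde ρ) (h : Hecke R L) {x y w : W}
    (hwy : eqvLR R L w y) :
    ∑ u, FtoK R (gammaT ρ w x u⁻¹) *
        algebraMap (AddMonoidAlgebra R Γ) (KField Γ R) (klCoord R L (h * klC R L u) y) =
      ∑ u, algebraMap (AddMonoidAlgebra R Γ) (KField Γ R) (klCoord R L (h * klC R L w) u) *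
        FtoK R (gammaT ρ u x y⁻¹) := by
  simp only [klCoord_mul_klC, map_sum, map_mul, Finset.mul_sum, Finset.sum_mul]
  rw [Finset.sum_comm]
  conv_rhs => rw [Finset.sum_comm]
  refine Finset.sum_congr rfl fun v _ => ?_
  simp only [mul_assoc, mul_left_comm (FtoK R _)]
  rw [← Finset.mul_sum, ← Finset.mul_sum, hP v x y w hwy]

variable {E : Λ → FDRep ℂ W}

theorem IsBalancedFamily.sum_gammaT_mul_grCoeff (H : IsBalancedFamily E ρ)
    (hL : ∀ i : B, 0 < L (cs.simple i)) (hP : P15Tilde ρ) (h : Hecke R L) (w x z : W) :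
    ∑ u, FtoK R (gammaT ρ w x u⁻¹) *
        algebraMap (AddMonoidAlgebra R Γ) (KField Γ R) (grCoeff R L z u h) =
      ∑ u, algebraMap (AddMonoidAlgebra R Γ) (KField Γ R) (grCoeff R L u w h) *
        FtoK R (gammaT ρ u x z⁻¹) := by
  by_cases hwz : eqvLR R L w z
  · convert hP.sum_gammaT_mul_klCoord h hwz using 2 with u _ u _
    · by_cases h0 : gammaT ρ w x u⁻¹ = 0
      · rw [h0, map_zero, zero_mul, zero_mul]
      · rw [grCoeff_of_eqvLR (hwz.symm.trans (H.eqvLR_of_gammaT_ne_zero hL h0).1)]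
    · by_cases h0 : gammaT ρ u x z⁻¹ = 0
      · rw [h0, map_zero, mul_zero, mul_zero]
      · rw [grCoeff_of_eqvLR ((H.eqvLR_of_gammaT_ne_zero hL h0).1.trans hwz.symm)]
  · rw [Finset.sum_eq_zero, Finset.sum_eq_zero]
    · intro u _
      by_cases h0 : gammaT ρ u x z⁻¹ = 0
      · rw [h0, map_zero, mul_zero]
      · rw [grCoeff_of_not_eqvLR fun huw =>
          hwz (huw.symm.trans (H.eqvLR_of_gammaT_ne_zero hL h0).1), map_zero, zero_mul]
    · intro u _
      by_cases h0 : gammaT ρ w x u⁻¹ = 0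
      · rw [h0, map_zero, zero_mul]
      · rw [grCoeff_of_not_eqvLR fun hzu =>
          hwz ((H.eqvLR_of_gammaT_ne_zero hL h0).1.trans hzu.symm), map_zero, mul_zero]

theorem IsBalancedFamily.grAct_mul_right (H : IsBalancedFamily E ρ)
    (hL : ∀ i : B, 0 < L (cs.simple i)) (hP : P15Tilde ρ) (h : Hecke R L) (a b : JTilde ρ) :
    grAct ρ h (a * b) = grAct ρ h a * b := by
  have tElt_case (w x : W) : grAct ρ h (tElt ρ w * tElt ρ x) = grAct ρ h (tElt ρ w) * tElt ρ x := by
    simp only [tElt_mul_tElt, map_sum, map_smul, grAct_tElt, Finset.sum_mul, Finset.smul_sum,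
      algebra_compatible_smul (KField Γ R) (grCoeff R L _ _ h), smul_mul_assoc, smul_smul]
    rw [Finset.sum_comm]
    conv_rhs => rw [Finset.sum_comm]
    simp only [← Finset.sum_smul, H.sum_gammaT_mul_grCoeff hL hP]
  rw [← (tBasis ρ).sum_repr a, ← (tBasis ρ).sum_repr b]
  simp only [Finset.sum_mul, Finset.mul_sum, smul_mul_assoc, mul_smul_comm, map_sum, map_smul,
    tBasis_apply, tElt_case]

/-- Lusztig's homomorphism `φ`: the element `φ(h)` is the result of the graded action `grAct` of `h`
on the identity element. -/
def lusztigHom (H : IsBalancedFamily E ρ) (hL : ∀ i : B, 0 < L (cs.simple i))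
    (hP : P15Tilde ρ) : Hecke R L →ₙₐ[AddMonoidAlgebra R Γ] JTilde ρ where
  toFun h := grAct ρ h (oneJ ρ)
  map_smul' a h := by rw [map_smul]; rfl
  map_zero' := by rw [map_zero, LinearMap.zero_apply]
  map_add' h h' := by rw [map_add, LinearMap.add_apply]
  map_mul' h h' := by
    rw [← H.grAct_mul_right hL hP, H.oneJ_mul, grAct_mul hL, Module.End.mul_apply]

theorem lusztigHom_apply (H : IsBalancedFamily E ρ) (hL : ∀ i : B, 0 < L (cs.simple i))
    (hP : P15Tilde ρ) (h : Hecke R L) : lusztigHom H hL hP h = grAct ρ h (oneJ ρ) :=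
  rfl

theorem lusztigHom_mul_tElt (H : IsBalancedFamily E ρ) (hL : ∀ i : B, 0 < L (cs.simple i))
    (hP : P15Tilde ρ) (h : Hecke R L) (w : W) :
    lusztigHom H hL hP h * tElt ρ w = grAct ρ h (tElt ρ w) := by
  rw [lusztigHom_apply, ← H.grAct_mul_right hL hP, H.oneJ_mul]

theorem grAct_tElt_sub_actT_mem_lowerSpan (hL : ∀ i : B, 0 < L (cs.simple i)) (h : Hecke R L)
    (w : W) : grAct ρ h (tElt ρ w) - actT ρ h w ∈ lowerSpan ρ w := by
  rw [grAct_tElt, actT, ← Finset.sum_sub_distrib]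
  refine sum_mem fun z _ => ?_
  by_cases hzw : eqvLR R L z w
  · rw [grCoeff_of_eqvLR hzw, sub_self]
    exact zero_mem _
  rw [grCoeff_of_not_eqvLR hzw, zero_smul, zero_sub]
  refine neg_mem ?_
  by_cases h0 : klCoord R L (h * klC R L w) z = 0
  · rw [h0, zero_smul]
    exact zero_mem _
  · exact Submodule.smul_mem _ _
      (Submodule.subset_span ⟨z, ⟨leLR_of_klCoord_mul_ne_zero hL h0, hzw⟩, rfl⟩)

theorem isLusztigHom_lusztigHom (H : IsBalancedFamily E ρ) (hL : ∀ i : B, 0 < L (cs.simple i))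
    (hP : P15Tilde ρ) (hf : ∀ l, ∃ u : Rˣ, algebraMap R (FractionRing R) u = fInv (ρ l)) :
    IsLusztigHom ρ (lusztigHom H hL hP) where
  map_one := by rw [lusztigHom_apply, grAct_one, Module.End.one_apply]
  mem_JA h := by
    rw [lusztigHom_apply, oneJ_eq_sum, map_sum]
    refine sum_mem fun w _ => ?_
    obtain ⟨a, ha⟩ := H.exists_algebraMap_eq_FtoK_nT hf w
    rw [map_smul, ← ha, algebraMap_smul, grAct_tElt]
    exact Submodule.smul_mem _ _ (sum_mem fun z _ =>
      Submodule.smul_mem _ _ (Submodule.subset_span ⟨z, rfl⟩))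
  sub_mem h w := by
    rw [lusztigHom_mul_tElt]
    exact grAct_tElt_sub_actT_mem_lowerSpan hL h w

theorem IsBalancedFamily.tBasis_repr_mul_tElt_eq_zero (H : IsBalancedFamily E ρ)
    (hL : ∀ i : B, 0 < L (cs.simple i)) (a : JTilde ρ) {z w : W} (hzw : ¬ eqvLR R L z w) :
    (tBasis ρ).repr (a * tElt ρ w) z = 0 := by
  classical
  have gammaT_eq_zero (x : W) : gammaT ρ x w z⁻¹ = 0 :=
    by_contra fun h0 => hzw (H.eqvLR_of_gammaT_ne_zero hL h0).2.symm
  simp [tBasis_repr_mul, ← tBasis_apply, Finsupp.single_apply, gammaT_eq_zero]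

theorem IsLusztigHom.eq_lusztigHom (H : IsBalancedFamily E ρ)
    (hL : ∀ i : B, 0 < L (cs.simple i)) (hP : P15Tilde ρ)
    {ψ : Hecke R L →ₙₐ[AddMonoidAlgebra R Γ] JTilde ρ} (hψ : IsLusztigHom ρ ψ) :
    ψ = lusztigHom H hL hP := by
  refine NonUnitalAlgHom.ext fun h => H.ext_mul_tElt fun w => ?_
  refine (tBasis ρ).ext_elem fun z => ?_
  rw [lusztigHom_mul_tElt, grAct_tElt, tBasis_repr_sum_smul]
  by_cases hzw : eqvLR R L z w
  · have repr_eq := tBasis_repr_eq_zero_of_mem_lowerSpan (hψ.sub_mem h w) hzw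
    rw [map_sub, Finsupp.sub_apply, sub_eq_zero] at repr_eq
    rw [repr_eq, grCoeff_of_eqvLR hzw, actT, tBasis_repr_sum_smul]
  · rw [grCoeff_of_not_eqvLR hzw, map_zero]
    exact H.tBasis_repr_mul_tElt_eq_zero hL _ hzw

theorem lusztigHom_klC (H : IsBalancedFamily E ρ) (hL : ∀ i : B, 0 < L (cs.simple i))
    (hP : P15Tilde ρ) (w : W) : lusztigHom H hL hP (klC R L w) =
      ∑ δ ∈ setD ρ, ∑ z : W, open scoped Classical in if eqvLR R L z δ then
        (algebraMap (AddMonoidAlgebra R Γ) (KField Γ R) (hConst R L w δ z) *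
          FtoK R (nT ρ δ)) • tElt ρ z else 0 := by
  rw [lusztigHom_apply, oneJ, map_sum]
  refine Finset.sum_congr rfl fun δ _ => ?_
  rw [map_smul, grAct_tElt, Finset.smul_sum]
  refine Finset.sum_congr rfl fun z _ => ?_
  split_ifs with hzδ
  · rw [grCoeff_of_eqvLR hzδ, ← algebraMap_smul (KField Γ R) (klCoord R L _ z), smul_smul,
      mul_comm]
    rfl
  · rw [grCoeff_of_not_eqvLR hzδ, zero_smul, smul_zero]

end LusztigHomomorphism

end KLAsym

end

theorem theorem5p2 {B W Γ Λ : Type*} [Group W] [Fintype W] {M : CoxeterMatrix B}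
    (cs : CoxeterSystem M W)
    [AddCommGroup Γ] [LinearOrder Γ] [IsOrderedAddMonoid Γ]
    (L : WeightFunction cs Γ) (hL : ∀ i : B, 0 < L (cs.simple i))
    (R : Subring ℂ)
    [Fintype Λ] (E : Λ → FDRep ℂ W) (hE : IsIrrFamily E)
    (d : Λ → ℕ) (ρ : ∀ l : Λ, MatRep R L (d l))
    (hρ : ∀ l : Λ, Corresponds (E l) (ρ l)) (hbal : ∀ l : Λ, IsBalanced (ρ l))
    (hR : IsLGood ρ) (hP15 : P15Tilde ρ) :
    ∃ φ : Hecke R L →ₙₐ[AddMonoidAlgebra R Γ] JTilde ρ,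
      IsLusztigHom ρ φ ∧
      (∀ ψ : Hecke R L →ₙₐ[AddMonoidAlgebra R Γ] JTilde ρ, IsLusztigHom ρ ψ → ψ = φ) ∧
      ∀ w : W, φ (klC R L w) =
        ∑ δ ∈ setD ρ, ∑ z : W, open scoped Classical in
          if eqvLR R L z δ then
            (algebraMap (AddMonoidAlgebra R Γ) (KField Γ R) (hConst R L w δ z) *
              FtoK R (nT ρ δ)) • tElt ρ z
          else 0 := by
  have H : IsBalancedFamily E ρ := ⟨hE, hρ, hbal⟩
  exact ⟨lusztigHom H hL hP15, isLusztigHom_lusztigHom H hL hP15 hR.2,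
    fun _ hψ => hψ.eq_lusztigHom H hL hP15, lusztigHom_klC H hL hP15⟩
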